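/- Let $\Omega\subset\mathbb R^3$ be a bounded Lipschitz domain, i.e. a bounded, open, connected, nonempty set such that every $\mathrm x\in\partial\Omega$ has an open neighbourhood $U$ and a bi-Lipschitz map $\phi$ from $U$ onto an open cube $aK$ centred at $0$ ($a>0$, $K=(-\tfrac12,\tfrac12)^3$) with $\phi(\mathrm x)=0$ and $\phi(\Omega\cap U)=a\{y\in K: y_3<0\}$. Let $\omega$ be the boundary (two-dimensional Hausdorff) measure, let $\Gamma_D\subset\partial\Omega$ be closed and $\Gamma_N=\partial\Omega\setminus\Gamma_D$, with $L^{\mathfrak p}(\Gamma_N)$ taken with respect to $\omega$. Let $J=(T_0,T_1)$ with $T_0<T_1$, let $2<p<\infty$, and consider the real Banach space $$\mathbb U=W^{1,2}(J;L^2(\Gamma_N))\cap L^p(J;L^p(\Gamma_N)),\qquad \|u\|_{\mathbb U}=\|u\|_{W^{1,2}(J;L^2(\Gamma_N))}+\|u\|_{L^p(J;L^p(\Gamma_N))}.$$ For $r\in(1,\infty)$ let $W^{1,r}_{\Gamma_D}(\Omega)$ be the closure in $W^{1,r}(\Omega)$ of $\{\psi|_\Omega:\psi\in C_c^\infty(\mathbb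 R^3),\ \operatorname{supp}\psi\cap\Gamma_D=\emptyset\}$, and for $q\in(1,\infty)$, $\tfrac1q+\tfrac1{q'}=1$, let $W^{-1,q}_{\Gamma_D}$ be the dual space of $W^{1,q'}_{\Gamma_D}(\Omega)$. An embedding is a continuous linear injection. (i) For every $\mathfrak p$ with $2<\mathfrak p<\frac{p+2}{2}$ there is $\varrho\in(0,1)$ such that $\mathbb U$ embeds into the Hölder space $C^\varrho(\overline J;L^{\mathfrak p}(\Gamma_N))$, the embedding mapping $u$ to its continuous representative. (ii) For every $q\in(1,\infty)$ with $p>\frac43q-2$ and every $s\in[1,\infty]$ there is a compact embedding $\mathcal E:\mathbb U\hookrightarrow L^s(J;W^{-1,q}_{\Gamma_D})$, namely the one for which, for almost every $t\in J$, $$\langle(\mathcal E u)(t),\psi|_\Omega\rangle=\int_{\Gamma_N}u(t)\,\psi\,d\omega\qquad\text{for all }\psi\in C_c^\infty(\mathbb R^3)\text{ with }\operatorname{supp}\psi\cap\Gamma_D=\emptyset.$$ -/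

import Mathlib

open MeasureTheory Set
open scoped ENNReal NNReal ContDiff

noncomputable section

namespace Thermistor

/-! ### Geometry in three dimensions -/

/-- Three-dimensional Euclidean space. -/
abbrev E3 : Type := EuclideanSpace ℝ (Fin 3)

/-- `a K`, where `K` is the open unit cube centred at the origin. -/
def cube (a : ℝ) : Set E3 := {x | ∀ i, |x i| < a / 2}

/-- `a K₋`, the lower half of the cube `a K`. -/
def lowerHalfCube (a : ℝ) : Set E3 := {x | x ∈ cube a ∧ x 2 < 0}

/-- Bounded Lipschitz domain: a bounded, open, connected, nonempty set such that each boundary point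
has an open neighbourhood `U` and a bi-Lipschitz map `φ` of `U` onto a cube `a K` that sends the
point to the origin and `Ω ∩ U` onto the lower half cube. (This is weaker than being locally the
subgraph of a Lipschitz function.) -/
structure IsBoundedLipschitzDomain (Ω : Set E3) : Prop where
  isOpen : IsOpen Ω
  isConnected : IsConnected Ω
  isBounded : Bornology.IsBounded Ω
  chart : ∀ x ∈ frontier Ω, ∃ (U : Set E3) (a : ℝ) (φ : E3 → E3) (L : ℝ≥0),
    IsOpen U ∧ x ∈ U ∧ 0 < a ∧ LipschitzOnWith L φ U ∧
    (∀ y ∈ U, ∀ z ∈ U, dist y z ≤ L * dist (φ y) (φ z)) ∧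
    φ '' U = cube a ∧ φ x = 0 ∧ φ '' (Ω ∩ U) = lowerHalfCube a

/-- The Neumann part `Γ_N = ∂Ω \ Γ_D` of the boundary. -/
def neumannPart (Ω ΓD : Set E3) : Set E3 := frontier Ω \ ΓD

/-- The boundary measure `ω` (the two-dimensional Hausdorff measure, normalised to be Lebesgue
measure on planes) on `Γ_N`. -/
def boundaryMeasure (Ω ΓD : Set E3) : Measure E3 :=
  (μHE[2] : Measure E3).restrict (neumannPart Ω ΓD)

/-! ### The Sobolev spaces `W^{1,r}(Ω)`, `W^{1,r}_Ξ(Ω)` and the dual space -/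

/-- Smooth compactly supported functions on the whole space whose support does not meet `Ξ`. -/
def IsTestFunctionOff (Ξ : Set E3) (ψ : E3 → ℝ) : Prop :=
  ContDiff ℝ ∞ ψ ∧ HasCompactSupport ψ ∧ Disjoint (tsupport ψ) Ξ

/-- The `i`-th partial derivative. -/
def partialDeriv (i : Fin 3) (ψ : E3 → ℝ) (x : E3) : ℝ :=
  fderiv ℝ ψ x (EuclideanSpace.single i 1)

/-- `g` is the weak gradient of `f` on `Ω`. -/
def IsWeakGradient (Ω : Set E3) (f : E3 → ℝ) (g : E3 → E3) : Prop :=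
  ∀ φ : E3 → ℝ, ContDiff ℝ ∞ φ → HasCompactSupport φ → tsupport φ ⊆ Ω → ∀ i : Fin 3,
    ∫ x in Ω, partialDeriv i φ x * f x = -∫ x in Ω, φ x * g x i

lemma IsTestFunctionOff.add {Ξ : Set E3} {ψ₁ ψ₂ : E3 → ℝ} (h₁ : IsTestFunctionOff Ξ ψ₁)
    (h₂ : IsTestFunctionOff Ξ ψ₂) : IsTestFunctionOff Ξ (ψ₁ + ψ₂) :=
  ⟨h₁.1.add h₂.1, h₁.2.1.add h₂.2.1,
    (Set.disjoint_union_left.2 ⟨h₁.2.2, h₂.2.2⟩).mono_left (tsupport_add ψ₁ ψ₂)⟩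

lemma IsTestFunctionOff.smul {Ξ : Set E3} {ψ : E3 → ℝ} (c : ℝ) (h : IsTestFunctionOff Ξ ψ) :
    IsTestFunctionOff Ξ (c • ψ) :=
  ⟨contDiff_const.smul h.1, h.2.1.smul_left (f := fun _ => c),
    h.2.2.mono_left (closure_mono (Function.support_const_smul_subset c ψ))⟩

lemma IsTestFunctionOff.zero (Ξ : Set E3) : IsTestFunctionOff Ξ 0 :=
  ⟨contDiff_const, HasCompactSupport.zero, by simp [tsupport]⟩

lemma partialDeriv_add (i : Fin 3) {ψ₁ ψ₂ : E3 → ℝ} (h₁ : ContDiff ℝ ∞ ψ₁) (h₂ : ContDiff ℝ ∞ ψ₂)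
    (x : E3) : partialDeriv i (ψ₁ + ψ₂) x = partialDeriv i ψ₁ x + partialDeriv i ψ₂ x := by
  unfold partialDeriv
  rw [fderiv_add (h₁.differentiable (by simp) x) (h₂.differentiable (by simp) x)]
  rfl

lemma partialDeriv_smul (i : Fin 3) (c : ℝ) {ψ : E3 → ℝ} (h : ContDiff ℝ ∞ ψ)
    (x : E3) : partialDeriv i (c • ψ) x = c * partialDeriv i ψ x := by
  unfold partialDeriv
  rw [fderiv_const_smul (h.differentiable (by simp) x)]
  rfl

lemma integrable_mul_of_Lp {Ω : Set E3} {r : ℝ≥0∞} (hr : 1 ≤ r) {f : E3 → ℝ}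
    (hf : MemLp f r (volume.restrict Ω)) {φ : E3 → ℝ} (hφ : Continuous φ)
    (hc : HasCompactSupport φ) : IntegrableOn (fun x => φ x * f x) Ω :=
  (hf.locallyIntegrable hr).integrable_smul_left_of_hasCompactSupport hφ hc

lemma continuous_partialDeriv (i : Fin 3) {φ : E3 → ℝ} (h : ContDiff ℝ ∞ φ) :
    Continuous (partialDeriv i φ) :=
  (h.continuous_fderiv (by simp)).clm_apply continuous_const

lemma hasCompactSupport_partialDeriv (i : Fin 3) {φ : E3 → ℝ} (h : HasCompactSupport φ) :
    HasCompactSupport (partialDeriv i φ) :=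
  h.fderiv_apply ℝ _

lemma memLp_coord {Ω : Set E3} {r : ℝ≥0∞} {g : E3 → E3} (hg : MemLp g r (volume.restrict Ω))
    (i : Fin 3) : MemLp (fun x => g x i) r (volume.restrict Ω) :=
  (EuclideanSpace.proj i : E3 →L[ℝ] ℝ).comp_memLp' hg

/-- The Sobolev space `W^{1,r}(Ω)` as a subspace: pairs `(f, g)` with `f ∈ L^r(Ω)` and with weak gradient
`g ∈ L^r(Ω; ℝ³)`. The norm is `(‖f‖_r ^ r + ‖∇f‖_r ^ r) ^ (1/r)`. -/
def sobolevSubmodule (Ω : Set E3) (r : ℝ≥0∞) [hr : Fact (1 ≤ r)] :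
    Submodule ℝ (WithLp r (Lp ℝ r (volume.restrict Ω) × Lp E3 r (volume.restrict Ω))) where
  carrier := {w | IsWeakGradient Ω w.fst w.snd}
  zero_mem' := by
    intro φ _ _ _ i
    have h1 : ∫ x in Ω, partialDeriv i φ x * (0 : Lp ℝ r (volume.restrict Ω)) x = 0 := by
      refine integral_eq_zero_of_ae ?_
      filter_upwards [Lp.coeFn_zero ℝ r (volume.restrict Ω)] with x hx
      simp only [hx, Pi.zero_apply, mul_zero]
    have h2 : ∫ x in Ω, φ x * (0 : Lp E3 r (volume.restrict Ω)) x i = 0 := by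
      refine integral_eq_zero_of_ae ?_
      filter_upwards [Lp.coeFn_zero E3 r (volume.restrict Ω)] with x hx
      simp only [hx, Pi.zero_apply, PiLp.zero_apply, mul_zero]
    simp only [WithLp.zero_fst, WithLp.zero_snd]
    rw [h1, h2, neg_zero]
  add_mem' := by
    intro v w hv hw φ h1 h2 h3 i
    have e1 : ∫ x in Ω, partialDeriv i φ x * (v.fst + w.fst : Lp ℝ r (volume.restrict Ω)) x
        = (∫ x in Ω, partialDeriv i φ x * v.fst x) + ∫ x in Ω, partialDeriv i φ x * w.fst x := by
      rw [← integral_add (integrable_mul_of_Lp hr.out (Lp.memLp v.fst) (continuous_partialDeriv i h1)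
        (hasCompactSupport_partialDeriv i h2)) (integrable_mul_of_Lp hr.out (Lp.memLp w.fst)
        (continuous_partialDeriv i h1) (hasCompactSupport_partialDeriv i h2))]
      refine integral_congr_ae ?_
      filter_upwards [Lp.coeFn_add v.fst w.fst] with x hx
      rw [hx, Pi.add_apply, mul_add]
    have e2 : ∫ x in Ω, φ x * (v.snd + w.snd : Lp E3 r (volume.restrict Ω)) x i
        = (∫ x in Ω, φ x * v.snd x i) + ∫ x in Ω, φ x * w.snd x i := by
      rw [← integral_add (integrable_mul_of_Lp hr.out (memLp_coord (Lp.memLp v.snd) i) h1.continuous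
        h2) (integrable_mul_of_Lp hr.out (memLp_coord (Lp.memLp w.snd) i) h1.continuous h2)]
      refine integral_congr_ae ?_
      filter_upwards [Lp.coeFn_add v.snd w.snd] with x hx
      rw [hx, Pi.add_apply, PiLp.add_apply, mul_add]
    simp only [WithLp.add_fst, WithLp.add_snd]
    rw [e1, e2, hv φ h1 h2 h3 i, hw φ h1 h2 h3 i]
    ring
  smul_mem' := by
    intro c w hw φ h1 h2 h3 i
    have e1 : ∫ x in Ω, partialDeriv i φ x * (c • w.fst : Lp ℝ r (volume.restrict Ω)) x
        = c * ∫ x in Ω, partialDeriv i φ x * w.fst x := by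
      rw [← integral_const_mul]
      refine integral_congr_ae ?_
      filter_upwards [Lp.coeFn_smul c w.fst] with x hx
      simp only [hx, Pi.smul_apply, smul_eq_mul]
      ring
    have e2 : ∫ x in Ω, φ x * (c • w.snd : Lp E3 r (volume.restrict Ω)) x i
        = c * ∫ x in Ω, φ x * w.snd x i := by
      rw [← integral_const_mul]
      refine integral_congr_ae ?_
      filter_upwards [Lp.coeFn_smul c w.snd] with x hx
      simp only [hx, Pi.smul_apply, PiLp.smul_apply, smul_eq_mul]
      ring
    simp only [WithLp.smul_fst, WithLp.smul_snd]
    rw [e1, e2, hw φ h1 h2 h3 i]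
    ring

/-- The Sobolev space `W^{1,r}(Ω)` with the norm `(‖f‖_r ^ r + ‖∇f‖_r ^ r) ^ (1/r)`. -/
def SobolevSpace (Ω : Set E3) (r : ℝ≥0∞) [Fact (1 ≤ r)] : Type := sobolevSubmodule Ω r

namespace SobolevSpace

variable {Ω : Set E3} {r : ℝ≥0∞} [Fact (1 ≤ r)]

instance : NormedAddCommGroup (SobolevSpace Ω r) :=
  inferInstanceAs (NormedAddCommGroup (sobolevSubmodule Ω r))

instance : NormedSpace ℝ (SobolevSpace Ω r) :=
  inferInstanceAs (NormedSpace ℝ (sobolevSubmodule Ω r))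

/-- The function underlying an element of `W^{1,r}(Ω)`. -/
def fn (w : SobolevSpace Ω r) : Lp ℝ r (volume.restrict Ω) := w.1.fst

/-- The weak gradient of an element of `W^{1,r}(Ω)`. -/
def grad (w : SobolevSpace Ω r) : Lp E3 r (volume.restrict Ω) := w.1.snd

end SobolevSpace

/-- The elements `ψ|_Ω` of `W^{1,r}(Ω)` with `ψ ∈ C_c^∞(ℝ³)` and `supp ψ ∩ Ξ = ∅`. -/
def sobolevTest (Ω Ξ : Set E3) (r : ℝ≥0∞) [Fact (1 ≤ r)] : Submodule ℝ (SobolevSpace Ω r) where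
  carrier := {w | ∃ ψ : E3 → ℝ, IsTestFunctionOff Ξ ψ ∧ w.fn =ᵐ[volume.restrict Ω] ψ ∧
    ∀ᵐ x ∂(volume.restrict Ω), ∀ i, w.grad x i = partialDeriv i ψ x}
  zero_mem' := by
    refine ⟨0, IsTestFunctionOff.zero Ξ, Lp.coeFn_zero _ _ _, ?_⟩
    filter_upwards [Lp.coeFn_zero E3 r (volume.restrict Ω)] with x hx i
    have : ((0 : SobolevSpace Ω r).grad : E3 → E3) x = 0 := hx
    rw [this]
    simp [partialDeriv]
  add_mem' := by
    rintro v w ⟨ψ₁, h1, h2, h3⟩ ⟨ψ₂, k1, k2, k3⟩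
    refine ⟨ψ₁ + ψ₂, h1.add k1, (Lp.coeFn_add v.fn w.fn).trans (h2.add k2), ?_⟩
    filter_upwards [Lp.coeFn_add v.grad w.grad, h3, k3] with x hx h k i
    have : ((v + w : SobolevSpace Ω r).grad : E3 → E3) x = v.grad x + w.grad x := hx
    rw [this, partialDeriv_add i h1.1 k1.1, ← h i, ← k i]
    rfl
  smul_mem' := by
    rintro c w ⟨ψ, h1, h2, h3⟩
    refine ⟨c • ψ, h1.smul c, (Lp.coeFn_smul c w.fn).trans (h2.const_smul c), ?_⟩
    filter_upwards [Lp.coeFn_smul c w.grad, h3] with x hx h i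
    have : ((c • w : SobolevSpace Ω r).grad : E3 → E3) x = c • w.grad x := hx
    rw [this, partialDeriv_smul i c h1.1, ← h i]
    rfl

/-- `W^{1,r}_Ξ(Ω)`, the closure in `W^{1,r}(Ω)` of the restrictions `ψ|_Ω` of functions
`ψ ∈ C_c^∞(ℝ³)` with `supp ψ ∩ Ξ = ∅`. -/
def sobolevOff (Ω Ξ : Set E3) (r : ℝ≥0∞) [Fact (1 ≤ r)] : Submodule ℝ (SobolevSpace Ω r) :=
  (sobolevTest Ω Ξ r).topologicalClosure

/-- The dual space of `W^{1,q'}_Ξ(Ω)` with the dual norm; for conjugate exponents `q, q'` this is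
`W^{-1,q}_Ξ(Ω)`. -/
abbrev NegSobolev (Ω Ξ : Set E3) (q' : ℝ≥0∞) [Fact (1 ≤ q')] : Type :=
  StrongDual ℝ (sobolevOff Ω Ξ q')

instance (Ω Ξ : Set E3) (r : ℝ≥0∞) [Fact (1 ≤ r)] : NormedAddCommGroup (NegSobolev Ω Ξ r) :=
  ContinuousLinearMap.toNormedAddCommGroup

instance (Ω Ξ : Set E3) (r : ℝ≥0∞) [Fact (1 ≤ r)] : NormedSpace ℝ (NegSobolev Ω Ξ r) :=
  ContinuousLinearMap.toNormedSpace

/-! ### Functions of time with values in a Banach space -/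

section Time

variable {X : Type*} [NormedAddCommGroup X] [NormedSpace ℝ X]

/-- `v` is the weak (distributional) derivative of `u` on the interval `(T₀, T₁)`. -/
def IsWeakTimeDeriv (T₀ T₁ : ℝ) (u v : ℝ → X) : Prop :=
  ∀ φ : ℝ → ℝ, ContDiff ℝ ∞ φ → HasCompactSupport φ → tsupport φ ⊆ Ioo T₀ T₁ →
    ∫ t in Ioo T₀ T₁, deriv φ t • u t = -∫ t in Ioo T₀ T₁, φ t • v t

lemma integrable_smul_of_Lp {T₀ T₁ : ℝ} {f : ℝ → X}
    (hf : MemLp f 2 (volume.restrict (Ioo T₀ T₁))) {φ : ℝ → ℝ} (hφ : Continuous φ)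
    (hc : HasCompactSupport φ) : IntegrableOn (fun x => φ x • f x) (Ioo T₀ T₁) :=
  (hf.locallyIntegrable (by norm_num)).integrable_smul_left_of_hasCompactSupport hφ hc

lemma integral_smul_Lp_zero {T₀ T₁ : ℝ} (φ : ℝ → ℝ) :
    ∫ t in Ioo T₀ T₁, φ t • (0 : Lp X 2 (volume.restrict (Ioo T₀ T₁))) t = 0 := by
  refine integral_eq_zero_of_ae ?_
  filter_upwards [Lp.coeFn_zero X 2 (volume.restrict (Ioo T₀ T₁))] with x hx
  simp only [hx, Pi.zero_apply, smul_zero]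

lemma integral_smul_Lp_add {T₀ T₁ : ℝ} {φ : ℝ → ℝ} (hφ : Continuous φ) (hc : HasCompactSupport φ)
    (u v : Lp X 2 (volume.restrict (Ioo T₀ T₁))) :
    ∫ t in Ioo T₀ T₁, φ t • (u + v) t
      = (∫ t in Ioo T₀ T₁, φ t • u t) + ∫ t in Ioo T₀ T₁, φ t • v t := by
  rw [← integral_add (integrable_smul_of_Lp (Lp.memLp u) hφ hc)
    (integrable_smul_of_Lp (Lp.memLp v) hφ hc)]
  refine integral_congr_ae ?_
  filter_upwards [Lp.coeFn_add u v] with x hx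
  rw [hx, Pi.add_apply, smul_add]

lemma integral_smul_Lp_smul {T₀ T₁ : ℝ} (φ : ℝ → ℝ) (c : ℝ)
    (u : Lp X 2 (volume.restrict (Ioo T₀ T₁))) :
    ∫ t in Ioo T₀ T₁, φ t • (c • u) t = c • ∫ t in Ioo T₀ T₁, φ t • u t := by
  rw [← integral_smul]
  refine integral_congr_ae ?_
  filter_upwards [Lp.coeFn_smul c u] with x hx
  simp [hx, smul_comm c]

variable (X) in
/-- The Bochner-Sobolev space `W^{1,2}(J; X)`, `J = (T₀, T₁)`, as a subspace: pairs `(u, v)` with `u ∈ L²(J; X)`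
and with weak derivative `v ∈ L²(J; X)`. The norm is `(‖u‖² + ‖∂ₜu‖²) ^ (1/2)`. -/
def timeSobolevSubmodule (T₀ T₁ : ℝ) :
    Submodule ℝ (WithLp 2 (Lp X 2 (volume.restrict (Ioo T₀ T₁)) ×
      Lp X 2 (volume.restrict (Ioo T₀ T₁)))) where
  carrier := {w | IsWeakTimeDeriv T₀ T₁ w.fst w.snd}
  zero_mem' := by
    intro φ _ _ _
    simp only [WithLp.zero_fst, WithLp.zero_snd]
    rw [integral_smul_Lp_zero, integral_smul_Lp_zero, neg_zero]
  add_mem' := by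
    intro v w hv hw φ h1 h2 h3
    simp only [WithLp.add_fst, WithLp.add_snd]
    rw [integral_smul_Lp_add (h1.continuous_deriv (by simp)) h2.deriv,
      integral_smul_Lp_add h1.continuous h2, hv φ h1 h2 h3, hw φ h1 h2 h3, neg_add]
  smul_mem' := by
    intro c w hw φ h1 h2 h3
    simp only [WithLp.smul_fst, WithLp.smul_snd]
    rw [integral_smul_Lp_smul, integral_smul_Lp_smul, hw φ h1 h2 h3, smul_neg]

variable (X) in
/-- The space `W^{1,2}(J; X)`, `J = (T₀, T₁)`, with the norm `(‖u‖² + ‖∂ₜu‖²) ^ (1/2)`. -/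
def TimeSobolev (T₀ T₁ : ℝ) : Type _ := timeSobolevSubmodule X T₀ T₁

namespace TimeSobolev

variable {T₀ T₁ : ℝ}

instance : NormedAddCommGroup (TimeSobolev X T₀ T₁) :=
  inferInstanceAs (NormedAddCommGroup (timeSobolevSubmodule X T₀ T₁))

instance : NormedSpace ℝ (TimeSobolev X T₀ T₁) :=
  inferInstanceAs (NormedSpace ℝ (timeSobolevSubmodule X T₀ T₁))

/-- The function underlying an element of `W^{1,2}(J; X)`. -/
def fn (u : TimeSobolev X T₀ T₁) : Lp X 2 (volume.restrict (Ioo T₀ T₁)) := u.1.fst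

/-- The weak time derivative of an element of `W^{1,2}(J; X)`. -/
def dt (u : TimeSobolev X T₀ T₁) : Lp X 2 (volume.restrict (Ioo T₀ T₁)) := u.1.snd

lemma fn_zero : (0 : TimeSobolev X T₀ T₁).fn = 0 := rfl

lemma fn_add (u v : TimeSobolev X T₀ T₁) : (u + v).fn = u.fn + v.fn := rfl

lemma fn_smul (c : ℝ) (u : TimeSobolev X T₀ T₁) : (c • u).fn = c • u.fn := rfl

end TimeSobolev

end Time

/-! ### Hölder continuous functions -/

section Holder

variable (ϱ : ℝ≥0) (K : Type*) [MetricSpace K] [CompactSpace K]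
variable (X : Type*) [NormedAddCommGroup X] [NormedSpace ℝ X]

/-- The continuous functions `K → X` that are Hölder continuous of order `ϱ`, as a subspace. -/
def holderSubmodule : Submodule ℝ C(K, X) where
  carrier := {f | MemHolder ϱ f}
  zero_mem' := memHolder_zero
  add_mem' hf hg := hf.add hg
  smul_mem' _ _ hf := hf.smul

/-- The Hölder space `C^ϱ(K; X)` on a compact metric space `K`. -/
def HolderSpace : Type _ := holderSubmodule ϱ K X

namespace HolderSpace

instance : AddCommGroup (HolderSpace ϱ K X) :=
  inferInstanceAs (AddCommGroup (holderSubmodule ϱ K X))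

instance : Module ℝ (HolderSpace ϱ K X) :=
  inferInstanceAs (Module ℝ (holderSubmodule ϱ K X))

variable {ϱ K X}

/-- The underlying continuous function. -/
def toContinuousMap (f : HolderSpace ϱ K X) : C(K, X) := f.1

instance : CoeFun (HolderSpace ϱ K X) (fun _ => K → X) := ⟨fun f => f.toContinuousMap⟩

lemma memHolder (f : HolderSpace ϱ K X) : MemHolder ϱ f := f.2

/-- The Hölder norm: the supremum norm plus the smallest Hölder constant. -/
instance : Norm (HolderSpace ϱ K X) := ⟨fun f => ‖f.toContinuousMap‖ + nnHolderNorm ϱ f⟩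

lemma norm_def (f : HolderSpace ϱ K X) : ‖f‖ = ‖f.toContinuousMap‖ + nnHolderNorm ϱ f := rfl

lemma core : NormedSpace.Core ℝ (HolderSpace ϱ K X) where
  norm_nonneg f := add_nonneg (norm_nonneg _) NNReal.zero_le_coe
  norm_smul c f := by
    have h : nnHolderNorm ϱ (c • f) = ‖c‖₊ * nnHolderNorm ϱ f := f.memHolder.nnHolderNorm_smul c
    have h' : ‖(c • f).toContinuousMap‖ = ‖c‖ * ‖f.toContinuousMap‖ :=
      norm_smul c f.toContinuousMap
    rw [norm_def, norm_def, h, h', NNReal.coe_mul, coe_nnnorm, mul_add]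
  norm_triangle f g := by
    have h : nnHolderNorm ϱ (f + g) ≤ nnHolderNorm ϱ f + nnHolderNorm ϱ g :=
      f.memHolder.nnHolderNorm_add_le g.memHolder
    have h' : ‖(f + g).toContinuousMap‖ ≤ ‖f.toContinuousMap‖ + ‖g.toContinuousMap‖ :=
      norm_add_le f.toContinuousMap g.toContinuousMap
    have h'' : (nnHolderNorm ϱ (f + g) : ℝ) ≤ nnHolderNorm ϱ f + nnHolderNorm ϱ g := by
      exact_mod_cast h
    rw [norm_def, norm_def, norm_def]
    linarith
  norm_eq_zero_iff f := by
    constructor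
    · intro h
      rw [norm_def] at h
      have h1 : ‖f.toContinuousMap‖ = 0 :=
        le_antisymm (by have : (0 : ℝ) ≤ nnHolderNorm ϱ f := NNReal.zero_le_coe
                        linarith) (norm_nonneg _)
      exact Subtype.ext (norm_eq_zero.1 h1)
    · rintro rfl
      have h1 : ‖(0 : HolderSpace ϱ K X).toContinuousMap‖ = 0 := norm_zero (E := C(K, X))
      have h2 : nnHolderNorm ϱ (0 : HolderSpace ϱ K X) = 0 := nnHolderNorm_zero K ϱ
      rw [norm_def, h1, h2]
      simp

instance : NormedAddCommGroup (HolderSpace ϱ K X) := NormedAddCommGroup.ofCore core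

instance : NormedSpace ℝ (HolderSpace ϱ K X) := NormedSpace.ofCore core

end HolderSpace

end Holder

/-! ### The control space -/

/-- The Bochner space `L^p(J; L^p(Γ_N))`, `J = (T₀, T₁)`. -/
abbrev BochnerLp (Ω ΓD : Set E3) (T₀ T₁ : ℝ) (p : ℝ≥0∞) [Fact (1 ≤ p)] : Type :=
  Lp (Lp ℝ p (boundaryMeasure Ω ΓD)) p (volume.restrict (Ioo T₀ T₁))

/-- The space `W^{1,2}(J; L²(Γ_N))`, `J = (T₀, T₁)`. -/
abbrev BoundaryTimeSobolev (Ω ΓD : Set E3) (T₀ T₁ : ℝ) : Type :=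
  TimeSobolev (Lp ℝ 2 (boundaryMeasure Ω ΓD)) T₀ T₁

/-- The control space `𝕌 = W^{1,2}(J; L²(Γ_N)) ∩ L^p(J; L^p(Γ_N))`: an element is a
function in the first space together with a function in the second space with which it agrees
almost everywhere. The norm is the sum of the norms in the two spaces. -/
def controlSpace (Ω ΓD : Set E3) (T₀ T₁ : ℝ) (p : ℝ≥0∞) [Fact (1 ≤ p)] :
    Submodule ℝ (WithLp 1 (BoundaryTimeSobolev Ω ΓD T₀ T₁ × BochnerLp Ω ΓD T₀ T₁ p)) where
  carrier := {x | ∀ᵐ t ∂(volume.restrict (Ioo T₀ T₁)),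
    (x.fst.fn t : E3 → ℝ) =ᵐ[boundaryMeasure Ω ΓD] x.snd t}
  zero_mem' := by
    filter_upwards [Lp.coeFn_zero (Lp ℝ 2 (boundaryMeasure Ω ΓD)) 2 (volume.restrict (Ioo T₀ T₁)),
      Lp.coeFn_zero (Lp ℝ p (boundaryMeasure Ω ΓD)) p (volume.restrict (Ioo T₀ T₁))] with t h1 h2
    have e1 : ((0 : WithLp 1 (BoundaryTimeSobolev Ω ΓD T₀ T₁ × BochnerLp Ω ΓD T₀ T₁ p)).fst.fn) t
        = 0 := h1
    have e2 : ((0 : WithLp 1 (BoundaryTimeSobolev Ω ΓD T₀ T₁ × BochnerLp Ω ΓD T₀ T₁ p)).snd) t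
        = 0 := h2
    rw [e1, e2]
    exact (Lp.coeFn_zero _ _ _).trans (Lp.coeFn_zero _ _ _).symm
  add_mem' := by
    intro x y hx hy
    filter_upwards [hx, hy, Lp.coeFn_add x.fst.fn y.fst.fn, Lp.coeFn_add x.snd y.snd] with
      t h1 h2 h3 h4
    simp only [WithLp.add_fst, WithLp.add_snd, TimeSobolev.fn_add]
    rw [h3, h4]
    exact (Lp.coeFn_add _ _).trans ((h1.add h2).trans (Lp.coeFn_add _ _).symm)
  smul_mem' := by
    intro c x hx
    filter_upwards [hx, Lp.coeFn_smul c x.fst.fn, Lp.coeFn_smul c x.snd] with t h1 h2 h3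
    simp only [WithLp.smul_fst, WithLp.smul_snd, TimeSobolev.fn_smul]
    rw [h2, h3]
    exact (Lp.coeFn_smul _ _).trans ((h1.const_smul c).trans (Lp.coeFn_smul _ _).symm)

/-- The value `u(t) ∈ L²(Γ_N)` of a control `u` at (almost every) time `t`. -/
def controlValue {Ω ΓD : Set E3} {T₀ T₁ : ℝ} {p : ℝ≥0∞} [Fact (1 ≤ p)]
    (u : controlSpace Ω ΓD T₀ T₁ p) (t : ℝ) : Lp ℝ 2 (boundaryMeasure Ω ΓD) :=
  u.1.fst.fn t

end Thermistor

end

/-! Part (i) rests on a trade-off in time. A control has a representative `U` that is Hölder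
continuous of order 1/2 with values in L² (`TimeSobolev.exists_representative`), and every interval
of length h contains times at which its L^p norm is at most h^(-1/p) times the norm of the control
(`exists_good_time`). Interpolate with 1/𝔭 = θ/2 + (1-θ)/p: between two such times at distance at
most h, `U` varies in L^𝔭 by O(h^ρ), where ρ = θ/2 - (1-θ)/p, and ρ is positive precisely for 𝔭 <
(p+2)/2. Summing along good times that converge geometrically to an arbitrary t, and passing to the
limit with Fatou's lemma, gives the Hölder bound at all times (`exists_holder_bound`).

For part (ii), the condition p > 4q/3 - 2 leaves room for some 𝔭 with max(2, 2q/3) < 𝔭 < (p+2)/2. By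
part (i) it is enough to embed L^𝔭(Γ_N) into the dual space by a compact operator T. Compactness is
kept in quantitative form: for every η, ‖T g‖ is at most η‖g‖ plus finitely many functionals of g
(`exists_boundaryFunctional`).

That bound is a trace estimate with a small constant, proved on test functions only. In a flattening
chart, a half ball is star shaped about each point of its flat face. Integrating the derivative of ψ
along segments therefore bounds ψ(x) minus an average of ψ by the Riesz potential of |∇ψ| with
kernel |w - x|^(-2), restricted to a small ball around x (`BoundaryChart.exists_oscillation_le`).
Balls of radius r have boundary measure O(r²) and volume O(r³), so a three-factor Hölder inequality
bounds the pairing of g with the potential truncated at distance ε by a constant times ε^δ ‖g‖_P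
‖∇ψ‖_r (`exists_lintegral_mul_potential_le`). The averages of ψ only meet the integrals of g over
finitely many pieces of the boundary; these are the finitely many functionals.

Hölder continuity in time turns the estimate for T into one of the same kind that is uniform in t,
through a finite net of times. This works for every s, including infinity, and
`isCompactOperator_of_forall_norm_le` concludes. Injectivity holds because test functions vanishing
near Γ_D separate functions on Γ_N and because a weak derivative is determined by its function. -/

noncomputable section

namespace Thermistor

open Filter Topology

/-! ### Operators given by linear relations, and a compactness criterion -/

section Abstract

variable {E F : Type*} [NormedAddCommGroup E] [NormedSpace ℝ E] [NormedAddCommGroup F]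
  [NormedSpace ℝ F]

/-- A bounded, single-valued and everywhere defined linear relation is a continuous linear map. -/
theorem exists_clm_of_relation (R : E → F → Prop) (C : ℝ)
    (hadd : ∀ x y f g, R x f → R y g → R (x + y) (f + g))
    (hsmul : ∀ (c : ℝ) x f, R x f → R (c • x) (c • f))
    (huniq : ∀ x f g, R x f → R x g → f = g)
    (hex : ∀ x, ∃ f, R x f ∧ ‖f‖ ≤ C * ‖x‖) :
    ∃ S : E →L[ℝ] F, ∀ x, R x (S x) ∧ ‖S x‖ ≤ C * ‖x‖ := by
  choose S hS hC using hex
  let S' : E →ₗ[ℝ] F :=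
    { toFun := S
      map_add' := fun x y => huniq _ _ _ (hS _) (hadd _ _ _ _ (hS x) (hS y))
      map_smul' := fun c x => huniq _ _ _ (hS _) (hsmul c _ _ (hS x)) }
  exact ⟨S'.mkContinuous C hC, fun x => ⟨hS x, hC x⟩⟩

/-- An operator which is bounded by finitely many functionals up to a small multiple of the norm
is compact. -/
theorem isCompactOperator_of_forall_norm_le [CompleteSpace F] (S : E →L[ℝ] F)
    (h : ∀ ε : ℝ, 0 < ε → ∃ (n : ℕ) (ℓ : Fin n → (E →L[ℝ] ℝ)),
      ∀ x, ‖S x‖ ≤ ε * ‖x‖ + ∑ i, |ℓ i x|) : IsCompactOperator S := by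
  refine (isCompactOperator_iff_isCompact_closure_image_closedBall (S : E →ₗ[ℝ] F)
    (r := 1) one_pos).2 ?_
  refine TotallyBounded.isCompact_of_isClosed (TotallyBounded.closure ?_) isClosed_closure
  rw [Metric.totallyBounded_iff]
  intro ε hε
  -- Two points of the unit ball differ by at most 2 in norm, which costs `ε / 2`. The net below is
  -- so fine that all `n` functionals together cost at most `ε / 4`; the `n + 1` avoids division by
  -- zero.
  obtain ⟨n, ℓ, hℓ⟩ := h (ε / 4) (by positivity)
  let Λ : E →L[ℝ] (Fin n → ℝ) := ContinuousLinearMap.pi ℓ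
  have hb : TotallyBounded (Λ '' Metric.closedBall 0 1) := by
    obtain ⟨r, hr⟩ := (Λ.lipschitz.isBounded_image Metric.isBounded_closedBall).subset_closedBall 0
    exact (isCompact_closedBall 0 r).totallyBounded.subset hr
  obtain ⟨t, hts, htf, hcov⟩ := totallyBounded_iff_subset.1 hb _
    (Metric.dist_mem_uniformity (show 0 < ε / (4 * (n + 1)) by positivity))
  obtain ⟨t', ht', htf', rfl⟩ : ∃ t' ⊆ Metric.closedBall (0 : E) 1, t'.Finite ∧ Λ '' t' = t := by
    obtain ⟨t', h1, h2⟩ := (Set.subset_image_iff).1 hts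
    obtain ⟨t'', h3, h4⟩ := Set.exists_subset_bijOn t' Λ
    have h6 := h4.image_eq.trans h2
    exact ⟨t'', h3.trans h1, Set.Finite.of_finite_image (h6 ▸ htf) h4.injOn, h6⟩
  refine ⟨S '' t', htf'.image _, ?_⟩
  rintro _ ⟨x, hx, rfl⟩
  have := hcov (mem_image_of_mem Λ hx)
  simp only [mem_iUnion, exists_prop] at this
  obtain ⟨_, ⟨y, hy, rfl⟩, hxy⟩ := this
  have hxy' : dist (Λ x) (Λ y) < ε / (4 * (n + 1)) := hxy
  refine mem_iUnion₂.2 ⟨S y, mem_image_of_mem _ hy, ?_⟩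
  rw [Metric.mem_ball, dist_eq_norm]
  change ‖S x - S y‖ < ε
  rw [← map_sub]
  have hn : ‖x - y‖ ≤ 2 := by
    have h1 : ‖x‖ ≤ 1 := by simpa using hx
    have h2 : ‖y‖ ≤ 1 := by simpa using ht' hy
    linarith [norm_sub_le x y]
  have hs : ∑ i, |ℓ i (x - y)| ≤ ∑ _i : Fin n, ε / (4 * (n + 1)) := by
    refine Finset.sum_le_sum fun i _ => ?_
    have : dist (Λ x i) (Λ y i) ≤ dist (Λ x) (Λ y) := dist_le_pi_dist _ _ i
    rw [Real.dist_eq] at this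
    rw [map_sub]
    exact this.trans hxy'.le
  rw [Finset.sum_const, Finset.card_univ, Fintype.card_fin, nsmul_eq_mul] at hs
  have h3 : (n : ℝ) * (ε / (4 * (n + 1))) ≤ ε / 4 := by
    rw [mul_div_assoc', div_le_div_iff₀ (by positivity) (by positivity)]
    nlinarith
  have := hℓ (x - y)
  nlinarith

end Abstract

/-! ### Interpolation, a Young type inequality, and Riesz potentials of measures -/

section Measure

variable {α : Type*} [MeasurableSpace α] {μ : Measure α}

/-- Interpolation between Lebesgue norms. -/
theorem eLpNorm_le_rpow_mul_rpow {X : Type*} [NormedAddCommGroup X] {a b r θ : ℝ} (ha : 0 < a)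
    (hb : 0 < b) (hr : 0 < r) (h0 : 0 ≤ θ) (h1 : θ ≤ 1) (h : 1 / r = θ / a + (1 - θ) / b)
    {f : α → X} (hf : AEStronglyMeasurable f μ) :
    eLpNorm f (ENNReal.ofReal r) μ ≤
      eLpNorm f (ENNReal.ofReal a) μ ^ θ * eLpNorm f (ENNReal.ofReal b) μ ^ (1 - θ) := by
  have aux : ∀ s : ℝ, 0 < s → eLpNorm f (ENNReal.ofReal s) μ = (∫⁻ x, ‖f x‖ₑ ^ s ∂μ) ^ (1 / s) := by
    intro s hs
    rw [eLpNorm_eq_lintegral_rpow_enorm_toReal (by simpa using hs) ENNReal.ofReal_ne_top,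
      ENNReal.toReal_ofReal hs.le]
  rw [aux r hr, aux a ha, aux b hb, ← ENNReal.rpow_mul, ← ENNReal.rpow_mul]
  have hsum : θ * r / a + (1 - θ) * r / b = 1 := by
    field_simp at h ⊢
    linarith
  have key := ENNReal.lintegral_mul_norm_pow_le (μ := μ) (hf.enorm.pow_const a)
    (hf.enorm.pow_const b) (p := θ * r / a) (q := (1 - θ) * r / b) (by positivity)
    (by have := sub_nonneg.2 h1; positivity) hsum
  have e : ∀ x, (‖f x‖ₑ ^ a) ^ (θ * r / a) * (‖f x‖ₑ ^ b) ^ ((1 - θ) * r / b) = ‖f x‖ₑ ^ r := by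
    intro x
    rw [← ENNReal.rpow_mul, ← ENNReal.rpow_mul, ← ENNReal.rpow_add_of_nonneg]
    · congr 1; field_simp; ring
    · positivity
    · have := sub_nonneg.2 h1; positivity
  simp only [e] at key
  calc (∫⁻ x, ‖f x‖ₑ ^ r ∂μ) ^ (1 / r) ≤ _ := ENNReal.rpow_le_rpow key (by positivity)
    _ = _ := by
      rw [ENNReal.mul_rpow_of_nonneg _ _ (by positivity), ← ENNReal.rpow_mul, ← ENNReal.rpow_mul]
      congr 2 <;> field_simp

/-- A Young type inequality for integral kernels, from Hölder's inequality with three factors. -/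
theorem lintegral_lintegral_mul_kernel_le {β : Type*} [MeasurableSpace β] {ν : Measure β}
    [SFinite μ] [SFinite ν] {P : α → ℝ≥0∞} {Q : β → ℝ≥0∞} {a b : α × β → ℝ≥0∞}
    (hP : AEMeasurable P μ) (hQ : AEMeasurable Q ν) (ha : Measurable a) (hb : Measurable b)
    {A B : ℝ≥0∞}
    (hA : ∀ x, ∫⁻ y, a (x, y) ∂ν ≤ A) (hB : ∀ y, ∫⁻ x, b (x, y) ∂μ ≤ B) {s t u : ℝ} (hs : 0 ≤ s)
    (ht : 0 ≤ t) (hu : 0 ≤ u) (h : s + t + u = 1) :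
    ∫⁻ x, ∫⁻ y, P x ^ (s + u) * Q y ^ (t + u) * (a (x, y) ^ s * b (x, y) ^ t) ∂ν ∂μ ≤
      (A * ∫⁻ x, P x ∂μ) ^ s * (B * ∫⁻ y, Q y ∂ν) ^ t * ((∫⁻ x, P x ∂μ) * ∫⁻ y, Q y ∂ν) ^ u := by
  have hP' : AEMeasurable (fun z : α × β => P z.1) (μ.prod ν) := hP.comp_fst
  have hQ' : AEMeasurable (fun z : α × β => Q z.2) (μ.prod ν) := hQ.comp_snd
  have hm : AEMeasurable (fun z : α × β => P z.1 ^ (s + u) * Q z.2 ^ (t + u) *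
      (a z ^ s * b z ^ t)) (μ.prod ν) :=
    ((hP'.pow_const _).mul (hQ'.pow_const _)).mul
      ((ha.aemeasurable.pow_const _).mul (hb.aemeasurable.pow_const _))
  have h1 : ∫⁻ x, ∫⁻ y, P x ^ (s + u) * Q y ^ (t + u) * (a (x, y) ^ s * b (x, y) ^ t) ∂ν ∂μ =
      ∫⁻ z, P z.1 ^ (s + u) * Q z.2 ^ (t + u) * (a z ^ s * b z ^ t) ∂(μ.prod ν) :=
    (lintegral_prod _ hm).symm
  rw [h1]
  -- The integrand is (P a)^s (Q b)^t (P Q)^u, so Hölder with the weights `s, t, u` leaves three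
  -- integrals over the product: the first two are bounded through `A` and `B`, the third
  -- factorises.
  let f : Fin 3 → α × β → ℝ≥0∞ :=
    ![fun z => P z.1 * a z, fun z => Q z.2 * b z, fun z => P z.1 * Q z.2]
  have key := ENNReal.lintegral_prod_norm_pow_le (μ := μ.prod ν) Finset.univ (f := f)
    (p := ![s, t, u]) (by
      intro i _
      fin_cases i
      · exact hP'.mul ha.aemeasurable
      · exact hQ'.mul hb.aemeasurable
      · exact hP'.mul hQ') (by simp [Fin.sum_univ_three, h]) (by
      intro i _
      fin_cases i <;> simpa)
  simp only [Fin.prod_univ_three, f, Matrix.cons_val_zero, Matrix.cons_val_one,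
    Matrix.cons_val] at key
  have i1 : ∫⁻ z, P z.1 * a z ∂(μ.prod ν) ≤ A * ∫⁻ x, P x ∂μ := by
    rw [lintegral_prod (fun z => P z.1 * a z) (hP'.mul ha.aemeasurable), ← lintegral_const_mul'' _ hP]
    refine lintegral_mono fun x => ?_
    change ∫⁻ y, P x * a (x, y) ∂ν ≤ _
    rw [lintegral_const_mul _ (by fun_prop), mul_comm]
    gcongr
    exact hA x
  have i2 : ∫⁻ z, Q z.2 * b z ∂(μ.prod ν) ≤ B * ∫⁻ y, Q y ∂ν := by
    rw [lintegral_prod_symm (fun z => Q z.2 * b z) (hQ'.mul hb.aemeasurable), ← lintegral_const_mul'' _ hQ]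
    refine lintegral_mono fun y => ?_
    change ∫⁻ x, Q y * b (x, y) ∂μ ≤ _
    rw [lintegral_const_mul _ (by fun_prop), mul_comm]
    gcongr
    exact hB y
  have i3 : ∫⁻ z, P z.1 * Q z.2 ∂(μ.prod ν) = (∫⁻ x, P x ∂μ) * ∫⁻ y, Q y ∂ν :=
    lintegral_prod_mul hP hQ
  rw [i3] at key
  refine (le_of_eq ?_).trans (key.trans ?_)
  · refine lintegral_congr fun z => ?_
    rw [ENNReal.mul_rpow_of_nonneg _ _ hs, ENNReal.mul_rpow_of_nonneg _ _ ht,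
      ENNReal.mul_rpow_of_nonneg _ _ hu, ENNReal.rpow_add_of_nonneg _ _ hs hu,
      ENNReal.rpow_add_of_nonneg _ _ ht hu]
    ring
  · gcongr

/-- Riesz potentials of measures with polynomial growth of balls are bounded. -/
theorem exists_lintegral_dist_rpow_le {X : Type*} [PseudoMetricSpace X] [MeasurableSpace X]
    [OpensMeasurableSpace X] (ν : Measure X) [IsFiniteMeasure ν] {d a : ℝ} {C : ℝ≥0}
    (hν : ∀ (x : X) (r : ℝ), 0 < r → ν (Metric.ball x r) ≤ C * ENNReal.ofReal (r ^ d))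
    (h0 : 0 < a) (had : a < d) :
    ∃ K : ℝ≥0, ∀ x, ∫⁻ w, ENNReal.ofReal (dist w x ^ (-a)) ∂ν ≤ K := by
  -- `c k` bounds the kernel on the shell of distances between 2^(-k-1) and 2^(-k). Multiplied by
  -- the measure of the ball of radius 2^(-k) it gives a geometric series of ratio 2^(-(d-a)), which
  -- converges because `a < d`.
  let c : ℕ → ℝ≥0∞ := fun k => ENNReal.ofReal (((1 / 2 : ℝ) ^ (k + 1)) ^ (-a))
  have hr : ENNReal.ofReal ((1 / 2 : ℝ) ^ (d - a)) < 1 := by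
    rw [ENNReal.ofReal_lt_one]
    exact Real.rpow_lt_one (by norm_num) (by norm_num) (by linarith)
  let K : ℝ≥0∞ := ν univ + ∑' k : ℕ, ENNReal.ofReal ((2 : ℝ) ^ a) * C *
    ENNReal.ofReal ((1 / 2 : ℝ) ^ (d - a)) ^ k
  have hK : K ≠ ⊤ := by
    refine ENNReal.add_ne_top.2 ⟨measure_ne_top _ _, ?_⟩
    rw [ENNReal.tsum_mul_left, ENNReal.tsum_geometric]
    refine ENNReal.mul_ne_top (ENNReal.mul_ne_top ENNReal.ofReal_ne_top ENNReal.coe_ne_top) ?_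
    exact ENNReal.inv_ne_top.2 (tsub_pos_of_lt hr).ne'
  refine ⟨K.toNNReal, fun x => ?_⟩
  rw [ENNReal.coe_toNNReal hK]
  have hpt : ∀ w, ENNReal.ofReal (dist w x ^ (-a)) ≤
      1 + ∑' k, (Metric.ball x ((1 / 2 : ℝ) ^ k)).indicator (fun _ => c k) w := by
    intro w
    rcases eq_or_lt_of_le (dist_nonneg : 0 ≤ dist w x) with h | h
    -- At distance zero the real power takes the value 0, so the singular point itself needs no
    -- estimate.
    · rw [← h, Real.zero_rpow (by linarith)]; simp
    rcases le_or_gt 1 (dist w x) with h1 | h1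
    · refine le_add_right ?_
      rw [ENNReal.ofReal_le_one]
      exact Real.rpow_le_one_of_one_le_of_nonpos h1 (by linarith)
    · obtain ⟨k, hk1, hk2⟩ := exists_nat_pow_near_of_lt_one h h1.le (by norm_num : (0 : ℝ) < 1 / 2)
        (by norm_num)
      -- The balls are open, so a distance exactly equal to a power of 1/2 is assigned to the next
      -- larger ball, where `c` still equals the kernel.
      rcases hk2.lt_or_eq with hk2 | hk2
      · refine le_add_left (le_trans (b := c k) ?_ (le_of_eq_of_le ?_ (ENNReal.le_tsum k)))
        rotate_left
        · rw [indicator_of_mem (by simpa using hk2)]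
        · refine ENNReal.ofReal_le_ofReal ?_
          exact Real.rpow_le_rpow_of_nonpos (by positivity) hk1.le (by linarith)
      · cases k with
        | zero => simp at hk2; linarith
        | succ k =>
          refine le_add_left (le_trans (b := c k) ?_ (le_of_eq_of_le ?_ (ENNReal.le_tsum k)))
          rotate_left
          · rw [indicator_of_mem]
            rw [Metric.mem_ball, hk2]
            exact pow_lt_pow_right_of_lt_one₀ (by norm_num) (by norm_num) (by omega)
          · refine ENNReal.ofReal_le_ofReal ?_
            rw [hk2]
  calc ∫⁻ w, ENNReal.ofReal (dist w x ^ (-a)) ∂ν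
      ≤ ∫⁻ w, 1 + ∑' k, (Metric.ball x ((1 / 2 : ℝ) ^ k)).indicator (fun _ => c k) w ∂ν :=
        lintegral_mono hpt
    _ = ν univ + ∑' k, c k * ν (Metric.ball x ((1 / 2 : ℝ) ^ k)) := by
        rw [lintegral_add_left measurable_const, lintegral_one, lintegral_tsum]
        · congr 2
          ext k
          rw [lintegral_indicator_const Metric.isOpen_ball.measurableSet]
        · intro k
          exact (measurable_const.indicator Metric.isOpen_ball.measurableSet).aemeasurable
    _ ≤ K := by
        refine add_le_add le_rfl (ENNReal.tsum_le_tsum fun k => ?_)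
        refine (mul_le_mul_right (hν x _ (by positivity)) _).trans (le_of_eq ?_)
        simp only [c]
        rw [← ENNReal.ofReal_pow (by positivity), mul_assoc, mul_left_comm, mul_left_comm (ENNReal.ofReal (2 ^ a)),
          ← ENNReal.ofReal_mul (by positivity), ← ENNReal.ofReal_mul (by positivity)]
        congr 2
        have e : ((1 / 2 : ℝ)) = 2 ^ (-1 : ℝ) := by rw [Real.rpow_neg_one]; norm_num
        rw [e, ← Real.rpow_natCast, ← Real.rpow_natCast, ← Real.rpow_natCast, ← Real.rpow_mul,
          ← Real.rpow_mul, ← Real.rpow_mul, ← Real.rpow_mul, ← Real.rpow_mul, ← Real.rpow_mul, ← Real.rpow_add,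
          ← Real.rpow_add] <;> try positivity
        congr 1
        push_cast
        ring

end Measure

/-! ### Variation of a smooth function along a Lipschitz curve -/

section UpperGradient

/-- A `C¹` function varies along a Lipschitz curve by at most the integral of the norm of its
derivative. -/
theorem norm_sub_le_integral_norm_fderiv {E : Type*} [NormedAddCommGroup E] [NormedSpace ℝ E]
    {ψ : E → ℝ} (hψ : ContDiff ℝ 1 ψ) {γ : ℝ → E} {K : ℝ≥0} (hγ : LipschitzOnWith K γ (Icc 0 1)) :
    |ψ (γ 1) - ψ (γ 0)| ≤ K * ∫ s in (0 : ℝ)..1, ‖fderiv ℝ ψ (γ s)‖ := by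
  have hk : ContinuousOn (fun s => ‖fderiv ℝ ψ (γ s)‖) (Icc 0 1) :=
    ((hψ.continuous_fderiv one_ne_zero).comp_continuousOn hγ.continuousOn).norm
  have hki : IntervalIntegrable (fun s => ‖fderiv ℝ ψ (γ s)‖) volume 0 1 := by
    refine ContinuousOn.intervalIntegrable ?_
    rwa [uIcc_of_le zero_le_one]
  -- The curve need not be differentiable, so there is no chain rule. A comparison of right-hand
  -- slopes needs only the Lipschitz bound for `γ` and the differentiability of `ψ`.
  refine image_le_of_liminf_slope_right_le_deriv_boundary (a := 0) (b := 1)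
    (f := fun s => |ψ (γ s) - ψ (γ 0)|)
    (B := fun x => K * ∫ s in (0 : ℝ)..x, ‖fderiv ℝ ψ (γ s)‖)
    (B' := fun s => K * ‖fderiv ℝ ψ (γ s)‖) ?_ ?_ ?_ ?_ ?_ (right_mem_Icc.2 zero_le_one)
  · exact ((hψ.continuous.comp_continuousOn hγ.continuousOn).sub continuousOn_const).abs
  · simp
  · refine continuousOn_const.mul ?_
    have := intervalIntegral.continuousOn_primitive_interval'
      (hki.mono_set (by rfl)) (left_mem_uIcc)
    rwa [uIcc_of_le zero_le_one] at this
  · intro x hx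
    refine HasDerivWithinAt.const_mul _ ?_
    have hc : ContinuousWithinAt (fun s => ‖fderiv ℝ ψ (γ s)‖) (Ici x) x :=
      (hk x (Ico_subset_Icc_self hx)).mono_of_mem_nhdsWithin
        (mem_of_superset (Icc_mem_nhdsGE hx.2) (Icc_subset_Icc_left hx.1))
    refine intervalIntegral.integral_hasDerivWithinAt_right
      (hki.mono_set ?_) ?_ (hc.mono Ioi_subset_Ici_self)
    · rw [uIcc_of_le hx.1, uIcc_of_le zero_le_one]
      exact Icc_subset_Icc_right hx.2.le
    · refine ⟨Icc x 1, mem_of_superset (Icc_mem_nhdsGT hx.2) (fun _ h => h), ?_⟩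
      exact (hk.mono (Icc_subset_Icc_left hx.1)).aestronglyMeasurable measurableSet_Icc
  · intro x hx r hr
    refine Eventually.frequently ?_
    have hx' := Ico_subset_Icc_self hx
    obtain ⟨ε, hε, hεr⟩ : ∃ ε : ℝ, 0 < ε ∧ (‖fderiv ℝ ψ (γ x)‖ + ε) * K < r := by
      have : Tendsto (fun ε : ℝ => (‖fderiv ℝ ψ (γ x)‖ + ε) * K) (𝓝[>] 0)
          (𝓝 ((‖fderiv ℝ ψ (γ x)‖ + 0) * K)) := by
        refine Tendsto.mono_left ?_ nhdsWithin_le_nhds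
        exact Continuous.tendsto (by fun_prop) 0
      rw [add_zero, mul_comm] at this
      obtain ⟨ε, h1, h2⟩ := ((this.eventually (gt_mem_nhds hr)).and self_mem_nhdsWithin).exists
      exact ⟨ε, h2, h1⟩
    have hd : ∀ᶠ y in 𝓝 (γ x), ‖ψ y - ψ (γ x)‖ ≤ (‖fderiv ℝ ψ (γ x)‖ + ε) * ‖y - γ x‖ := by
      have h1 := (hψ.differentiable one_ne_zero (γ x)).hasFDerivAt.isLittleO.def hε
      filter_upwards [h1] with y hy
      have h2 := (fderiv ℝ ψ (γ x)).le_opNorm (y - γ x)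
      have h3 := norm_add_le (ψ y - ψ (γ x) - (fderiv ℝ ψ (γ x)) (y - γ x))
        ((fderiv ℝ ψ (γ x)) (y - γ x))
      rw [sub_add_cancel] at h3
      linarith
    have hγx : Tendsto γ (𝓝[>] x) (𝓝 (γ x)) :=
      ((hγ.continuousOn x hx').mono_of_mem_nhdsWithin
        (mem_of_superset (Icc_mem_nhdsGT hx.2) (Icc_subset_Icc_left hx.1)))
    filter_upwards [hγx.eventually hd, Icc_mem_nhdsGT hx.2, self_mem_nhdsWithin] with z hz hz1 hz2
    have hz2' : 0 < z - x := sub_pos.2 hz2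
    have h4 : ‖γ z - γ x‖ ≤ K * (z - x) := by
      have := hγ.dist_le_mul z ⟨hx.1.trans hz1.1, hz1.2⟩ x hx'
      rwa [dist_eq_norm, Real.dist_eq, abs_of_pos hz2'] at this
    rw [slope_def_field, div_lt_iff₀ hz2']
    have h5 := abs_sub_abs_le_abs_sub (ψ (γ z) - ψ (γ 0)) (ψ (γ x) - ψ (γ 0))
    rw [sub_sub_sub_cancel_right] at h5
    have h6 : ‖ψ (γ z) - ψ (γ x)‖ ≤ (‖fderiv ℝ ψ (γ x)‖ + ε) * (K * (z - x)) :=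
      hz.trans (by gcongr)
    rw [Real.norm_eq_abs] at h6
    nlinarith

end UpperGradient

/-! ### From integrals along segments to the Riesz potential -/

section Potential

/-- This is the integral over the homothety ratio s that remains after the substitution w = y + s(z
- y), with ρ = |w - y|. The Jacobian contributes s^(-3), the length |z - y| equals ρ/s, and |z - y|
< d forces s > ρ/d. The integral of ρ s^(-4) over s > ρ/d is d³ρ^(-2)/3. -/
theorem lintegral_rpow_neg_four_le {ρ d : ℝ} (hd : 0 < d) (hρ : 0 ≤ ρ) :
    ∫⁻ s in Ioc (0 : ℝ) 1, ENNReal.ofReal (s ^ (-3 : ℝ)) *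
      (if ρ < s * d then ENNReal.ofReal (ρ / s) else 0) ≤
      ENNReal.ofReal (d ^ 3) * ENNReal.ofReal (ρ ^ (-2 : ℝ)) := by
  rcases hρ.eq_or_lt with rfl | hρ
  · simp
  calc ∫⁻ s in Ioc (0 : ℝ) 1, ENNReal.ofReal (s ^ (-3 : ℝ)) *
        (if ρ < s * d then ENNReal.ofReal (ρ / s) else 0)
      ≤ ∫⁻ s in Ioi (0 : ℝ), ENNReal.ofReal (s ^ (-3 : ℝ)) *
        (if ρ < s * d then ENNReal.ofReal (ρ / s) else 0) :=
        lintegral_mono_set fun s hs => hs.1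
    _ = ∫⁻ s in Ioi (0 : ℝ), (Ioi (ρ / d)).indicator (fun s => ENNReal.ofReal (ρ * s ^ (-4 : ℝ))) s := by
        refine setLIntegral_congr_fun measurableSet_Ioi fun s hs => ?_
        have hs0 : 0 < s := hs
        by_cases h : ρ < s * d
        · rw [if_pos h, indicator_of_mem (by rwa [mem_Ioi, div_lt_iff₀ hd]),
            ← ENNReal.ofReal_mul (by positivity)]
          congr 1
          rw [show (-4 : ℝ) = -3 + -1 by norm_num, Real.rpow_add hs0, Real.rpow_neg_one]
          ring
        · rw [if_neg h, indicator_of_notMem (by rwa [mem_Ioi, div_lt_iff₀ hd]), mul_zero]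
    _ ≤ ∫⁻ s in Ioi (ρ / d), ENNReal.ofReal (ρ * s ^ (-4 : ℝ)) := by
        refine (setLIntegral_le_lintegral _ _).trans (le_of_eq ?_)
        rw [lintegral_indicator measurableSet_Ioi]
    _ = ENNReal.ofReal (∫ s in Ioi (ρ / d), ρ * s ^ (-4 : ℝ)) := by
        rw [ofReal_integral_eq_lintegral_ofReal]
        · exact (integrableOn_Ioi_rpow_of_lt (by norm_num) (by positivity)).const_mul _
        · filter_upwards [ae_restrict_mem measurableSet_Ioi] with s hs
          have : 0 < s := lt_trans (by positivity) (mem_Ioi.1 hs)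
          positivity
    _ ≤ _ := by
        rw [← ENNReal.ofReal_mul (by positivity)]
        refine ENNReal.ofReal_le_ofReal ?_
        rw [integral_const_mul, integral_Ioi_rpow_of_lt (by norm_num) (by positivity),
          Real.rpow_neg hρ.le, show (-4 : ℝ) + 1 = -3 by norm_num, Real.rpow_neg (by positivity),
          show (3 : ℝ) = (3 : ℕ) by norm_num, show (2 : ℝ) = (2 : ℕ) by norm_num,
          Real.rpow_natCast, Real.rpow_natCast]
        have : ρ * (-((ρ / d) ^ 3)⁻¹ / -(3 : ℕ)) = d ^ 3 * (ρ ^ 2)⁻¹ / 3 := by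
          push_cast
          field_simp
        rw [this]
        have : 0 ≤ d ^ 3 * (ρ ^ 2)⁻¹ := by positivity
        linarith

theorem lintegral_homothety (H : E3 → ℝ≥0∞) (y : E3) {s : ℝ} (hs : 0 < s) :
    ∫⁻ z, H (y + s • (z - y)) = ENNReal.ofReal (s ^ (-3 : ℝ)) * ∫⁻ w, H w := by
  have h1 : ∫⁻ z, H (y + s • (z - y)) = ∫⁻ z, H (y + s • z) :=
    lintegral_sub_right_eq_self (fun z => H (y + s • z)) y
  have h2 : ∫⁻ z, H (y + s • z) = ∫⁻ z, H (y + z) ∂(Measure.map (s • ·) (volume : Measure E3)) :=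
    (lintegral_map_equiv (fun z => H (y + z)) (MeasurableEquiv.smul₀ s hs.ne')).symm
  rw [h1, h2, Measure.map_addHaar_smul _ hs.ne', lintegral_smul_measure,
    lintegral_add_left_eq_self]
  congr 2
  simp only [finrank_euclideanSpace, Fintype.card_fin]
  rw [abs_of_pos (by positivity), Real.rpow_neg hs.le]
  norm_cast

/-- Integrals along the segments joining a point to the points of a set which is star shaped about
it are controlled by the Riesz potential. -/
theorem lintegral_segment_le {B : Set E3} (hB : MeasurableSet B) {y : E3}
    (hstar : ∀ z ∈ B, ∀ s ∈ Ioc (0 : ℝ) 1, y + s • (z - y) ∈ B) {d : ℝ} (hd : 0 < d)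
    (hBd : ∀ z ∈ B, dist z y < d) {G : E3 → ℝ≥0∞} (hG : Measurable G) :
    ∫⁻ z in B, ∫⁻ s in Ioc (0 : ℝ) 1, ENNReal.ofReal (dist z y) * G (y + s • (z - y)) ≤
      ENNReal.ofReal (d ^ 3) * ∫⁻ w in B, G w * ENNReal.ofReal (dist w y ^ (-2 : ℝ)) := by
  -- The integrand in terms of the endpoint w = y + s(z - y). The indicator records star-shapedness,
  -- and the cutoff records the bound |z - y| < d, which keeps the s-integral away from 0.
  let H : ℝ → E3 → ℝ≥0∞ := fun s w =>
    B.indicator (fun w => (if dist w y < s * d then ENNReal.ofReal (dist w y / s) else 0) * G w) w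
  have hite : Measurable fun p : E3 × ℝ =>
      if dist p.1 y < p.2 * d then ENNReal.ofReal (dist p.1 y / p.2) else 0 := by
    refine Measurable.ite ?_ (by fun_prop) measurable_const
    exact measurableSet_lt (by fun_prop) (by fun_prop)
  have hH : Measurable fun p : E3 × ℝ => H p.2 p.1 := by
    have : (fun p : E3 × ℝ => H p.2 p.1) = (Prod.fst ⁻¹' B).indicator (fun p : E3 × ℝ =>
        (if dist p.1 y < p.2 * d then ENNReal.ofReal (dist p.1 y / p.2) else 0) * G p.1) := rfl
    rw [this]
    exact (hite.mul (hG.comp measurable_fst)).indicator (measurable_fst hB)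
  calc ∫⁻ z in B, ∫⁻ s in Ioc (0 : ℝ) 1, ENNReal.ofReal (dist z y) * G (y + s • (z - y))
      ≤ ∫⁻ z in B, ∫⁻ s in Ioc (0 : ℝ) 1, H s (y + s • (z - y)) := by
        refine setLIntegral_mono' hB fun z hz => setLIntegral_mono' measurableSet_Ioc fun s hs => ?_
        have e : dist (y + s • (z - y)) y = s * dist z y := by
          rw [dist_eq_norm, dist_eq_norm, add_sub_cancel_left, norm_smul, Real.norm_eq_abs,
            abs_of_pos hs.1]
        simp only [H]
        rw [indicator_of_mem (hstar z hz s hs), e,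
          if_pos (mul_lt_mul_of_pos_left (hBd z hz) hs.1), mul_div_cancel_left₀ _ hs.1.ne']
    _ ≤ ∫⁻ z, ∫⁻ s in Ioc (0 : ℝ) 1, H s (y + s • (z - y)) := setLIntegral_le_lintegral _ _
    _ = ∫⁻ s in Ioc (0 : ℝ) 1, ∫⁻ z, H s (y + s • (z - y)) := by
        refine lintegral_lintegral_swap (Measurable.aemeasurable ?_)
        exact hH.comp (f := fun p : E3 × ℝ => (y + p.2 • (p.1 - y), p.2)) (by fun_prop)
    _ = ∫⁻ s in Ioc (0 : ℝ) 1, ∫⁻ w, ENNReal.ofReal (s ^ (-3 : ℝ)) * H s w := by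
        refine setLIntegral_congr_fun measurableSet_Ioc fun s hs => ?_
        rw [lintegral_homothety _ _ hs.1, lintegral_const_mul]
        exact hH.comp (f := fun w : E3 => (w, s)) (by fun_prop)
    _ = ∫⁻ w, ∫⁻ s in Ioc (0 : ℝ) 1, ENNReal.ofReal (s ^ (-3 : ℝ)) * H s w := by
        refine lintegral_lintegral_swap (Measurable.aemeasurable ?_)
        refine Measurable.mul (by fun_prop) ?_
        exact hH.comp (f := fun p : ℝ × E3 => (p.2, p.1)) (by fun_prop)
    _ ≤ ∫⁻ w, B.indicator (fun w => ENNReal.ofReal (d ^ 3) *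
          (G w * ENNReal.ofReal (dist w y ^ (-2 : ℝ)))) w := by
        refine lintegral_mono fun w => ?_
        by_cases hw : w ∈ B
        · simp only [H, indicator_of_mem hw, ← mul_assoc]
          rw [lintegral_mul_const]
          · refine (mul_le_mul_left (lintegral_rpow_neg_four_le hd dist_nonneg) _).trans
              (le_of_eq ?_)
            ring
          · refine Measurable.mul (by fun_prop) ?_
            exact hite.comp (f := fun s : ℝ => (w, s)) (by fun_prop)
        · simp [H, indicator_of_notMem hw]
    _ = _ := by
        rw [lintegral_indicator hB, lintegral_const_mul]
        fun_prop

end Potential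

/-! ### Measures of Lipschitz images -/

section Lipschitz

theorem _root_.LipschitzOnWith.euclideanHausdorffMeasure_image_le {X Y : Type*} [MetricSpace X]
    [MeasurableSpace X] [BorelSpace X] [MetricSpace Y] [MeasurableSpace Y] [BorelSpace Y]
    {K : ℝ≥0} {f : X → Y} {s : Set X} (h : LipschitzOnWith K f s) (d : ℕ) :
    (μHE[d] : Measure Y) (f '' s) ≤ (K : ℝ≥0∞) ^ d * (μHE[d] : Measure X) s := by
  rw [Measure.euclideanHausdorffMeasure_def, Measure.euclideanHausdorffMeasure_def,
    Measure.smul_apply, Measure.smul_apply, ENNReal.smul_def, ENNReal.smul_def, smul_eq_mul,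
    smul_eq_mul, mul_left_comm]
  gcongr
  simpa using h.hausdorffMeasure_image_le (d := d) (by positivity)

theorem _root_.LipschitzOnWith.volume_image_le {K : ℝ≥0} {f : E3 → E3} {s : Set E3}
    (h : LipschitzOnWith K f s) : volume (f '' s) ≤ (K : ℝ≥0∞) ^ 3 * volume s := by
  rw [← EuclideanSpace.euclideanHausdorffMeasure_eq_volume]
  exact h.euclideanHausdorffMeasure_image_le 3

end Lipschitz

/-! ### Charts that flatten the boundary -/

/-- A bi-Lipschitz chart flattening the boundary of `Ω`, with both maps extended continuously to the
whole space. -/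
structure BoundaryChart (Ω : Set E3) where
  source : Set E3
  size : ℝ
  toFun : E3 → E3
  invFun : E3 → E3
  lip : ℝ≥0
  isOpen_source : IsOpen source
  continuous_toFun : Continuous toFun
  continuous_invFun : Continuous invFun
  lipschitzOn_toFun : LipschitzOnWith lip toFun source
  lipschitzOn_invFun : LipschitzOnWith lip invFun (cube size)
  map_source : ∀ x ∈ source, toFun x ∈ cube size
  map_target : ∀ z ∈ cube size, invFun z ∈ source
  left_inv : ∀ x ∈ source, invFun (toFun x) = x
  right_inv : ∀ z ∈ cube size, toFun (invFun z) = z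
  map_lower : ∀ z ∈ lowerHalfCube size, invFun z ∈ Ω
  map_frontier : ∀ x ∈ source, x ∈ frontier Ω → toFun x 2 = 0

theorem isOpen_cube (a : ℝ) : IsOpen (cube a) := by
  have : cube a = ⋂ i, {x : E3 | |x i| < a / 2} := by ext; simp [cube]
  rw [this]
  exact isOpen_iInter_of_finite fun i => isOpen_lt (by fun_prop) continuous_const

/-- The inverse of a bi-Lipschitz map is Lipschitz on the cube, and in finite dimensions both maps
extend as Lipschitz maps to the whole space. The extensions are globally continuous, hence
measurable, which spares all later measurability questions on subsets. -/
theorem IsBoundedLipschitzDomain.exists_chart {Ω : Set E3} (hΩ : IsBoundedLipschitzDomain Ω) {x : E3}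
    (hx : x ∈ frontier Ω) : ∃ c : BoundaryChart Ω, x ∈ c.source := by
  obtain ⟨U, a, φ, L, hU, hxU, ha, hφ, hφ', himg, -, hlow⟩ := hΩ.chart x hx
  have hinj : InjOn φ U := fun y hy z hz h => by
    have := hφ' y hy z hz
    rw [h, dist_self, mul_zero] at this
    exact dist_le_zero.1 this
  have hmapU : ∀ y ∈ U, φ y ∈ cube a := fun y hy => himg ▸ mem_image_of_mem φ hy
  let χ := Function.invFunOn φ U
  have hχU : ∀ z ∈ cube a, χ z ∈ U := fun z hz => Function.invFunOn_mem (himg ▸ hz : z ∈ φ '' U)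
  have hφχ : ∀ z ∈ cube a, φ (χ z) = z := fun z hz =>
    Function.invFunOn_eq (himg ▸ hz : z ∈ φ '' U)
  have hχφ : ∀ y ∈ U, χ (φ y) = y := fun y hy =>
    hinj (hχU _ (hmapU y hy)) hy (hφχ _ (hmapU y hy))
  have hχ : LipschitzOnWith L χ (cube a) := LipschitzOnWith.of_dist_le_mul fun z hz w hw => by
    have := hφ' _ (hχU z hz) _ (hχU w hw)
    rwa [hφχ z hz, hφχ w hw] at this
  obtain ⟨φ₁, h1, e1⟩ := hφ.extend_finite_dimension
  obtain ⟨χ₁, h2, e2⟩ := hχ.extend_finite_dimension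
  have hlow' : ∀ z ∈ lowerHalfCube a, χ z ∈ Ω := by
    intro z hz
    obtain ⟨y, hy, rfl⟩ := hlow.symm ▸ hz
    rw [hχφ y hy.2]
    exact hy.1
  refine ⟨{ source := U, size := a, toFun := φ₁, invFun := χ₁, lip := L
            isOpen_source := hU
            continuous_toFun := h1.continuous
            continuous_invFun := h2.continuous
            lipschitzOn_toFun := fun y hy z hz => by rw [← e1 hy, ← e1 hz]; exact hφ hy hz
            lipschitzOn_invFun := fun y hy z hz => by rw [← e2 hy, ← e2 hz]; exact hχ hy hz
            map_source := fun y hy => by rw [← e1 hy]; exact hmapU y hy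
            map_target := fun z hz => by rw [← e2 hz]; exact hχU z hz
            left_inv := fun y hy => by rw [← e1 hy, ← e2 (hmapU y hy)]; exact hχφ y hy
            right_inv := fun z hz => by rw [← e2 hz, ← e1 (hχU z hz)]; exact hφχ z hz
            map_lower := fun z hz => by rw [← e2 hz.1]; exact hlow' z hz
            map_frontier := ?_ }, hxU⟩
  intro y hyU hy
  rw [← e1 hyU]
  have hyΩ : y ∉ Ω := fun h => (hΩ.isOpen.frontier_eq ▸ hy).2 h
  -- A boundary point cannot map above the plane, since points of `Ω` close to it map below; it
  -- cannot map below, since it would then lie in `Ω`, which is open.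
  refine le_antisymm (not_lt.1 fun hlt => ?_) (not_lt.1 fun hlt => hyΩ ?_)
  · have hopen : IsOpen (U ∩ φ₁ ⁻¹' {z : E3 | 0 < z 2}) :=
      hU.inter ((isOpen_lt continuous_const (by fun_prop)).preimage h1.continuous)
    obtain ⟨z, hz1, hz2⟩ := mem_closure_iff.1 (frontier_subset_closure hy) _ hopen
      ⟨hyU, by change 0 < φ₁ y 2; rw [← e1 hyU]; exact hlt⟩
    have hz3 : 0 < φ₁ z 2 := hz1.2
    have hz4 : φ z ∈ lowerHalfCube a := hlow ▸ mem_image_of_mem φ ⟨hz2, hz1.1⟩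
    rw [← e1 hz1.1] at hz3
    exact lt_asymm hz3 hz4.2
  · have := hlow' (φ y) ⟨hmapU y hyU, hlt⟩
    rwa [hχφ y hyU] at this

namespace BoundaryChart

variable {Ω : Set E3} (c : BoundaryChart Ω)

/-- Instead of a change of variables with a Jacobian, the push-forward of Lebesgue measure is
compared with Lebesgue measure: a preimage under `invFun` inside the cube is contained in an image
under the Lipschitz map `toFun`. -/
theorem lintegral_comp_invFun_le {A S : Set E3} (hAc : A ⊆ cube c.size)
    (hAS : ∀ z ∈ A, c.invFun z ∈ S) {f : E3 → ℝ≥0∞} (hf : Measurable f) :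
    ∫⁻ z in A, f (c.invFun z) ≤ (c.lip : ℝ≥0∞) ^ 3 * ∫⁻ w in S, f w := by
  have hm : Measure.map c.invFun (volume.restrict A) ≤
      (c.lip : ℝ≥0∞) ^ 3 • (volume.restrict S : Measure E3) := by
    refine Measure.le_iff.2 fun T hT => ?_
    rw [Measure.map_apply c.continuous_invFun.measurable hT, Measure.restrict_apply
      (c.continuous_invFun.measurable hT), Measure.smul_apply, Measure.restrict_apply hT, smul_eq_mul]
    have hsub : c.invFun ⁻¹' T ∩ A ⊆ c.toFun '' (T ∩ S ∩ c.source) := fun z hz =>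
      ⟨c.invFun z, ⟨⟨hz.1, hAS z hz.2⟩, c.map_target z (hAc hz.2)⟩, c.right_inv z (hAc hz.2)⟩
    calc volume (c.invFun ⁻¹' T ∩ A) ≤ volume (c.toFun '' (T ∩ S ∩ c.source)) := measure_mono hsub
      _ ≤ (c.lip : ℝ≥0∞) ^ 3 * volume (T ∩ S ∩ c.source) :=
        (c.lipschitzOn_toFun.mono inter_subset_right).volume_image_le
      _ ≤ _ := mul_le_mul_right (measure_mono inter_subset_left) _
  calc ∫⁻ z in A, f (c.invFun z) = ∫⁻ w, f w ∂(Measure.map c.invFun (volume.restrict A)) :=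
        (lintegral_map hf c.continuous_invFun.measurable).symm
    _ ≤ _ := lintegral_mono' hm le_rfl
    _ = _ := by rw [lintegral_smul_measure, smul_eq_mul]

/-- The inclusion of the plane `{x₃ = 0}`. -/
def planeIncl (x : EuclideanSpace ℝ (Fin 2)) : E3 := !₂[x 0, x 1, 0]

theorem dist_planeIncl (x y : EuclideanSpace ℝ (Fin 2)) :
    dist (planeIncl x) (planeIncl y) = dist x y := by
  simp [planeIncl, EuclideanSpace.dist_eq, Fin.sum_univ_succ]

/-- The boundary piece is a Lipschitz image of part of a planar disc. Since `x` may lie outside the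
chart, the disc is centred at the image of some point `x₀` of the piece. Points of the piece are
within 2r of `x₀`, which explains the radius (2L + 1)r; the extra r makes the inequality strict. -/
theorem exists_hausdorffMeasure_le : ∃ C : ℝ≥0, ∀ (x : E3) (r : ℝ), 0 < r →
    (μHE[2] : Measure E3) (frontier Ω ∩ c.source ∩ Metric.ball x r) ≤
      C * ENNReal.ofReal (r ^ (2 : ℝ)) := by
  let v : ℝ≥0∞ := volume (Metric.ball (0 : EuclideanSpace ℝ (Fin 2)) 1)
  have hv : v ≠ ⊤ := measure_ball_lt_top.ne
  refine ⟨c.lip ^ 2 * ((2 * c.lip + 1) ^ 2 * v.toNNReal), fun x r hr => ?_⟩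
  rcases (frontier Ω ∩ c.source ∩ Metric.ball x r).eq_empty_or_nonempty with h | ⟨x₀, hx₀⟩
  · rw [h]; simp
  let p : E3 → EuclideanSpace ℝ (Fin 2) := fun z => !₂[z 0, z 1]
  have hp : ∀ y ∈ c.source, y ∈ frontier Ω → planeIncl (p (c.toFun y)) = c.toFun y := by
    intro y hy hy'
    ext i
    fin_cases i
    · rfl
    · rfl
    · exact (c.map_frontier y hy hy').symm
  let S : Set (EuclideanSpace ℝ (Fin 2)) :=
    Metric.ball (p (c.toFun x₀)) ((2 * c.lip + 1) * r) ∩ {z | planeIncl z ∈ cube c.size}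
  have hsub : frontier Ω ∩ c.source ∩ Metric.ball x r ⊆ (c.invFun ∘ planeIncl) '' S := by
    rintro y ⟨⟨hy1, hy2⟩, hy3⟩
    refine ⟨p (c.toFun y), ⟨?_, ?_⟩, ?_⟩
    · rw [Metric.mem_ball, ← dist_planeIncl, hp y hy2 hy1, hp x₀ hx₀.1.2 hx₀.1.1]
      have h1 := c.lipschitzOn_toFun.dist_le_mul y hy2 x₀ hx₀.1.2
      have h2 : dist y x₀ < 2 * r := by
        have := dist_triangle_right y x₀ x
        have := Metric.mem_ball.1 hy3
        have := Metric.mem_ball.1 hx₀.2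
        linarith
      have h3 : (c.lip : ℝ) * dist y x₀ ≤ c.lip * (2 * r) := by gcongr
      linarith
    · change planeIncl (p (c.toFun y)) ∈ cube c.size
      rw [hp y hy2 hy1]
      exact c.map_source y hy2
    · rw [Function.comp_apply, hp y hy2 hy1, c.left_inv y hy2]
  have hlip : LipschitzOnWith c.lip (c.invFun ∘ planeIncl) S :=
    LipschitzOnWith.of_dist_le_mul fun z hz w hw => by
      rw [← dist_planeIncl z w]
      exact c.lipschitzOn_invFun.dist_le_mul _ hz.2 _ hw.2
  refine (measure_mono hsub).trans ((hlip.euclideanHausdorffMeasure_image_le 2).trans ?_)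
  rw [EuclideanSpace.euclideanHausdorffMeasure_eq_volume]
  have hball : volume S ≤ ENNReal.ofReal (((2 * c.lip + 1) * r) ^ 2) * v := by
    refine (measure_mono inter_subset_left).trans (le_of_eq ?_)
    rw [Measure.addHaar_ball _ _ (by positivity)]
    simp [v]
  refine (mul_le_mul_right hball _).trans (le_of_eq ?_)
  push_cast
  rw [ENNReal.coe_toNNReal hv, mul_pow, ENNReal.ofReal_mul (by positivity),
    ENNReal.ofReal_pow (by positivity), ENNReal.ofReal_add (by positivity) zero_le_one,
    ENNReal.ofReal_mul (by positivity)]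
  rw [show (2 : ℝ) = (2 : ℕ) by norm_num, Real.rpow_natCast]
  simp only [Nat.cast_ofNat, ENNReal.ofReal_ofNat, ENNReal.ofReal_coe_nnreal, ENNReal.ofReal_one]
  ring

/-- The part of a ball below the plane `{x₃ = 0}`. -/
def halfBall (y : E3) (h : ℝ) : Set E3 := Metric.ball y h ∩ {z | z 2 < 0}

theorem isOpen_halfBall (y : E3) (h : ℝ) : IsOpen (halfBall y h) :=
  Metric.isOpen_ball.inter (isOpen_lt (by fun_prop) continuous_const)

theorem volume_halfBall_ne_top (y : E3) (h : ℝ) : volume (halfBall y h) ≠ ⊤ :=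
  ((measure_mono inter_subset_left).trans_lt measure_ball_lt_top).ne

/-- The half ball contains the ball of radius h/2 whose centre lies h/2 below `y`. -/
theorem le_volume_halfBall {y : E3} (hy : y 2 = 0) {h : ℝ} (hh : 0 < h) :
    ENNReal.ofReal ((h / 2) ^ 3) * volume (Metric.ball (0 : E3) 1) ≤ volume (halfBall y h) := by
  have : Metric.ball (y - EuclideanSpace.single 2 (h / 2)) (h / 2) ⊆ halfBall y h := by
    intro z hz
    rw [Metric.mem_ball] at hz
    constructor
    · have h1 : dist (y - EuclideanSpace.single 2 (h / 2)) y = h / 2 := by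
        rw [dist_eq_norm, sub_sub_cancel_left, norm_neg, PiLp.norm_single,
          Real.norm_of_nonneg (by positivity)]
      rw [Metric.mem_ball]
      linarith [dist_triangle z (y - EuclideanSpace.single 2 (h / 2)) y]
    · have h1 : ‖(z - (y - EuclideanSpace.single 2 (h / 2)) : E3) 2‖ < h / 2 :=
        (PiLp.norm_apply_le _ _).trans_lt (by rwa [dist_eq_norm] at hz)
      simp only [PiLp.sub_apply, hy, Real.norm_eq_abs, PiLp.single_apply, if_true] at h1
      have := (abs_lt.1 h1).2
      change z 2 < 0
      linarith
  refine le_trans (le_of_eq ?_) (measure_mono this)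
  rw [Measure.addHaar_ball volume (y - EuclideanSpace.single 2 (h / 2))
    (by positivity : 0 ≤ h / 2), finrank_euclideanSpace, Fintype.card_fin]

/-- The half ball is star shaped about every point of its flat face, not only about its centre. This
allows one average to serve all nearby boundary points. -/
theorem add_smul_sub_mem_halfBall {y₀ y z : E3} {h s : ℝ} (hy : y ∈ Metric.ball y₀ h)
    (hy2 : y 2 = 0) (hz : z ∈ halfBall y₀ h) (hs : s ∈ Ioc (0 : ℝ) 1) :
    y + s • (z - y) ∈ halfBall y₀ h := by
  refine ⟨(convex_ball y₀ h).add_smul_sub_mem hy hz.1 ⟨hs.1.le, hs.2⟩, ?_⟩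
  change (y + s • (z - y)) 2 < 0
  simp only [PiLp.add_apply, PiLp.smul_apply, PiLp.sub_apply, hy2, smul_eq_mul]
  have : z 2 < 0 := hz.2
  nlinarith [hs.1]

/-- The chart inverse carries the segment from `y` to `z` to a curve with Lipschitz constant at most
L|z - y|, to which `norm_sub_le_integral_norm_fderiv` applies. -/
theorem enorm_sub_le_lintegral_segment {ψ : E3 → ℝ} (hψ : ContDiff ℝ 1 ψ) {y z : E3}
    (hyz : ∀ s ∈ Icc (0 : ℝ) 1, y + s • (z - y) ∈ cube c.size) :
    ‖ψ (c.invFun y) - ψ (c.invFun z)‖ₑ ≤ c.lip * ∫⁻ s in Ioc (0 : ℝ) 1,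
      ENNReal.ofReal (dist z y) * ‖fderiv ℝ ψ (c.invFun (y + s • (z - y)))‖ₑ := by
  have hf : Continuous (fderiv ℝ ψ) := hψ.continuous_fderiv one_ne_zero
  have hγ : LipschitzOnWith (c.lip * (nndist z y)) (fun s : ℝ => c.invFun (y + s • (z - y)))
      (Icc 0 1) := by
    refine LipschitzOnWith.of_dist_le_mul fun s hs t ht => ?_
    refine (c.lipschitzOn_invFun.dist_le_mul _ (hyz s hs) _ (hyz t ht)).trans (le_of_eq ?_)
    rw [dist_add_left, dist_eq_norm, ← sub_smul, norm_smul, NNReal.coe_mul, coe_nndist,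
      dist_eq_norm z y, dist_eq_norm s t]
    ring
  have hc : Continuous fun s : ℝ => fderiv ℝ ψ (c.invFun (y + s • (z - y))) :=
    hf.comp (c.continuous_invFun.comp (by fun_prop))
  have key := norm_sub_le_integral_norm_fderiv hψ hγ
  simp only [one_smul, zero_smul, add_zero, add_sub_cancel] at key
  rw [← enorm_neg, neg_sub, Real.enorm_eq_ofReal_abs]
  refine (ENNReal.ofReal_le_ofReal key).trans (le_of_eq ?_)
  rw [lintegral_const_mul _ hc.enorm.measurable, ENNReal.ofReal_mul (by positivity),
    NNReal.coe_mul, ENNReal.ofReal_mul (by positivity), ENNReal.ofReal_coe_nnreal, coe_nndist,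
    mul_assoc, intervalIntegral.integral_of_le zero_le_one,
    ofReal_integral_eq_lintegral_ofReal]
  · simp only [ofReal_norm]
  · exact hc.norm.integrableOn_Icc.mono_set Ioc_subset_Icc_self
  · exact Eventually.of_forall fun s => norm_nonneg _

theorem dist_rpow_neg_two_le {w y : E3} (hw : w ∈ cube c.size) (hy : y ∈ cube c.size)
    (hwy : w ≠ y) : ENNReal.ofReal (dist w y ^ (-2 : ℝ)) ≤
      (c.lip : ℝ≥0∞) ^ 2 * ENNReal.ofReal (dist (c.invFun w) (c.invFun y) ^ (-2 : ℝ)) := by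
  have hle : dist (c.invFun w) (c.invFun y) ≤ c.lip * dist w y :=
    c.lipschitzOn_invFun.dist_le_mul w hw y hy
  have hpos : 0 < dist (c.invFun w) (c.invFun y) := by
    refine dist_pos.2 fun h => hwy ?_
    rw [← c.right_inv w hw, h, c.right_inv y hy]
  have hpos' : 0 < dist w y := dist_pos.2 hwy
  have hL : (0 : ℝ) < c.lip := by
    by_contra hcon
    have : (c.lip : ℝ) = 0 := le_antisymm (not_lt.1 hcon) c.lip.2
    rw [this, zero_mul] at hle
    linarith
  have : dist w y ^ (-2 : ℝ) ≤
      (c.lip : ℝ) ^ 2 * dist (c.invFun w) (c.invFun y) ^ (-2 : ℝ) := by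
    rw [Real.rpow_neg hpos'.le, Real.rpow_neg hpos.le, ← div_eq_mul_inv,
      inv_le_comm₀ (by positivity) (by positivity), inv_div, div_le_iff₀ (by positivity),
      show (2 : ℝ) = (2 : ℕ) by norm_num, Real.rpow_natCast, Real.rpow_natCast, ← mul_pow,
      mul_comm (dist w y)]
    gcongr
  have := ENNReal.ofReal_le_ofReal this
  rwa [ENNReal.ofReal_mul (by positivity), ENNReal.ofReal_pow (by positivity),
    ENNReal.ofReal_coe_nnreal] at this

theorem invFun_mem_of_mem_halfBall {y₀ y z : E3} {h : ℝ} (hball : Metric.ball y₀ h ⊆ cube c.size)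
    (hz : z ∈ halfBall y₀ h) (hy : y ∈ Metric.ball y₀ h) {ε : ℝ} (hε : c.lip * (2 * h) < ε) :
    c.invFun z ∈ Ω ∩ Metric.ball (c.invFun y) ε := by
  refine ⟨c.map_lower z ⟨hball hz.1, hz.2⟩, ?_⟩
  refine (c.lipschitzOn_invFun.dist_le_mul z (hball hz.1) y (hball hy)).trans_lt
    (lt_of_le_of_lt ?_ hε)
  gcongr
  have h1 : dist z y₀ < h := hz.1
  have h2 : dist y y₀ < h := hy
  linarith [dist_triangle_right z y y₀]

/-- Segments are integrated in the flat picture, where `lintegral_segment_le` yields the kernel |w -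
y|^(-2). Kernel and volume are then carried back to `Ω`, at the price of L² and L³. The half ball is
so small that its image stays within ε of the boundary point. -/
theorem lintegral_enorm_sub_le {y₀ y : E3} {h : ℝ} (hh : 0 < h)
    (hball : Metric.ball y₀ h ⊆ cube c.size) (hy : y ∈ Metric.ball y₀ h) (hy2 : y 2 = 0) {ε : ℝ}
    (hε : c.lip * (2 * h) < ε) {ψ : E3 → ℝ} (hψ : ContDiff ℝ 1 ψ) :
    ∫⁻ z in halfBall y₀ h, ‖ψ (c.invFun y) - ψ (c.invFun z)‖ₑ ≤
      c.lip * (ENNReal.ofReal ((2 * h) ^ 3) * ((c.lip : ℝ≥0∞) ^ 2 * ((c.lip : ℝ≥0∞) ^ 3 *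
        ∫⁻ w in Ω ∩ Metric.ball (c.invFun y) ε,
          ‖fderiv ℝ ψ w‖ₑ * ENNReal.ofReal (dist w (c.invFun y) ^ (-2 : ℝ))))) := by
  have hf : Continuous (fderiv ℝ ψ) := hψ.continuous_fderiv one_ne_zero
  have hBm : MeasurableSet (halfBall y₀ h) := (isOpen_halfBall y₀ h).measurableSet
  let G : E3 → ℝ≥0∞ := fun z => ‖fderiv ℝ ψ (c.invFun z)‖ₑ
  have hG : Measurable G := (hf.comp c.continuous_invFun).enorm.measurable
  let f : E3 → ℝ≥0∞ := fun w =>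
    ‖fderiv ℝ ψ w‖ₑ * ENNReal.ofReal (dist w (c.invFun y) ^ (-2 : ℝ))
  have hfm : Measurable f := hf.enorm.measurable.mul (by fun_prop)
  have hseg : ∀ z ∈ halfBall y₀ h, ‖ψ (c.invFun y) - ψ (c.invFun z)‖ₑ ≤ c.lip *
      ∫⁻ s in Ioc (0 : ℝ) 1, ENNReal.ofReal (dist z y) * G (y + s • (z - y)) := fun z hz =>
    c.enorm_sub_le_lintegral_segment hψ fun s hs =>
      hball ((convex_ball y₀ h).add_smul_sub_mem hy hz.1 hs)
  have hpt : ∀ w ∈ halfBall y₀ h, G w * ENNReal.ofReal (dist w y ^ (-2 : ℝ)) ≤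
      (c.lip : ℝ≥0∞) ^ 2 * f (c.invFun w) := by
    intro w hw
    have hwy : w ≠ y := by
      rintro rfl
      have h2 : w 2 < 0 := hw.2
      rw [hy2] at h2
      exact lt_irrefl _ h2
    calc G w * ENNReal.ofReal (dist w y ^ (-2 : ℝ)) ≤ G w * ((c.lip : ℝ≥0∞) ^ 2 *
          ENNReal.ofReal (dist (c.invFun w) (c.invFun y) ^ (-2 : ℝ))) :=
          mul_le_mul_right (c.dist_rpow_neg_two_le (hball hw.1) (hball hy) hwy) _
      _ = _ := mul_left_comm _ _ _
  have hBd : ∀ z ∈ halfBall y₀ h, dist z y < 2 * h := fun z hz => by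
    have h1 : dist z y₀ < h := hz.1
    have h2 : dist y y₀ < h := hy
    linarith [dist_triangle_right z y y₀]
  calc ∫⁻ z in halfBall y₀ h, ‖ψ (c.invFun y) - ψ (c.invFun z)‖ₑ
      ≤ ∫⁻ z in halfBall y₀ h, c.lip * ∫⁻ s in Ioc (0 : ℝ) 1,
          ENNReal.ofReal (dist z y) * G (y + s • (z - y)) := setLIntegral_mono' hBm hseg
    _ = c.lip * ∫⁻ z in halfBall y₀ h, ∫⁻ s in Ioc (0 : ℝ) 1,
          ENNReal.ofReal (dist z y) * G (y + s • (z - y)) :=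
        lintegral_const_mul' _ _ ENNReal.coe_ne_top
    _ ≤ c.lip * (ENNReal.ofReal ((2 * h) ^ 3) *
          ∫⁻ w in halfBall y₀ h, G w * ENNReal.ofReal (dist w y ^ (-2 : ℝ))) :=
        mul_le_mul_right (lintegral_segment_le hBm
          (fun z hz s hs => add_smul_sub_mem_halfBall hy hy2 hz hs) (by positivity) hBd hG) _
    _ ≤ c.lip * (ENNReal.ofReal ((2 * h) ^ 3) *
          ∫⁻ w in halfBall y₀ h, (c.lip : ℝ≥0∞) ^ 2 * f (c.invFun w)) :=
        mul_le_mul_right (mul_le_mul_right (setLIntegral_mono' hBm hpt) _) _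
    _ ≤ _ := by
        rw [lintegral_const_mul' _ _ (ENNReal.pow_ne_top ENNReal.coe_ne_top)]
        refine mul_le_mul_right (mul_le_mul_right (mul_le_mul_right ?_ _) _) _
        exact c.lintegral_comp_invFun_le (inter_subset_left.trans hball)
          (fun z hz => c.invFun_mem_of_mem_halfBall hball hz hy hε) hfm

theorem exists_small_radius (L : ℝ≥0) {h₀ ε : ℝ} (hh₀ : 0 < h₀) (hε : 0 < ε) :
    ∃ h : ℝ, 0 < h ∧ h ≤ h₀ ∧ L * (2 * h) < ε := by
  refine ⟨min h₀ (ε / (2 * (L + 1))), lt_min hh₀ (by positivity), min_le_left _ _, ?_⟩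
  have h1 := min_le_right h₀ (ε / (2 * (L + 1)))
  calc (L : ℝ) * (2 * min h₀ (ε / (2 * (L + 1)))) ≤ L * (2 * (ε / (2 * (L + 1)))) := by gcongr
    _ = L / (L + 1) * ε := by field_simp
    _ < 1 * ε := by
      gcongr
      rw [div_lt_one (by positivity)]
      linarith
    _ = ε := one_mul ε

theorem exists_average_enorm_le {B : Set E3} (h0 : volume B ≠ 0) (ht : volume B ≠ ⊤) {g : E3 → ℝ}
    (hg : IntegrableOn g B) : ∃ m : ℝ, ‖m‖ₑ ≤ (volume B)⁻¹ * ∫⁻ z in B, ‖g z‖ₑ ∧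
      ∀ a, ‖a - m‖ₑ ≤ (volume B)⁻¹ * ∫⁻ z in B, ‖a - g z‖ₑ := by
  let π : Measure E3 := (volume B)⁻¹ • volume.restrict B
  have hπ : IsProbabilityMeasure π := ⟨by
    rw [Measure.smul_apply, Measure.restrict_apply_univ, smul_eq_mul,
      ENNReal.inv_mul_cancel h0 ht]⟩
  have hgint : Integrable g π := hg.smul_measure (ENNReal.inv_ne_top.2 h0)
  refine ⟨∫ z, g z ∂π, ?_, fun a => ?_⟩
  · refine (enorm_integral_le_lintegral_enorm _).trans ?_
    rw [lintegral_smul_measure, smul_eq_mul]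
  · have hdiff : a - ∫ z, g z ∂π = ∫ z, (a - g z) ∂π := by
      rw [integral_sub (integrable_const _) hgint]
      simp
    rw [hdiff]
    refine (enorm_integral_le_lintegral_enorm _).trans ?_
    rw [lintegral_smul_measure, smul_eq_mul]

/-- The radius cancels: (2h)³ / (h/2)³ = 64. Hence the oscillation constant does not depend on the
scale. -/
theorem inv_mul_le {h : ℝ} (hh : 0 < h) {v : ℝ≥0∞} (hv : v ≠ 0) (L : ℝ≥0) (I : ℝ≥0∞) :
    (ENNReal.ofReal ((h / 2) ^ 3) * v)⁻¹ * (L * (ENNReal.ofReal ((2 * h) ^ 3) *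
      ((L : ℝ≥0∞) ^ 2 * ((L : ℝ≥0∞) ^ 3 * I)))) ≤
      (64 * v⁻¹.toNNReal * (L * (L ^ 2 * L ^ 3)) : ℝ≥0) * I := by
  have hr0 : ENNReal.ofReal ((h / 2) ^ 3) ≠ 0 := by simpa using by positivity
  have e : ENNReal.ofReal ((2 * h) ^ 3) = 64 * ENNReal.ofReal ((h / 2) ^ 3) := by
    rw [← ENNReal.ofReal_ofNat, ← ENNReal.ofReal_mul (by positivity)]
    congr 1
    ring
  rw [ENNReal.mul_inv (Or.inl hr0) (Or.inl ENNReal.ofReal_ne_top), e]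
  push_cast
  rw [ENNReal.coe_toNNReal (ENNReal.inv_ne_top.2 hv)]
  refine le_of_eq ?_
  calc _ = ((ENNReal.ofReal ((h / 2) ^ 3))⁻¹ * ENNReal.ofReal ((h / 2) ^ 3)) *
        (64 * v⁻¹ * (L * ((L : ℝ≥0∞) ^ 2 * (L : ℝ≥0∞) ^ 3)) * I) := by ring
    _ = _ := by rw [ENNReal.inv_mul_cancel hr0 ENNReal.ofReal_ne_top, one_mul]

/-- A Poincaré type estimate in which `m` is the average of ψ over a half ball pulled back by the
chart. The order of quantifiers is essential: `C` is fixed before ε, so that truncating the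
potential makes it small, whereas `D`, which multiplies only the finite-rank part, may blow up as ε
tends to 0. -/
theorem exists_oscillation_le : ∃ C : ℝ≥0, ∀ x₀ ∈ c.source, x₀ ∈ frontier Ω → ∀ ε : ℝ, 0 < ε →
    ∃ V : Set E3, IsOpen V ∧ x₀ ∈ V ∧ ∃ D : ℝ≥0, ∀ ψ : E3 → ℝ, ContDiff ℝ 1 ψ →
      ∃ m : ℝ, ‖m‖ₑ ≤ D * ∫⁻ w in Ω, ‖ψ w‖ₑ ∧ ∀ x ∈ V, x ∈ frontier Ω →
        ‖ψ x - m‖ₑ ≤ C * ∫⁻ w in Ω ∩ Metric.ball x ε,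
          ‖fderiv ℝ ψ w‖ₑ * ENNReal.ofReal (dist w x ^ (-2 : ℝ)) := by
  obtain ⟨v₁, hv₁def⟩ : ∃ v₁ : ℝ≥0∞, v₁ = volume (Metric.ball (0 : E3) 1) := ⟨_, rfl⟩
  have hv₁0 : v₁ ≠ 0 := hv₁def ▸ (Metric.measure_ball_pos _ _ one_pos).ne'
  refine ⟨64 * v₁⁻¹.toNNReal * (c.lip * (c.lip ^ 2 * c.lip ^ 3)), fun x₀ hx₀ hx₀' ε hε => ?_⟩
  let y₀ := c.toFun x₀
  obtain ⟨h₀, hh₀, hcube⟩ := Metric.isOpen_iff.1 (isOpen_cube c.size) y₀ (c.map_source x₀ hx₀)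
  obtain ⟨h, hh, hhh₀, hhε⟩ := exists_small_radius c.lip hh₀ hε
  have hball : Metric.ball y₀ h ⊆ cube c.size := (Metric.ball_subset_ball hhh₀).trans hcube
  have hBm : MeasurableSet (halfBall y₀ h) := (isOpen_halfBall y₀ h).measurableSet
  have hvB := le_volume_halfBall (c.map_frontier x₀ hx₀ hx₀') hh
  rw [← hv₁def] at hvB
  have hvBt := volume_halfBall_ne_top y₀ h
  have hr0 : ENNReal.ofReal ((h / 2) ^ 3) ≠ 0 := by simpa using by positivity
  have hvB0 : volume (halfBall y₀ h) ≠ 0 :=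
    (lt_of_lt_of_le (ENNReal.mul_pos hr0 hv₁0) hvB).ne'
  have hψint : ∀ ψ : E3 → ℝ, ContDiff ℝ 1 ψ →
      IntegrableOn (fun z => ψ (c.invFun z)) (halfBall y₀ h) := fun ψ hψ =>
    ((hψ.continuous.comp c.continuous_invFun).continuousOn.integrableOn_compact
      (isCompact_closedBall y₀ h)).mono_set
      (inter_subset_left.trans Metric.ball_subset_closedBall)
  obtain ⟨D, hD⟩ : ∃ D : ℝ≥0, (D : ℝ≥0∞) = (volume (halfBall y₀ h))⁻¹ * (c.lip : ℝ≥0∞) ^ 3 :=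
    ⟨_, ENNReal.coe_toNNReal (ENNReal.mul_ne_top (ENNReal.inv_ne_top.2 hvB0)
      (ENNReal.pow_ne_top ENNReal.coe_ne_top))⟩
  refine ⟨c.source ∩ c.toFun ⁻¹' (Metric.ball y₀ h),
    c.isOpen_source.inter (Metric.isOpen_ball.preimage c.continuous_toFun),
    ⟨hx₀, mem_preimage.2 (Metric.mem_ball_self hh)⟩, D, fun ψ hψ => ?_⟩
  obtain ⟨m, hm, hm'⟩ := exists_average_enorm_le hvB0 hvBt (hψint ψ hψ)
  refine ⟨m, hm.trans ?_, ?_⟩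
  · rw [hD, mul_assoc]
    exact mul_le_mul_right (c.lintegral_comp_invFun_le (f := fun w => ‖ψ w‖ₑ)
      (inter_subset_left.trans hball) (fun z hz => c.map_lower z ⟨hball hz.1, hz.2⟩)
      hψ.continuous.enorm.measurable) _
  · rintro x ⟨hxs, hxy⟩ hx
    have key := c.lintegral_enorm_sub_le hh hball hxy (c.map_frontier x hxs hx) hhε hψ
    rw [c.left_inv x hxs] at key
    refine (hm' (ψ x)).trans ((mul_le_mul' (ENNReal.inv_le_inv.2 hvB) key).trans ?_)
    exact inv_mul_le hh hv₁0 _ _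

end BoundaryChart

theorem _root_.IsCompact.exists_fin_subcover {X ι : Type*} [TopologicalSpace X] {K : Set X}
    (hK : IsCompact K) (U : ι → Set X) (hU : ∀ i, IsOpen (U i)) (hKU : K ⊆ ⋃ i, U i) :
    ∃ (n : ℕ) (f : Fin n → ι), K ⊆ ⋃ i, U (f i) := by
  obtain ⟨t, ht⟩ := hK.elim_finite_subcover U hU hKU
  refine ⟨t.card, fun i => t.equivFin.symm i, fun x hx => ?_⟩
  obtain ⟨i, hi, hxi⟩ := mem_iUnion₂.1 (ht hx)
  exact mem_iUnion.2 ⟨t.equivFin ⟨i, hi⟩, by simpa using hxi⟩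

/-! ### Covering the compact boundary by finitely many pieces -/

namespace IsBoundedLipschitzDomain

variable {Ω : Set E3}

theorem isCompact_frontier (hΩ : IsBoundedLipschitzDomain Ω) : IsCompact (frontier Ω) :=
  Metric.isCompact_of_isClosed_isBounded isClosed_frontier
    (hΩ.isBounded.closure.subset frontier_subset_closure)

theorem exists_finite_charts (hΩ : IsBoundedLipschitzDomain Ω) :
    ∃ (n : ℕ) (c : Fin n → BoundaryChart Ω), frontier Ω ⊆ ⋃ i, (c i).source := by
  refine hΩ.isCompact_frontier.exists_fin_subcover (fun c : BoundaryChart Ω => c.source)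
    (fun c => c.isOpen_source) fun x hx => ?_
  obtain ⟨c, hc⟩ := hΩ.exists_chart hx
  exact mem_iUnion.2 ⟨c, hc⟩

/-- The boundary of a bounded Lipschitz domain is a two-dimensional set. -/
theorem exists_hausdorffMeasure_le (hΩ : IsBoundedLipschitzDomain Ω) : ∃ C : ℝ≥0, ∀ (x : E3) (r : ℝ), 0 < r →
    (μHE[2] : Measure E3) (frontier Ω ∩ Metric.ball x r) ≤ C * ENNReal.ofReal (r ^ (2 : ℝ)) := by
  obtain ⟨n, c, hc⟩ := hΩ.exists_finite_charts
  choose C hC using fun i => (c i).exists_hausdorffMeasure_le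
  refine ⟨∑ i, C i, fun x r hr => ?_⟩
  have hsub : frontier Ω ∩ Metric.ball x r ⊆
      ⋃ i, (frontier Ω ∩ (c i).source ∩ Metric.ball x r) := fun y hy => by
    obtain ⟨i, hi⟩ := mem_iUnion.1 (hc hy.1)
    exact mem_iUnion.2 ⟨i, ⟨hy.1, hi⟩, hy.2⟩
  refine (measure_mono hsub).trans ((measure_iUnion_fintype_le _ _).trans ?_)
  push_cast
  rw [Finset.sum_mul]
  exact Finset.sum_le_sum fun i _ => hC i x r hr

/-- The boundary of a bounded Lipschitz domain can be partitioned into finitely many pieces on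
which `C¹` functions are constant up to a Riesz potential of their derivative. -/
theorem exists_partition (hΩ : IsBoundedLipschitzDomain Ω) : ∃ C : ℝ≥0, ∀ ε : ℝ, 0 < ε →
    ∃ (n : ℕ) (M : Fin n → Set E3) (D : ℝ≥0), (∀ i, MeasurableSet (M i)) ∧
      Pairwise (Function.onFun Disjoint M) ∧ frontier Ω ⊆ ⋃ i, M i ∧
      ∀ ψ : E3 → ℝ, ContDiff ℝ 1 ψ → ∀ i, ∃ m : ℝ, ‖m‖ₑ ≤ D * ∫⁻ w in Ω, ‖ψ w‖ₑ ∧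
        ∀ x ∈ M i, x ∈ frontier Ω → ‖ψ x - m‖ₑ ≤ C * ∫⁻ w in Ω ∩ Metric.ball x ε,
          ‖fderiv ℝ ψ w‖ₑ * ENNReal.ofReal (dist w x ^ (-2 : ℝ)) := by
  obtain ⟨n, c, hc⟩ := hΩ.exists_finite_charts
  choose C hC using fun i => (c i).exists_oscillation_le
  -- The number of charts is fixed before ε. Only the number of pieces and `D` depend on ε.
  refine ⟨∑ i, C i, fun ε hε => ?_⟩
  have key : ∀ x : frontier Ω, ∃ V : Set E3, IsOpen V ∧ x.1 ∈ V ∧ ∃ D : ℝ≥0, ∀ ψ : E3 → ℝ,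
      ContDiff ℝ 1 ψ → ∃ m : ℝ, ‖m‖ₑ ≤ D * ∫⁻ w in Ω, ‖ψ w‖ₑ ∧ ∀ x ∈ V, x ∈ frontier Ω →
        ‖ψ x - m‖ₑ ≤ (∑ i, C i : ℝ≥0) * ∫⁻ w in Ω ∩ Metric.ball x ε,
          ‖fderiv ℝ ψ w‖ₑ * ENNReal.ofReal (dist w x ^ (-2 : ℝ)) := by
    rintro ⟨x, hx⟩
    obtain ⟨i, hi⟩ := mem_iUnion.1 (hc hx)
    obtain ⟨V, hV, hxV, D, hD⟩ := hC i x hi hx ε hε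
    refine ⟨V, hV, hxV, D, fun ψ hψ => ?_⟩
    obtain ⟨m, hm, hm'⟩ := hD ψ hψ
    refine ⟨m, hm, fun y hy hy' => (hm' y hy hy').trans ?_⟩
    gcongr
    exact Finset.single_le_sum (f := C) (fun _ _ => zero_le) (Finset.mem_univ i)
  choose V hV hxV D hD using key
  obtain ⟨N, f, hf⟩ := hΩ.isCompact_frontier.exists_fin_subcover V hV
    fun x hx => mem_iUnion.2 ⟨⟨x, hx⟩, hxV _⟩
  -- Making the cover disjoint lets boundary integrals split into a sum over the pieces; the
  -- estimates survive because each piece only shrinks.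
  refine ⟨N, disjointed fun i : Fin N => V (f i), ∑ i, D (f i), fun i => ?_,
    disjoint_disjointed _, ?_, ?_⟩
  · exact disjointedRec (fun t j ht => ht.diff (hV (f j)).measurableSet) (hV (f i)).measurableSet
  · rwa [iUnion_disjointed]
  · intro ψ hψ i
    obtain ⟨m, hm, hm'⟩ := hD (f i) ψ hψ
    refine ⟨m, hm.trans ?_, fun x hx hx' => hm' x (disjointed_subset _ i hx) hx'⟩
    gcongr
    exact Finset.single_le_sum (f := fun i => D (f i)) (fun _ _ => zero_le) (Finset.mem_univ i)

end IsBoundedLipschitzDomain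

/-! ### The boundary measure and the truncated Riesz potential -/

theorem boundaryMeasure_ball_le {Ω : Set E3} (hΩ : IsBoundedLipschitzDomain Ω) (ΓD : Set E3) :
    ∃ C : ℝ≥0, ∀ (x : E3) (r : ℝ), 0 < r →
      boundaryMeasure Ω ΓD (Metric.ball x r) ≤ C * ENNReal.ofReal (r ^ (2 : ℝ)) := by
  obtain ⟨C, hC⟩ := hΩ.exists_hausdorffMeasure_le
  refine ⟨C, fun x r hr => (le_trans ?_ (hC x r hr))⟩
  rw [boundaryMeasure, Measure.restrict_apply Metric.isOpen_ball.measurableSet, inter_comm]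
  exact measure_mono (inter_subset_inter_left _ sdiff_subset)

theorem isFiniteMeasure_boundaryMeasure {Ω : Set E3} (hΩ : IsBoundedLipschitzDomain Ω)
    (ΓD : Set E3) : IsFiniteMeasure (boundaryMeasure Ω ΓD) := by
  obtain ⟨C, hC⟩ := hΩ.exists_hausdorffMeasure_le
  obtain ⟨R, hR, hsub⟩ := hΩ.isCompact_frontier.isBounded.subset_ball_lt 0 0
  refine ⟨?_⟩
  rw [boundaryMeasure, Measure.restrict_apply_univ]
  refine lt_of_le_of_lt ((measure_mono ?_).trans (hC 0 R hR))
    (ENNReal.mul_lt_top ENNReal.coe_lt_top ENNReal.ofReal_lt_top)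
  exact fun x hx => ⟨hx.1, hsub hx.1⟩

theorem IsBoundedLipschitzDomain.isFiniteMeasure_volume {Ω : Set E3}
    (hΩ : IsBoundedLipschitzDomain Ω) : IsFiniteMeasure (volume.restrict Ω) :=
  ⟨by rw [Measure.restrict_apply_univ]; exact hΩ.isBounded.measure_lt_top⟩

theorem ae_boundaryMeasure_mem {Ω : Set E3} {ΓD : Set E3} (hΓD : IsClosed ΓD) :
    ∀ᵐ x ∂(boundaryMeasure Ω ΓD), x ∈ neumannPart Ω ΓD :=
  ae_restrict_mem (isClosed_frontier.measurableSet.diff hΓD.measurableSet)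

/-- The kernels on the right are together more singular than ρ^(-2) by the power δ, and for ρ < ε
this excess can be traded for the small factor ε^δ. -/
theorem dist_rpow_le_mul {ρ ε s t δ a b : ℝ} (hρ0 : 0 ≤ ρ) (hρ : ρ < ε) (hδ : 0 < δ)
    (h : a * s + b * t = 2 + δ) :
    ENNReal.ofReal (ρ ^ (-2 : ℝ)) ≤ ENNReal.ofReal (ε ^ δ) *
      (ENNReal.ofReal (ρ ^ (-a)) ^ s * ENNReal.ofReal (ρ ^ (-b)) ^ t) := by
  rcases hρ0.eq_or_lt with rfl | hρ0
  · rw [Real.zero_rpow (by norm_num)]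
    simp
  rw [ENNReal.ofReal_rpow_of_pos (by positivity), ENNReal.ofReal_rpow_of_pos (by positivity),
    ← ENNReal.ofReal_mul (by positivity), ← ENNReal.ofReal_mul (by
      have : 0 < ε := hρ0.trans hρ
      positivity)]
  refine ENNReal.ofReal_le_ofReal ?_
  rw [← Real.rpow_mul hρ0.le, ← Real.rpow_mul hρ0.le, ← Real.rpow_add hρ0,
    show -a * s + -b * t = -2 + -δ by linarith, Real.rpow_add hρ0, mul_left_comm,
    Real.rpow_neg hρ0.le δ]
  refine le_mul_of_one_le_right (by positivity) ?_
  rw [← div_eq_mul_inv, one_le_div (by positivity)]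
  exact Real.rpow_le_rpow hρ0.le hρ.le hδ.le

/-- The Riesz potential maps `L^r(Ω)` to the dual of `L^P(Γ_N)`, with a small norm if it is
truncated to small distances. -/
theorem exists_lintegral_mul_potential_le {Ω : Set E3} (hΩ : IsBoundedLipschitzDomain Ω)
    (ΓD : Set E3) {P r : ℝ} (hP : 1 < P) (hr : 0 < r) (hr1 : 1 - 1 / r ≤ 1 / P)
    (hr2 : 2 / P < 3 * (1 - 1 / r)) :
    ∃ (K : ℝ≥0) (δ : ℝ), 0 < δ ∧ ∀ (g : E3 → ℝ≥0∞) (G : E3 → ℝ≥0∞),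
      AEMeasurable g (boundaryMeasure Ω ΓD) → Measurable G → ∀ ε : ℝ, 0 < ε →
      ∫⁻ x, g x * (∫⁻ w in Ω ∩ Metric.ball x ε, G w * ENNReal.ofReal (dist w x ^ (-2 : ℝ)))
        ∂(boundaryMeasure Ω ΓD) ≤ K * ENNReal.ofReal (ε ^ δ) *
          ((∫⁻ x, g x ^ P ∂(boundaryMeasure Ω ΓD)) ^ (1 / P) *
            (∫⁻ w in Ω, G w ^ r) ^ (1 / r)) := by
  have hfin := isFiniteMeasure_boundaryMeasure hΩ ΓD
  have hfinΩ := hΩ.isFiniteMeasure_volume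
  obtain ⟨C, hC⟩ := boundaryMeasure_ball_le hΩ ΓD
  -- The weights of the three-factor Hölder inequality: s + u = 1/P and t + u = 1/r, so that g^P and
  -- G^r enter with the right powers. The hypothesis `hr1` is the condition u ≥ 0.
  obtain ⟨s, hs⟩ : ∃ s, s = 1 - 1 / r := ⟨_, rfl⟩
  obtain ⟨t, ht⟩ : ∃ t, t = 1 - 1 / P := ⟨_, rfl⟩
  obtain ⟨u, hu⟩ : ∃ u, u = 1 / P - s := ⟨_, rfl⟩
  have hP1 : 1 / P < 1 := by rw [div_lt_one (by positivity)]; exact hP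
  have hP0 : 0 < 1 / P := by positivity
  have hP2 : 2 / P = 2 * (1 / P) := by ring
  rw [← hs] at hr1 hr2
  rw [hP2] at hr2
  have hs0 : 0 < s := by linarith
  have ht0 : 0 < t := by linarith
  have hu0 : 0 ≤ u := by linarith
  have hstu : s + t + u = 1 := by rw [hu, ht]; ring
  -- The exponents a = 3 - κ and b = 2 - κ lie just below the dimensions of the domain and of the
  -- boundary, so both Riesz potentials are bounded. Since s + t ≤ 1, the excess δ = as + bt - 2 is
  -- at least 3s - 2/P - κ, which is positive for this κ.
  obtain ⟨κ, hκ0, hκ1, hκ2⟩ : ∃ κ : ℝ, 0 < κ ∧ κ < 1 ∧ κ < 3 * s - 2 * (1 / P) := by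
    obtain ⟨κ, h1, h2⟩ := exists_between (lt_min (one_pos) (sub_pos.2 hr2))
    exact ⟨κ, h1, h2.trans_le (min_le_left _ _), h2.trans_le (min_le_right _ _)⟩
  obtain ⟨a, ha⟩ : ∃ a, a = 3 - κ := ⟨_, rfl⟩
  obtain ⟨b, hb⟩ : ∃ b, b = 2 - κ := ⟨_, rfl⟩
  obtain ⟨δ, hδ⟩ : ∃ δ, δ = a * s + b * t - 2 := ⟨_, rfl⟩
  have hδ0 : 0 < δ := by
    rw [hδ, ha, hb]
    have : s + t ≤ 1 := by linarith
    have : κ * (s + t) ≤ κ := by nlinarith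
    nlinarith
  obtain ⟨A, hA⟩ := exists_lintegral_dist_rpow_le (volume.restrict Ω) (d := 3) (a := a)
    (C := (volume (Metric.ball (0 : E3) 1)).toNNReal) (by
      intro x ρ hρ
      refine (Measure.restrict_apply_le _ _).trans (le_of_eq ?_)
      rw [Measure.addHaar_ball _ _ hρ.le, ENNReal.coe_toNNReal measure_ball_lt_top.ne, mul_comm]
      simp only [finrank_euclideanSpace, Fintype.card_fin]
      norm_cast) (by linarith) (by linarith)
  obtain ⟨B, hB⟩ := exists_lintegral_dist_rpow_le (boundaryMeasure Ω ΓD) hC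
    (a := b) (by linarith) (by linarith)
  refine ⟨(A ^ s * B ^ t), δ, hδ0, fun g G hg hG ε hε => ?_⟩
  have hsu : P * (s + u) = 1 := by rw [hu]; field_simp; ring
  have htu : r * (t + u) = 1 := by rw [hu, ht, hs]; field_simp; ring
  have key := lintegral_lintegral_mul_kernel_le (μ := boundaryMeasure Ω ΓD)
    (ν := volume.restrict Ω) (P := fun x => g x ^ P) (Q := fun w => G w ^ r)
    (a := fun z => ENNReal.ofReal (dist z.2 z.1 ^ (-a)))
    (b := fun z => ENNReal.ofReal (dist z.2 z.1 ^ (-b)))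
    (hg.pow_const _) (hG.pow_const _).aemeasurable (by fun_prop) (by fun_prop) (A := A) (B := B)
    hA (fun y => by simpa only [dist_comm y] using hB y) hs0.le ht0.le hu0 hstu
  have e1 : (∫⁻ x, g x ^ P ∂(boundaryMeasure Ω ΓD)) ^ (1 / P) =
      (∫⁻ x, g x ^ P ∂(boundaryMeasure Ω ΓD)) ^ s * (∫⁻ x, g x ^ P ∂(boundaryMeasure Ω ΓD)) ^ u := by
    rw [← ENNReal.rpow_add_of_nonneg _ _ hs0.le hu0]
    congr 1
    linarith
  have e2 : (∫⁻ w in Ω, G w ^ r) ^ (1 / r) =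
      (∫⁻ w in Ω, G w ^ r) ^ t * (∫⁻ w in Ω, G w ^ r) ^ u := by
    rw [← ENNReal.rpow_add_of_nonneg _ _ ht0.le hu0]
    congr 1
    linarith
  calc ∫⁻ x, g x * (∫⁻ w in Ω ∩ Metric.ball x ε, G w * ENNReal.ofReal (dist w x ^ (-2 : ℝ)))
        ∂(boundaryMeasure Ω ΓD)
      ≤ ∫⁻ x, ENNReal.ofReal (ε ^ δ) * (∫⁻ w in Ω, (g x ^ P) ^ (s + u) * (G w ^ r) ^ (t + u) *
          (ENNReal.ofReal (dist w x ^ (-a)) ^ s * ENNReal.ofReal (dist w x ^ (-b)) ^ t))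
          ∂(boundaryMeasure Ω ΓD) := by
        refine lintegral_mono fun x => ?_
        have hball : MeasurableSet (Metric.ball x ε) := Metric.isOpen_ball.measurableSet
        rw [inter_comm, ← Measure.restrict_restrict hball, ← lintegral_const_mul _ (by fun_prop),
          ← lintegral_const_mul' _ _ ENNReal.ofReal_ne_top]
        refine (setLIntegral_mono' hball fun w hw => ?_).trans (setLIntegral_le_lintegral _ _)
        rw [← ENNReal.rpow_mul, ← ENNReal.rpow_mul, hsu, htu, ENNReal.rpow_one, ENNReal.rpow_one]
        have := dist_rpow_le_mul (dist_nonneg (x := w) (y := x)) (Metric.mem_ball.1 hw) hδ0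
          (show a * s + b * t = 2 + δ by rw [hδ]; ring)
        calc g x * (G w * ENNReal.ofReal (dist w x ^ (-2 : ℝ)))
            ≤ g x * (G w * (ENNReal.ofReal (ε ^ δ) * (ENNReal.ofReal (dist w x ^ (-a)) ^ s *
              ENNReal.ofReal (dist w x ^ (-b)) ^ t))) :=
              mul_le_mul_right (mul_le_mul_right this _) _
          _ = _ := by ring
    _ = ENNReal.ofReal (ε ^ δ) * ∫⁻ x, (∫⁻ w in Ω, (g x ^ P) ^ (s + u) * (G w ^ r) ^ (t + u) *
          (ENNReal.ofReal (dist w x ^ (-a)) ^ s * ENNReal.ofReal (dist w x ^ (-b)) ^ t))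
          ∂(boundaryMeasure Ω ΓD) := lintegral_const_mul' _ _ ENNReal.ofReal_ne_top
    _ ≤ _ := by
        refine (mul_le_mul_right key _).trans (le_of_eq ?_)
        rw [e1, e2, ENNReal.mul_rpow_of_nonneg _ _ hs0.le, ENNReal.mul_rpow_of_nonneg _ _ ht0.le,
          ENNReal.mul_rpow_of_nonneg _ _ hu0, ENNReal.coe_mul,
          ← ENNReal.coe_rpow_of_nonneg _ hs0.le, ← ENNReal.coe_rpow_of_nonneg _ ht0.le]
        ring

/-! ### Pairing a boundary function with a smooth function -/

section Integral

variable {Ω ΓD : Set E3}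

theorem integrable_mul_of_continuous {P : ℝ≥0∞} (hP : 1 ≤ P) {μ : Measure E3} [IsFiniteMeasure μ]
    {g : E3 → ℝ} (hg : MemLp g P μ) {ψ : E3 → ℝ} (hψ : Continuous ψ) (hc : HasCompactSupport ψ) :
    Integrable (fun x => g x * ψ x) μ := by
  obtain ⟨M, hM⟩ := hψ.bounded_above_of_compact_support hc
  exact (hg.integrable hP).mul_bdd hψ.aestronglyMeasurable (Eventually.of_forall hM)

/-- On each piece write ψ = (ψ - m) + m. The oscillation is dominated by the truncated potential,
whose pairing with g carries the small factor. The constant m leaves only the integral of g over the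
piece, times a multiple of the L¹ norm of ψ. -/
theorem enorm_integral_mul_le (hΩ : IsBoundedLipschitzDomain Ω) (hΓD : IsClosed ΓD) {P r : ℝ}
    (hP : 1 < P) (hr : 0 < r) (hr1 : 1 - 1 / r ≤ 1 / P) (hr2 : 2 / P < 3 * (1 - 1 / r)) :
    ∀ η : ℝ, 0 < η → ∃ (n : ℕ) (M : Fin n → Set E3) (D : ℝ≥0), (∀ i, MeasurableSet (M i)) ∧
      ∀ g : E3 → ℝ, MemLp g (ENNReal.ofReal P) (boundaryMeasure Ω ΓD) →
      ∀ ψ : E3 → ℝ, ContDiff ℝ 1 ψ → HasCompactSupport ψ →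
      ‖∫ x, g x * ψ x ∂(boundaryMeasure Ω ΓD)‖ₑ ≤
        ENNReal.ofReal η * (eLpNorm g (ENNReal.ofReal P) (boundaryMeasure Ω ΓD) *
          eLpNorm (fderiv ℝ ψ) (ENNReal.ofReal r) (volume.restrict Ω)) +
        D * (∑ i, ‖∫ x in M i, g x ∂(boundaryMeasure Ω ΓD)‖ₑ) *
          eLpNorm ψ 1 (volume.restrict Ω) := by
  intro η hη
  have hfin := isFiniteMeasure_boundaryMeasure hΩ ΓD
  obtain ⟨K, δ, hδ, hK⟩ := exists_lintegral_mul_potential_le hΩ ΓD hP hr hr1 hr2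
  obtain ⟨C, hC⟩ := hΩ.exists_partition
  obtain ⟨ε, hε, hεη⟩ : ∃ ε : ℝ, 0 < ε ∧ C * K * ε ^ δ ≤ η := by
    refine ⟨(η / (C * K + 1)) ^ (1 / δ), by positivity, ?_⟩
    rw [← Real.rpow_mul (by positivity), one_div, inv_mul_cancel₀ hδ.ne', Real.rpow_one,
      mul_div_assoc', div_le_iff₀ (by positivity)]
    nlinarith
  obtain ⟨n, M, D, hM, hMd, hcov, hosc⟩ := hC ε hε
  refine ⟨n, M, D, hM, fun g hg ψ hψ hc => ?_⟩
  have hP1 : (1 : ℝ≥0∞) ≤ ENNReal.ofReal P := by simpa using hP.le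
  choose m hm hm' using hosc ψ hψ
  have hgψ := integrable_mul_of_continuous hP1 hg hψ.continuous hc
  have hgi : Integrable g (boundaryMeasure Ω ΓD) := hg.integrable hP1
  have hU : ∀ᵐ x ∂(boundaryMeasure Ω ΓD), x ∈ ⋃ i, M i :=
    (ae_boundaryMeasure_mem hΓD).mono fun x hx => hcov hx.1
  have hsplit : ∫ x, g x * ψ x ∂(boundaryMeasure Ω ΓD) =
      ∑ i, ∫ x in M i, g x * ψ x ∂(boundaryMeasure Ω ΓD) := by
    rw [← integral_iUnion_fintype hM hMd (fun i => hgψ.integrableOn),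
      Measure.restrict_eq_self_of_ae_mem hU]
  let pot : E3 → ℝ≥0∞ := fun x => ∫⁻ w in Ω ∩ Metric.ball x ε,
    ‖fderiv ℝ ψ w‖ₑ * ENNReal.ofReal (dist w x ^ (-2 : ℝ))
  have hpiece : ∀ i, ‖∫ x in M i, g x * ψ x ∂(boundaryMeasure Ω ΓD)‖ₑ ≤
      (∫⁻ x in M i, ‖g x‖ₑ * (C * pot x) ∂(boundaryMeasure Ω ΓD)) +
        D * ‖∫ x in M i, g x ∂(boundaryMeasure Ω ΓD)‖ₑ * eLpNorm ψ 1 (volume.restrict Ω) := by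
    intro i
    have e : ∫ x in M i, g x * ψ x ∂(boundaryMeasure Ω ΓD) =
        (∫ x in M i, g x * (ψ x - m i) ∂(boundaryMeasure Ω ΓD)) +
          (∫ x in M i, g x ∂(boundaryMeasure Ω ΓD)) * m i := by
      rw [← integral_mul_const, ← integral_add]
      · simp only [mul_sub, sub_add_cancel]
      · simp only [mul_sub]
        exact (hgψ.sub (hgi.mul_const _)).integrableOn
      · exact (hgi.mul_const _).integrableOn
    rw [e]
    refine (enorm_add_le _ _).trans (add_le_add ?_ ?_)
    · refine (enorm_integral_le_lintegral_enorm _).trans ?_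
      refine lintegral_mono_ae ?_
      filter_upwards [ae_restrict_mem (hM i), ae_restrict_of_ae (ae_boundaryMeasure_mem hΓD)]
        with x hx hx'
      rw [enorm_mul]
      gcongr
      exact hm' i x hx hx'.1
    · rw [enorm_mul, eLpNorm_one_eq_lintegral_enorm]
      calc _ ≤ ‖∫ x in M i, g x ∂(boundaryMeasure Ω ΓD)‖ₑ * (D * ∫⁻ w in Ω, ‖ψ w‖ₑ) := by
            gcongr
            exact hm i
        _ = _ := by ring
  have hpot : ∑ i, ∫⁻ x in M i, ‖g x‖ₑ * (C * pot x) ∂(boundaryMeasure Ω ΓD) ≤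
      ENNReal.ofReal η * (eLpNorm g (ENNReal.ofReal P) (boundaryMeasure Ω ΓD) *
          eLpNorm (fderiv ℝ ψ) (ENNReal.ofReal r) (volume.restrict Ω)) := by
    rw [← tsum_fintype (L := .unconditional _), ← lintegral_iUnion hM hMd]
    refine (setLIntegral_le_lintegral _ _).trans ?_
    simp only [mul_left_comm _ (C : ℝ≥0∞)]
    rw [lintegral_const_mul' _ _ ENNReal.coe_ne_top]
    have := hK (fun x => ‖g x‖ₑ) (fun w => ‖fderiv ℝ ψ w‖ₑ) hg.1.enorm
      (hψ.continuous_fderiv one_ne_zero).enorm.measurable ε hε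
    rw [eLpNorm_eq_lintegral_rpow_enorm_toReal (by simpa using by positivity)
      ENNReal.ofReal_ne_top, eLpNorm_eq_lintegral_rpow_enorm_toReal (by simpa using by positivity)
      ENNReal.ofReal_ne_top, ENNReal.toReal_ofReal (by positivity), ENNReal.toReal_ofReal hr.le]
    refine (mul_le_mul_right
      (show ∫⁻ x, ‖g x‖ₑ * pot x ∂(boundaryMeasure Ω ΓD) ≤ _ from this) _).trans ?_
    refine (le_of_eq (mul_assoc _ _ _).symm).trans (mul_le_mul_left ?_ _)
    refine le_trans (le_of_eq ?_) (ENNReal.ofReal_le_ofReal hεη)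
    rw [ENNReal.ofReal_mul (by positivity), ENNReal.ofReal_mul (by positivity),
      ENNReal.ofReal_coe_nnreal, ENNReal.ofReal_coe_nnreal, mul_assoc]
  rw [hsplit]
  calc _ ≤ ∑ i, ‖∫ x in M i, g x * ψ x ∂(boundaryMeasure Ω ΓD)‖ₑ := enorm_sum_le _ _
    _ ≤ ∑ i, ((∫⁻ x in M i, ‖g x‖ₑ * (C * pot x) ∂(boundaryMeasure Ω ΓD)) +
        D * ‖∫ x in M i, g x ∂(boundaryMeasure Ω ΓD)‖ₑ * eLpNorm ψ 1 (volume.restrict Ω)) :=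
        Finset.sum_le_sum fun i _ => hpiece i
    _ ≤ _ := by
        rw [Finset.sum_add_distrib, ← Finset.sum_mul, ← Finset.mul_sum]
        exact add_le_add hpot le_rfl

end Integral

/-! ### Test functions as elements of the Sobolev space -/

section SobolevTest

variable {Ω : Set E3}

theorem setIntegral_partialDeriv_mul (i : Fin 3) {φ ψ : E3 → ℝ} (hφ : ContDiff ℝ ∞ φ)
    (hc : HasCompactSupport φ) (hs : tsupport φ ⊆ Ω) (hψ : ContDiff ℝ ∞ ψ) :
    ∫ x in Ω, partialDeriv i φ x * ψ x = -∫ x in Ω, φ x * partialDeriv i ψ x := by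
  have h1 : ∫ x in Ω, partialDeriv i φ x * ψ x = ∫ x, partialDeriv i φ x * ψ x := by
    refine setIntegral_eq_integral_of_forall_compl_eq_zero fun x hx => ?_
    have : fderiv ℝ φ x = 0 :=
      image_eq_zero_of_notMem_tsupport fun h => hx (hs (tsupport_fderiv_subset ℝ h))
    simp [partialDeriv, this]
  have h2 : ∫ x in Ω, φ x * partialDeriv i ψ x = ∫ x, φ x * partialDeriv i ψ x := by
    refine setIntegral_eq_integral_of_forall_compl_eq_zero fun x hx => ?_
    rw [image_eq_zero_of_notMem_tsupport fun h => hx (hs h), zero_mul]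
  rw [h1, h2, neg_eq_iff_eq_neg.symm]
  refine (integral_mul_fderiv_eq_neg_fderiv_mul_of_integrable ?_ ?_ ?_ ?_ ?_).symm
  · exact ((continuous_partialDeriv i hφ).mul hψ.continuous).integrable_of_hasCompactSupport
      (hasCompactSupport_partialDeriv i hc).mul_right
  · exact (hφ.continuous.mul (continuous_partialDeriv i hψ)).integrable_of_hasCompactSupport
      hc.mul_right
  · exact (hφ.continuous.mul hψ.continuous).integrable_of_hasCompactSupport hc.mul_right
  · exact fun x _ => hφ.differentiable (by simp) x
  · exact fun x _ => hψ.differentiable (by simp) x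

/-- The weak gradient of a smooth function is the classical one. -/
theorem grad_ae_eq_of_fn_ae_eq (hΩ : IsOpen Ω) {r : ℝ≥0∞} [hr : Fact (1 ≤ r)] {w : SobolevSpace Ω r}
    {ψ : E3 → ℝ} (hψ : ContDiff ℝ ∞ ψ) (hw : w.fn =ᵐ[volume.restrict Ω] ψ) :
    ∀ᵐ x ∂(volume.restrict Ω), ∀ i, w.grad x i = partialDeriv i ψ x := by
  rw [ae_all_iff]
  intro i
  have hloc : LocallyIntegrable (fun x => w.grad x i) (volume.restrict Ω) :=
    (memLp_coord (Lp.memLp w.grad) i).locallyIntegrable hr.out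
  have hloc' : LocallyIntegrable (fun x => partialDeriv i ψ x) (volume.restrict Ω) :=
    (continuous_partialDeriv i hψ).locallyIntegrable
  have h := hΩ.ae_eq_zero_of_integral_contDiff_smul_eq_zero (μ := volume.restrict Ω)
    (f := fun x => w.grad x i - partialDeriv i ψ x) ((hloc.sub hloc').locallyIntegrableOn _) ?_
  · filter_upwards [h, ae_restrict_mem hΩ.measurableSet] with x hx hx'
    exact sub_eq_zero.1 (hx hx')
  intro φ hφ hc hs
  simp only [smul_eq_mul, mul_sub]
  rw [integral_sub (g := fun x => φ x * partialDeriv i ψ x) (integrable_mul_of_Lp hr.out (memLp_coord (Lp.memLp w.grad) i) hφ.continuous hc)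
    ((hφ.continuous.mul (continuous_partialDeriv i hψ)).integrable_of_hasCompactSupport
      hc.mul_right).integrableOn]
  have h1 := w.2 φ hφ hc hs i
  have h2 := setIntegral_partialDeriv_mul i hφ hc hs hψ
  have h3 : ∫ x in Ω, partialDeriv i φ x * w.fn x = ∫ x in Ω, partialDeriv i φ x * ψ x :=
    integral_congr_ae (hw.mono fun x hx => by simp only [hx])
  change ∫ x in Ω, partialDeriv i φ x * w.fn x = -∫ x in Ω, φ x * w.grad x i at h1
  linarith

theorem mem_sobolevTest (hΩ : IsOpen Ω) {Ξ : Set E3} {r : ℝ≥0∞} [hr : Fact (1 ≤ r)]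
    {w : SobolevSpace Ω r} {ψ : E3 → ℝ} (hψ : IsTestFunctionOff Ξ ψ)
    (hw : w.fn =ᵐ[volume.restrict Ω] ψ) : w ∈ sobolevTest Ω Ξ r :=
  ⟨ψ, hψ, hw, grad_ae_eq_of_fn_ae_eq hΩ hψ.1 hw⟩

/-- Every test function restricts to an element of the Sobolev space. -/
theorem exists_fn_ae_eq (Ξ : Set E3) {r : ℝ≥0∞} [hr : Fact (1 ≤ r)] {ψ : E3 → ℝ}
    (hψ : IsTestFunctionOff Ξ ψ) : ∃ w : SobolevSpace Ω r, w.fn =ᵐ[volume.restrict Ω] ψ := by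
  have h1 : MemLp ψ r (volume.restrict Ω) :=
    (hψ.1.continuous.memLp_of_hasCompactSupport hψ.2.1).restrict Ω
  let G : E3 → E3 := fun x => WithLp.toLp 2 fun i => partialDeriv i ψ x
  have hGc : Continuous G := (PiLp.continuous_toLp 2 _).comp
    (continuous_pi fun i => continuous_partialDeriv i hψ.1)
  have hGs : HasCompactSupport G := by
    refine (hψ.2.1.fderiv ℝ).mono' fun x hx => ?_
    refine subset_tsupport _ fun h => hx ?_
    ext i
    change partialDeriv i ψ x = 0
    rw [partialDeriv, h]
    rfl
  have h2 : MemLp G r (volume.restrict Ω) := (hGc.memLp_of_hasCompactSupport hGs).restrict Ω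
  refine ⟨⟨WithLp.toLp r (h1.toLp ψ, h2.toLp G), ?_⟩, h1.coeFn_toLp⟩
  intro φ hφ hc hs i
  change ∫ x in Ω, partialDeriv i φ x * (h1.toLp ψ : E3 → ℝ) x = -∫ x in Ω, φ x * (h2.toLp G : E3 → E3) x i
  have e1 : ∫ x in Ω, partialDeriv i φ x * (h1.toLp ψ : E3 → ℝ) x = ∫ x in Ω, partialDeriv i φ x * ψ x :=
    integral_congr_ae (h1.coeFn_toLp.mono fun x hx => by simp only [hx])
  have e2 : ∫ x in Ω, φ x * (h2.toLp G : E3 → E3) x i = ∫ x in Ω, φ x * partialDeriv i ψ x :=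
    integral_congr_ae (h2.coeFn_toLp.mono fun x hx => by simp only [hx]; rfl)
  rw [e1, e2]
  exact setIntegral_partialDeriv_mul i hφ hc hs hψ.1

theorem norm_fn_le {r : ℝ≥0∞} [Fact (1 ≤ r)] (w : SobolevSpace Ω r) : ‖w.fn‖ ≤ ‖w‖ :=
  WithLp.norm_fst_le _ w.1

theorem norm_grad_le {r : ℝ≥0∞} [Fact (1 ≤ r)] (w : SobolevSpace Ω r) : ‖w.grad‖ ≤ ‖w‖ :=
  WithLp.norm_snd_le _ w.1

/-- The derivative is the inner product with the vector of partial derivatives, so the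
Cauchy–Schwarz inequality applies. -/
theorem norm_fderiv_le {v : E3} {ψ : E3 → ℝ} {x : E3} (h : ∀ i, v i = partialDeriv i ψ x) :
    ‖fderiv ℝ ψ x‖ ≤ ‖v‖ := by
  refine ContinuousLinearMap.opNorm_le_bound _ (norm_nonneg _) fun y => ?_
  have hy : y = ∑ i, y i • EuclideanSpace.single i (1 : ℝ) := by
    ext j
    simp [Pi.single_apply]
  have : fderiv ℝ ψ x y = inner ℝ v y := by
    conv_lhs => rw [hy]
    rw [map_sum, PiLp.inner_apply]
    refine Finset.sum_congr rfl fun i _ => ?_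
    rw [map_smul, h i]
    simp [partialDeriv]
  rw [this]
  exact abs_real_inner_le_norm v y

theorem exists_eLpNorm_le_norm (hΩ : IsBoundedLipschitzDomain Ω) {r s : ℝ≥0∞} (hsr : s ≤ r)
    (hs : s ≠ 0) [hr : Fact (1 ≤ r)] :
    ∃ C : ℝ≥0, ∀ (w : SobolevSpace Ω r) (ψ : E3 → ℝ), ContDiff ℝ ∞ ψ →
      w.fn =ᵐ[volume.restrict Ω] ψ → eLpNorm ψ 1 (volume.restrict Ω) ≤ C * ‖w‖ₑ ∧
        eLpNorm (fderiv ℝ ψ) s (volume.restrict Ω) ≤ C * ‖w‖ₑ := by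
  have hfin := hΩ.isFiniteMeasure_volume
  let c : ℝ≥0∞ → ℝ≥0 := fun s =>
    ((volume.restrict Ω : Measure E3) univ ^ (1 / s.toReal - 1 / r.toReal)).toNNReal
  have hc : ∀ s ≤ r, s ≠ 0 → (c s : ℝ≥0∞) =
      (volume.restrict Ω : Measure E3) univ ^ (1 / s.toReal - 1 / r.toReal) := by
    intro s hs hs0
    refine ENNReal.coe_toNNReal (ENNReal.rpow_ne_top_of_nonneg ?_ (measure_ne_top _ _))
    rcases eq_or_ne r ⊤ with rfl | h
    · simp
    · rw [sub_nonneg]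
      exact one_div_le_one_div_of_le (ENNReal.toReal_pos hs0 (ne_top_of_le_ne_top h hs))
        (ENNReal.toReal_mono h hs)
  refine ⟨c 1 + c s, fun w ψ hψ hw => ⟨?_, ?_⟩⟩
  · calc eLpNorm ψ 1 (volume.restrict Ω)
        ≤ eLpNorm ψ r (volume.restrict Ω) * c 1 := by
          rw [hc 1 hr.out one_ne_zero]
          exact eLpNorm_le_eLpNorm_mul_rpow_measure_univ hr.out hψ.continuous.aestronglyMeasurable
      _ = ‖w.fn‖ₑ * c 1 := by rw [← eLpNorm_congr_ae hw, Lp.enorm_def]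
      _ ≤ ‖w‖ₑ * c 1 := by
          gcongr
          exact enorm_le_iff_norm_le.2 (norm_fn_le w)
      _ ≤ _ := by
          rw [mul_comm]
          gcongr
          exact_mod_cast le_self_add
  · have hg := grad_ae_eq_of_fn_ae_eq hΩ.isOpen hψ hw
    calc eLpNorm (fderiv ℝ ψ) s (volume.restrict Ω)
        ≤ eLpNorm (fderiv ℝ ψ) r (volume.restrict Ω) * c s := by
          rw [hc s hsr hs]
          exact eLpNorm_le_eLpNorm_mul_rpow_measure_univ hsr
            (hψ.continuous_fderiv (by simp)).aestronglyMeasurable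
      _ ≤ ‖w.grad‖ₑ * c s := by
          rw [Lp.enorm_def]
          gcongr
          exact eLpNorm_mono_ae (hg.mono fun x hx => norm_fderiv_le hx)
      _ ≤ ‖w‖ₑ * c s := by
          gcongr
          exact enorm_le_iff_norm_le.2 (norm_grad_le w)
      _ ≤ _ := by
          rw [mul_comm]
          gcongr
          exact_mod_cast le_add_self

end SobolevTest

/-! ### The trace estimate and the density of test functions -/

section Functional

variable {Ω ΓD : Set E3}

/-- The trace estimate: functions in `L^P(Γ_N)` act on test functions, and the norm of this action
is, up to a small multiple of the norm of the function, controlled by finitely many integrals. -/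
theorem exists_abs_integral_mul_le (hΩ : IsBoundedLipschitzDomain Ω) (hΓD : IsClosed ΓD)
    {P q q' : ℝ} [Fact (1 ≤ ENNReal.ofReal q')] [Fact (1 ≤ ENNReal.ofReal P)] (hP : 1 < P)
    (hq : q.HolderConjugate q') (hqP : 2 / 3 * q < P) :
    ∀ η : ℝ, 0 < η → ∃ (n : ℕ) (M : Fin n → Set E3) (D : ℝ), 0 ≤ D ∧ (∀ i, MeasurableSet (M i)) ∧
      ∀ (g : Lp ℝ (ENNReal.ofReal P) (boundaryMeasure Ω ΓD))
        (w : SobolevSpace Ω (ENNReal.ofReal q')) (ψ : E3 → ℝ), IsTestFunctionOff ΓD ψ →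
        w.fn =ᵐ[volume.restrict Ω] ψ → |∫ x, g x * ψ x ∂(boundaryMeasure Ω ΓD)| ≤
          (η * ‖g‖ + ∑ i, D * |∫ x in M i, g x ∂(boundaryMeasure Ω ΓD)|) * ‖w‖ := by
  intro η hη
  have hq0 : 0 < q := hq.pos
  have hq'0 : 0 < q' := hq.symm.pos
  have hsum : 1 / q + 1 / q' = 1 := by simpa using hq.inv_add_inv_eq_one
  -- The gradient exponent is r = 1/m. The potential estimate needs 1 - 1/r ≤ 1/P, so q' is lowered
  -- where necessary, which is harmless on a domain of finite measure. If m = 1/q', then 2/P < 3(1 -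
  -- 1/r) is the hypothesis `hqP`; if m = 1 - 1/P, it reads 2/P < 3/P.
  obtain ⟨m, hm⟩ : ∃ m, m = max (1 / q') (1 - 1 / P) := ⟨_, rfl⟩
  have hm0 : 0 < m := hm ▸ lt_max_of_lt_left (by positivity)
  have hr : 1 / (1 / m) = m := one_div_one_div m
  have hr1 : 1 - 1 / (1 / m) ≤ 1 / P := by
    rw [hr, hm]
    linarith [le_max_right (1 / q') (1 - 1 / P)]
  have hr2 : 2 / P < 3 * (1 - 1 / (1 / m)) := by
    have h1 : 2 / P < 3 / q := by
      rw [div_lt_div_iff₀ (by positivity) hq0]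
      linarith
    have e1 : 2 / P = 2 * (1 / P) := by ring
    have e2 : 3 / q = 3 * (1 / q) := by ring
    have hP0 : 0 < 1 / P := by positivity
    rw [e1, e2] at h1
    rw [hr, hm, e1]
    rcases max_choice (1 / q') (1 - 1 / P) with h | h <;> rw [h] <;> linarith
  have hrq : 1 / m ≤ q' := by
    rw [one_div_le hm0 hq'0, hm]
    exact le_max_left _ _
  obtain ⟨C, hC⟩ := exists_eLpNorm_le_norm hΩ (r := ENNReal.ofReal q')
    (s := ENNReal.ofReal (1 / m)) (ENNReal.ofReal_le_ofReal hrq) (by simpa using hm0)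
  obtain ⟨n, M, D, hM, hmain⟩ := enorm_integral_mul_le (ΓD := ΓD) hΩ hΓD hP (by positivity) hr1 hr2
    (η / (C + 1)) (by positivity)
  refine ⟨n, M, C * D, by positivity, hM, fun g w ψ hψ hw => ?_⟩
  obtain ⟨h1, h2⟩ := hC w ψ hψ.1 hw
  have key := hmain g (Lp.memLp g) ψ (hψ.1.of_le (by simp)) hψ.2.1
  have key2 : ‖∫ x, g x * ψ x ∂(boundaryMeasure Ω ΓD)‖ₑ ≤
      ENNReal.ofReal ((η * ‖g‖ + ∑ i, C * D * |∫ x in M i, g x ∂(boundaryMeasure Ω ΓD)|) * ‖w‖) := by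
    refine key.trans ?_
    have hη' : η / (C + 1) * C ≤ η := by
      rw [div_mul_eq_mul_div, div_le_iff₀ (by positivity)]
      nlinarith
    calc _ ≤ ENNReal.ofReal (η / (C + 1)) * (‖g‖ₑ * (C * ‖w‖ₑ)) +
          D * (∑ i, ‖∫ x in M i, g x ∂(boundaryMeasure Ω ΓD)‖ₑ) * (C * ‖w‖ₑ) := by
          rw [Lp.enorm_def]
          gcongr
      _ = (ENNReal.ofReal (η / (C + 1) * C) * ‖g‖ₑ +
          ∑ i, C * D * ‖∫ x in M i, g x ∂(boundaryMeasure Ω ΓD)‖ₑ) * ‖w‖ₑ := by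
          rw [ENNReal.ofReal_mul (by positivity), ENNReal.ofReal_coe_nnreal, ← Finset.mul_sum]
          ring
      _ ≤ (ENNReal.ofReal η * ‖g‖ₑ +
          ∑ i, C * D * ‖∫ x in M i, g x ∂(boundaryMeasure Ω ΓD)‖ₑ) * ‖w‖ₑ := by
          gcongr
      _ = _ := by
          rw [ENNReal.ofReal_mul (by positivity), ENNReal.ofReal_add (by positivity) (by positivity),
            ENNReal.ofReal_mul hη.le, ofReal_norm, ofReal_norm, ENNReal.ofReal_sum_of_nonneg
              (fun i _ => by positivity)]
          congr 2
          refine Finset.sum_congr rfl fun i _ => ?_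
          rw [ENNReal.ofReal_mul (by positivity), ENNReal.ofReal_mul (by positivity),
            ENNReal.ofReal_coe_nnreal, ENNReal.ofReal_coe_nnreal, Real.enorm_eq_ofReal_abs]
  rw [Real.enorm_eq_ofReal_abs] at key2
  exact (ENNReal.ofReal_le_ofReal_iff (by positivity)).1 key2

theorem denseRange_inclusion_sobolevTest (Ω Ξ : Set E3) (r : ℝ≥0∞) [Fact (1 ≤ r)] : DenseRange
    (Submodule.inclusion (sobolevTest Ω Ξ r).le_topologicalClosure) :=
  (denseRange_inclusion_iff (sobolevTest Ω Ξ r).le_topologicalClosure).2 fun _ h => h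

/-- The density of test functions, as a bound for the dual norm. -/
theorem NegSobolev.norm_le_of_forall_test {Ξ : Set E3} {r : ℝ≥0∞} [Fact (1 ≤ r)]
    (ℓ : NegSobolev Ω Ξ r) {B : ℝ} (hB : 0 ≤ B)
    (h : ∀ w : sobolevOff Ω Ξ r, w.1 ∈ sobolevTest Ω Ξ r → |ℓ w| ≤ B * ‖w‖) : ‖ℓ‖ ≤ B := by
  refine ContinuousLinearMap.opNorm_le_bound _ hB fun w => ?_
  refine isClosed_property (denseRange_inclusion_sobolevTest Ω Ξ r) (p := fun w => ‖ℓ w‖ ≤ B * ‖w‖)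
    (isClosed_le (by fun_prop) (by fun_prop)) ?_ w
  exact fun v => h _ v.2

end Functional

/-! ### Boundary functions as elements of the dual space -/

section Functional

variable {Ω ΓD : Set E3}

theorem exists_setIntegral_clm {μ : Measure E3} [IsFiniteMeasure μ] {P : ℝ≥0∞}
    [hP : Fact (1 ≤ P)] (M : Set E3) : ∃ ℓ : Lp ℝ P μ →L[ℝ] ℝ, ∀ g, ℓ g = ∫ x in M, g x ∂μ := by
  have hint : ∀ g : Lp ℝ P μ, Integrable g μ := fun g => (Lp.memLp g).integrable hP.out
  have hexp : 0 ≤ 1 / (1 : ℝ≥0∞).toReal - 1 / P.toReal := by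
    rcases eq_or_ne P ⊤ with rfl | h
    · simp
    · rw [sub_nonneg]
      exact one_div_le_one_div_of_le (by simp) (ENNReal.toReal_mono h hP.out)
  have hc : μ univ ^ (1 / (1 : ℝ≥0∞).toReal - 1 / P.toReal) ≠ ⊤ :=
    ENNReal.rpow_ne_top_of_nonneg hexp (measure_ne_top _ _)
  suffices h : ∃ ℓ : Lp ℝ P μ →L[ℝ] ℝ, ∀ g, ℓ g = ∫ x in M, g x ∂μ ∧ ‖ℓ g‖ ≤
      (μ univ ^ (1 / (1 : ℝ≥0∞).toReal - 1 / P.toReal)).toReal * ‖g‖ from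
    h.imp fun ℓ hℓ g => (hℓ g).1
  refine exists_clm_of_relation (fun (g : Lp ℝ P μ) (r : ℝ) => r = ∫ x in M, g x ∂μ) _ ?_ ?_ ?_ ?_
  · rintro g g' _ _ rfl rfl
    rw [← integral_add (hint g).integrableOn (hint g').integrableOn]
    exact integral_congr_ae (ae_restrict_of_ae ((Lp.coeFn_add g g').mono fun x hx => hx.symm))
  · rintro c g _ rfl
    rw [← integral_smul]
    exact integral_congr_ae (ae_restrict_of_ae ((Lp.coeFn_smul c g).mono fun x hx => hx.symm))
  · exact fun g _ _ h h' => h.trans h'.symm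
  · intro g
    refine ⟨_, rfl, ?_⟩
    have h1 : ‖∫ x in M, g x ∂μ‖ₑ ≤
        μ univ ^ (1 / (1 : ℝ≥0∞).toReal - 1 / P.toReal) * ‖g‖ₑ := by
      calc ‖∫ x in M, g x ∂μ‖ₑ ≤ ∫⁻ x in M, ‖g x‖ₑ ∂μ := enorm_integral_le_lintegral_enorm _
        _ ≤ ∫⁻ x, ‖g x‖ₑ ∂μ := setLIntegral_le_lintegral _ _
        _ = eLpNorm g 1 μ := eLpNorm_one_eq_lintegral_enorm.symm
        _ ≤ _ := by
          rw [Lp.enorm_def, mul_comm]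
          exact eLpNorm_le_eLpNorm_mul_rpow_measure_univ hP.out (Lp.memLp g).1
    have h2 := ENNReal.toReal_mono (ENNReal.mul_ne_top hc enorm_ne_top) h1
    rwa [ENNReal.toReal_mul, toReal_enorm, toReal_enorm] at h2

/-- A functional which is bounded on the test functions extends to the closure. -/
theorem exists_negSobolev (hΩ : IsOpen Ω) {r : ℝ≥0∞} [Fact (1 ≤ r)] (Φ : (E3 → ℝ) → ℝ)
    (hadd : ∀ ψ₁ ψ₂, IsTestFunctionOff ΓD ψ₁ → IsTestFunctionOff ΓD ψ₂ →
      Φ (ψ₁ + ψ₂) = Φ ψ₁ + Φ ψ₂)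
    (hsmul : ∀ (c : ℝ) ψ, IsTestFunctionOff ΓD ψ → Φ (c • ψ) = c * Φ ψ) {B : ℝ}
    (hB : ∀ (w : SobolevSpace Ω r) ψ, IsTestFunctionOff ΓD ψ → w.fn =ᵐ[volume.restrict Ω] ψ →
      |Φ ψ| ≤ B * ‖w‖) :
    ∃ ℓ : NegSobolev Ω ΓD r, ∀ (w : sobolevOff Ω ΓD r) (ψ : E3 → ℝ), IsTestFunctionOff ΓD ψ →
      w.1.fn =ᵐ[volume.restrict Ω] ψ → ℓ w = Φ ψ := by
  let R : sobolevTest Ω ΓD r → ℝ → Prop := fun w y =>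
    ∃ ψ, IsTestFunctionOff ΓD ψ ∧ w.1.fn =ᵐ[volume.restrict Ω] ψ ∧ y = Φ ψ
  have hRadd : ∀ x y f g, R x f → R y g → R (x + y) (f + g) := by
    rintro x y _ _ ⟨ψ₁, h1, h2, rfl⟩ ⟨ψ₂, k1, k2, rfl⟩
    exact ⟨ψ₁ + ψ₂, h1.add k1, (Lp.coeFn_add x.1.fn y.1.fn).trans (h2.add k2),
      (hadd _ _ h1 k1).symm⟩
  have hRsmul : ∀ (c : ℝ) x f, R x f → R (c • x) (c • f) := by
    rintro c x _ ⟨ψ, h1, h2, rfl⟩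
    exact ⟨c • ψ, h1.smul c, (Lp.coeFn_smul c x.1.fn).trans (h2.const_smul c),
      (hsmul c _ h1).symm⟩
  -- The value does not depend on the chosen ψ: a difference of two choices represents the zero
  -- element of the Sobolev space, where the bound `hB` forces Φ to vanish.
  have hRuniq : ∀ x f g, R x f → R x g → f = g := by
    intro x f g hf hg
    have h0 : R (x + (-1 : ℝ) • x) (f + (-1 : ℝ) • g) := hRadd _ _ _ _ hf (hRsmul _ _ _ hg)
    rw [neg_one_smul, neg_one_smul, add_neg_cancel] at h0
    obtain ⟨ψ, h1, h2, h3⟩ := h0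
    have := hB _ ψ h1 h2
    rw [← h3] at this
    simp only [ZeroMemClass.coe_zero, norm_zero, mul_zero] at this
    have h4 := abs_nonpos_iff.1 this
    linarith
  obtain ⟨f, hf⟩ := exists_clm_of_relation R B hRadd hRsmul hRuniq fun w => by
    obtain ⟨ψ, h1, h2, -⟩ := w.2
    exact ⟨_, ⟨ψ, h1, h2, rfl⟩, hB w.1 ψ h1 h2⟩
  let e : sobolevTest Ω ΓD r →L[ℝ] sobolevOff Ω ΓD r :=
    ⟨Submodule.inclusion (sobolevTest Ω ΓD r).le_topologicalClosure,
      continuous_inclusion (sobolevTest Ω ΓD r).le_topologicalClosure⟩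
  have he : IsUniformInducing e := (AddMonoidHomClass.isometry_of_norm e fun _ => rfl).isUniformInducing
  refine ⟨f.extend e, fun w ψ hψ hw => ?_⟩
  have hwt := mem_sobolevTest hΩ hψ hw
  have h1 : f.extend e w = f ⟨w.1, hwt⟩ :=
    f.extend_eq (denseRange_inclusion_sobolevTest Ω ΓD r) he ⟨w.1, hwt⟩
  rw [h1]
  exact hRuniq _ _ _ (hf _).1 ⟨ψ, hψ, hw, rfl⟩

/-- The embedding of `L^P(Γ_N)` into the dual space. -/
theorem exists_boundaryFunctional (hΩ : IsBoundedLipschitzDomain Ω) (hΓD : IsClosed ΓD)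
    {P q q' : ℝ} [Fact (1 ≤ ENNReal.ofReal q')] [hP1 : Fact (1 ≤ ENNReal.ofReal P)] (hP : 1 < P)
    (hq : q.HolderConjugate q') (hqP : 2 / 3 * q < P) :
    ∃ T : Lp ℝ (ENNReal.ofReal P) (boundaryMeasure Ω ΓD) →L[ℝ]
        NegSobolev Ω ΓD (ENNReal.ofReal q'),
      (∀ g (w : sobolevOff Ω ΓD (ENNReal.ofReal q')) (ψ : E3 → ℝ), IsTestFunctionOff ΓD ψ →
        w.1.fn =ᵐ[volume.restrict Ω] ψ → T g w = ∫ x, g x * ψ x ∂(boundaryMeasure Ω ΓD)) ∧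
      ∀ η : ℝ, 0 < η → ∃ (n : ℕ)
        (ℓ : Fin n → (Lp ℝ (ENNReal.ofReal P) (boundaryMeasure Ω ΓD) →L[ℝ] ℝ)),
        ∀ g, ‖T g‖ ≤ η * ‖g‖ + ∑ i, |ℓ i g| := by
  have hfin := isFiniteMeasure_boundaryMeasure hΩ ΓD
  have hint : ∀ (g : Lp ℝ (ENNReal.ofReal P) (boundaryMeasure Ω ΓD)) ψ, IsTestFunctionOff ΓD ψ →
      Integrable (fun x => g x * ψ x) (boundaryMeasure Ω ΓD) := fun g ψ hψ =>
    integrable_mul_of_continuous hP1.out (Lp.memLp g) hψ.1.continuous hψ.2.1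
  have hbound : ∀ η : ℝ, 0 < η → ∃ (n : ℕ)
      (ℓ : Fin n → (Lp ℝ (ENNReal.ofReal P) (boundaryMeasure Ω ΓD) →L[ℝ] ℝ)),
      ∀ (g : Lp ℝ (ENNReal.ofReal P) (boundaryMeasure Ω ΓD))
        (w : SobolevSpace Ω (ENNReal.ofReal q')) ψ, IsTestFunctionOff ΓD ψ →
        w.fn =ᵐ[volume.restrict Ω] ψ → |∫ x, g x * ψ x ∂(boundaryMeasure Ω ΓD)| ≤
          (η * ‖g‖ + ∑ i, |ℓ i g|) * ‖w‖ := by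
    intro η hη
    obtain ⟨n, M, D, hD, -, h⟩ := exists_abs_integral_mul_le hΩ hΓD hP hq hqP η hη
    choose ℓ hℓ using fun i => exists_setIntegral_clm (μ := boundaryMeasure Ω ΓD)
      (P := ENNReal.ofReal P) (M i)
    refine ⟨n, fun i => D • ℓ i, fun g w ψ hψ hw => (h g w ψ hψ hw).trans (le_of_eq ?_)⟩
    congr 2
    refine Finset.sum_congr rfl fun i _ => ?_
    rw [smul_apply, hℓ i, smul_eq_mul, abs_mul, abs_of_nonneg hD]
  -- The choice η = 1 already yields boundedness of the operator; the estimate for all η is kept for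
  -- compactness.
  obtain ⟨n₁, ℓ₁, h₁⟩ := hbound 1 one_pos
  let B : ℝ := 1 + ∑ i, ‖ℓ₁ i‖
  have hB : ∀ (g : Lp ℝ (ENNReal.ofReal P) (boundaryMeasure Ω ΓD)) (w : SobolevSpace Ω (ENNReal.ofReal q')) ψ, IsTestFunctionOff ΓD ψ →
      w.fn =ᵐ[volume.restrict Ω] ψ →
      |∫ x, g x * ψ x ∂(boundaryMeasure Ω ΓD)| ≤ B * ‖g‖ * ‖w‖ := by
    intro g w ψ hψ hw
    refine (h₁ g w ψ hψ hw).trans ?_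
    gcongr
    rw [add_mul, Finset.sum_mul]
    gcongr with i
    exact (ℓ₁ i).le_opNorm g
  let R : Lp ℝ (ENNReal.ofReal P) (boundaryMeasure Ω ΓD) → NegSobolev Ω ΓD (ENNReal.ofReal q') →
      Prop := fun g ℓ => ∀ (w : sobolevOff Ω ΓD (ENNReal.ofReal q')) (ψ : E3 → ℝ),
        IsTestFunctionOff ΓD ψ → w.1.fn =ᵐ[volume.restrict Ω] ψ →
        ℓ w = ∫ x, g x * ψ x ∂(boundaryMeasure Ω ΓD)
  have hRle : ∀ g ℓ, R g ℓ → ∀ b, 0 ≤ b → (∀ (w : SobolevSpace Ω (ENNReal.ofReal q')) ψ,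
      IsTestFunctionOff ΓD ψ → w.fn =ᵐ[volume.restrict Ω] ψ →
      |∫ x, g x * ψ x ∂(boundaryMeasure Ω ΓD)| ≤ b * ‖w‖) → ‖ℓ‖ ≤ b := by
    intro g ℓ hR b hb h
    refine ℓ.norm_le_of_forall_test hb fun w hw => ?_
    obtain ⟨ψ, h1, h2, -⟩ := hw
    rw [hR w ψ h1 h2]
    exact h w.1 ψ h1 h2
  have hRadd : ∀ x y f g, R x f → R y g → R (x + y) (f + g) := by
    intro x y f g hf hg w ψ hψ hw
    rw [add_apply, hf w ψ hψ hw, hg w ψ hψ hw,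
      ← integral_add (hint x ψ hψ) (hint y ψ hψ)]
    refine integral_congr_ae ((Lp.coeFn_add x y).mono fun z hz => ?_)
    simp only [hz, Pi.add_apply, add_mul]
  have hRsmul : ∀ (c : ℝ) x f, R x f → R (c • x) (c • f) := by
    intro c x f hf w ψ hψ hw
    rw [smul_apply, hf w ψ hψ hw, ← integral_smul]
    refine integral_congr_ae ((Lp.coeFn_smul c x).mono fun z hz => ?_)
    simp only [hz, Pi.smul_apply, smul_eq_mul, mul_assoc]
  have hRuniq : ∀ x f g, R x f → R x g → f = g := by
    intro x f g hf hg
    have h0 : R (x + (-1 : ℝ) • x) (f + (-1 : ℝ) • g) := hRadd _ _ _ _ hf (hRsmul _ _ _ hg)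
    rw [neg_one_smul, neg_one_smul, add_neg_cancel, ← sub_eq_add_neg] at h0
    have := hRle _ _ h0 0 le_rfl fun w ψ hψ hw => by simpa using hB 0 w ψ hψ hw
    exact sub_eq_zero.1 (norm_le_zero_iff.1 this)
  obtain ⟨T, hT⟩ := exists_clm_of_relation R B hRadd hRsmul hRuniq fun g => by
    obtain ⟨ℓ, hℓ⟩ := exists_negSobolev (r := ENNReal.ofReal q') (ΓD := ΓD) hΩ.isOpen
      (fun ψ => ∫ x, g x * ψ x ∂(boundaryMeasure Ω ΓD))
      (fun ψ₁ ψ₂ h1 h2 => by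
        rw [← integral_add (hint g ψ₁ h1) (hint g ψ₂ h2)]
        simp only [Pi.add_apply, mul_add])
      (fun c ψ h => by
        rw [← integral_const_mul]
        simp only [Pi.smul_apply, smul_eq_mul, mul_left_comm])
      (hB g)
    exact ⟨ℓ, hℓ, hRle g ℓ hℓ _ (by positivity) (hB g)⟩
  refine ⟨T, fun g => (hT g).1, fun η hη => ?_⟩
  obtain ⟨n, ℓ, h⟩ := hbound η hη
  exact ⟨n, ℓ, fun g => hRle g (T g) (hT g).1 _ (by positivity) (h g)⟩

end Functional

/-! ### Weak derivatives in time and the continuous representative -/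

section WeakDerivative

variable {X : Type*} [NormedAddCommGroup X] [NormedSpace ℝ X]

theorem _root_.IsCompact.exists_subset_Icc_of_subset_Ioo {K : Set ℝ} (hK : IsCompact K) {a b : ℝ}
    (hab : a < b) (hKab : K ⊆ Ioo a b) : ∃ a' b', a < a' ∧ b' < b ∧ a' ≤ b' ∧ K ⊆ Icc a' b' := by
  obtain ⟨m, hm1, hm2⟩ := exists_between hab
  have hK' : IsCompact (insert m K) := hK.insert m
  have hsub : insert m K ⊆ Ioo a b := insert_subset ⟨hm1, hm2⟩ hKab
  obtain ⟨x, hx, hxle⟩ := hK'.exists_isLeast ⟨m, mem_insert _ _⟩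
  obtain ⟨y, hy, hyle⟩ := hK'.exists_isGreatest ⟨m, mem_insert _ _⟩
  exact ⟨x, y, (hsub hx).1, (hsub hy).2, hyle hx,
    fun z hz => ⟨hxle (mem_insert_of_mem _ hz), hyle (mem_insert_of_mem _ hz)⟩⟩

/-- A smooth function with compact support in an interval and vanishing integral has a primitive
with compact support in this interval. -/
theorem exists_primitive_of_integral_eq_zero {a b : ℝ} (hab : a < b) {h : ℝ → ℝ}
    (hh : ContDiff ℝ ∞ h) (hc : HasCompactSupport h) (hs : tsupport h ⊆ Ioo a b)
    (h0 : ∫ t, h t = 0) : ∃ φ : ℝ → ℝ, ContDiff ℝ ∞ φ ∧ HasCompactSupport φ ∧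
      tsupport φ ⊆ Ioo a b ∧ deriv φ = h := by
  obtain ⟨a', b', ha, hb, hab', hsub⟩ := IsCompact.exists_subset_Icc_of_subset_Ioo hc hab hs
  have hi : Integrable h := hh.continuous.integrable_of_hasCompactSupport hc
  have hz : ∀ t, t ∉ Icc a' b' → h t = 0 := fun t ht =>
    image_eq_zero_of_notMem_tsupport fun h' => ht (hsub h')
  let φ : ℝ → ℝ := fun t => ∫ s in a'..t, h s
  have hd : ∀ t, HasDerivAt φ (h t) t := fun t =>
    intervalIntegral.integral_hasDerivAt_right (hi.intervalIntegrable)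
      (hh.continuous.stronglyMeasurableAtFilter _ _) hh.continuous.continuousAt
  have hderiv : deriv φ = h := funext fun t => (hd t).deriv
  have hsupp : Function.support φ ⊆ Icc a' b' := by
    intro t ht
    by_contra hcon
    refine ht ?_
    rcases lt_or_ge t a' with h1 | h1
    · change ∫ s in a'..t, h s = 0
      rw [intervalIntegral.integral_symm, intervalIntegral.integral_of_le h1.le,
        ← integral_Ioc_eq_integral_Ioo.symm, setIntegral_eq_zero_of_forall_eq_zero, neg_zero]
      intro s hs'
      exact hz s fun h' => absurd h'.1 (not_le.2 hs'.2)
    · have h2 : b' < t := not_le.1 fun h2 => hcon ⟨h1, h2⟩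
      change ∫ s in a'..t, h s = 0
      rw [intervalIntegral.integral_of_le h1, ← integral_Icc_eq_integral_Ioc,
        setIntegral_eq_integral_of_forall_compl_eq_zero, h0]
      intro s hs'
      exact hz s fun h' => hs' ⟨h'.1, h'.2.trans h2.le⟩
  have hts : tsupport φ ⊆ Icc a' b' := closure_minimal hsupp isClosed_Icc
  refine ⟨φ, ?_, ?_, fun t ht => ⟨ha.trans_le (hts ht).1, (hts ht).2.trans_lt hb⟩, hderiv⟩
  · rw [contDiff_infty_iff_deriv, hderiv]
    exact ⟨fun t => (hd t).differentiableAt, hh⟩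
  · exact isCompact_Icc.of_isClosed_subset (isClosed_tsupport _) hts

/-- A function with vanishing weak derivative is constant. -/
theorem exists_ae_eq_const_of_weakDeriv_eq_zero [CompleteSpace X] {a b : ℝ} (hab : a < b)
    {w : ℝ → X} (hw : IntegrableOn w (Ioo a b))
    (h : ∀ φ : ℝ → ℝ, ContDiff ℝ ∞ φ → HasCompactSupport φ → tsupport φ ⊆ Ioo a b →
      ∫ t in Ioo a b, deriv φ t • w t = 0) :
    ∃ c, ∀ᵐ t ∂(volume.restrict (Ioo a b)), w t = c := by
  -- A fixed bump of integral 1. For any test function g, the function g - (∫ g) η has integral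
  -- zero, hence is the derivative of a test function. Therefore w acts on g as the constant ∫ η w.
  obtain ⟨η, hη1, hη2, hη3, hη4⟩ : ∃ η : ℝ → ℝ, ContDiff ℝ ∞ η ∧ HasCompactSupport η ∧
      tsupport η ⊆ Ioo a b ∧ ∫ t, η t = 1 := by
    let η : ContDiffBump ((a + b) / 2) := ⟨(b - a) / 8, (b - a) / 4, by linarith, by linarith⟩
    refine ⟨η.normed volume, η.contDiff_normed, η.hasCompactSupport_normed, ?_, η.integral_normed⟩
    rw [η.tsupport_normed_eq, Real.closedBall_eq_Icc]
    intro t ht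
    change _ ∧ _ at ht
    have h1 : (a + b) / 2 - (b - a) / 4 ≤ t := ht.1
    have h2 : t ≤ (a + b) / 2 + (b - a) / 4 := ht.2
    constructor <;> linarith
  have hsm : ∀ g : ℝ → ℝ, ContDiff ℝ ∞ g → HasCompactSupport g →
      IntegrableOn (fun t => g t • w t) (Ioo a b) := by
    intro g hg hgc
    obtain ⟨M, hM⟩ := hg.continuous.bounded_above_of_compact_support hgc
    exact hw.bdd_smul M hg.continuous.aestronglyMeasurable (Eventually.of_forall hM)
  refine ⟨∫ t in Ioo a b, η t • w t, ?_⟩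
  set c := ∫ t in Ioo a b, η t • w t
  have key := isOpen_Ioo.ae_eq_zero_of_integral_contDiff_smul_eq_zero
    (μ := volume.restrict (Ioo a b)) (U := Ioo a b) (f := fun t => w t - c) ?_ ?_
  · filter_upwards [key, ae_restrict_mem measurableSet_Ioo] with t ht ht'
    exact sub_eq_zero.1 (ht ht')
  · refine LocallyIntegrable.locallyIntegrableOn ?_ _
    exact (Integrable.sub hw (integrable_const c)).locallyIntegrable
  intro g hg hgc hgs
  let I : ℝ := ∫ t, g t
  have hgi : Integrable g := hg.continuous.integrable_of_hasCompactSupport hgc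
  have hηi : Integrable η := hη1.continuous.integrable_of_hasCompactSupport hη2
  obtain ⟨φ, hφ1, hφ2, hφ3, hφ4⟩ := exists_primitive_of_integral_eq_zero hab
    (h := fun t => g t - I * η t) (hg.sub (contDiff_const.mul hη1))
    (hgc.sub hη2.mul_left) (by
      refine (tsupport_sub g fun t => I * η t).trans (union_subset hgs ?_)
      exact (tsupport_mul_subset_right).trans hη3) (by
      rw [integral_sub hgi (hηi.const_mul _), integral_const_mul, hη4]
      simp [I])
  have h1 := h φ hφ1 hφ2 hφ3
  have h2 : ∫ t in Ioo a b, deriv φ t • w t = (∫ t in Ioo a b, g t • w t) - I • c := by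
    rw [hφ4, ← integral_smul, ← integral_sub (g := fun t => I • η t • w t) (hsm g hg hgc)
      ((hsm η hη1 hη2).smul I)]
    refine integral_congr_ae (Eventually.of_forall fun t => ?_)
    simp only [sub_smul, mul_smul]
  have h3 : ∫ t in Ioo a b, g t = I := by
    refine setIntegral_eq_integral_of_forall_compl_eq_zero fun t ht => ?_
    exact image_eq_zero_of_notMem_tsupport fun h' => ht (hgs h')
  simp only [smul_sub]
  rw [integral_sub (hsm g hg hgc) (hgi.integrableOn.smul_const c), integral_smul_const, h3, ← h2, h1]

/-- Fubini on the triangle a < s ≤ t < b: integrating φ' over t from s to b gives -φ(s), because φ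
vanishes at b. -/
theorem integral_deriv_smul_primitive [CompleteSpace X] {a b : ℝ} {v : ℝ → X}
    (hv : Integrable v) {φ : ℝ → ℝ} (hφ : ContDiff ℝ ∞ φ) (hc : HasCompactSupport φ)
    (hs : tsupport φ ⊆ Ioo a b) :
    ∫ t in Ioo a b, deriv φ t • (∫ s in Ioc a t, v s) = -∫ t in Ioo a b, φ t • v t := by
  have hφ' : Integrable (deriv φ) :=
    (hφ.continuous_deriv (by simp)).integrable_of_hasCompactSupport hc.deriv
  have hφ'o : IntegrableOn (deriv φ) (Ioo a b) := hφ'.integrableOn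
  have hvo : IntegrableOn v (Ioo a b) := hv.integrableOn
  let F : ℝ → ℝ → X := fun t s => {p : ℝ × ℝ | p.2 ≤ p.1}.indicator
    (fun p : ℝ × ℝ => deriv φ p.1 • v p.2) (t, s)
  have hF : Integrable (Function.uncurry F)
      ((volume.restrict (Ioo a b)).prod (volume.restrict (Ioo a b))) := by
    have : Function.uncurry F = {p : ℝ × ℝ | p.2 ≤ p.1}.indicator
      (fun p : ℝ × ℝ => deriv φ p.1 • v p.2) := rfl
    rw [this]
    exact (hφ'o.smul_prod hvo).indicator (measurableSet_le measurable_snd measurable_fst)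
  have h1 : ∀ t ∈ Ioo a b, deriv φ t • (∫ s in Ioc a t, v s) = ∫ s in Ioo a b, F t s := by
    intro t ht
    have e : ∀ s, F t s = (Iic t).indicator (fun s => deriv φ t • v s) s := fun s => rfl
    simp only [e]
    rw [setIntegral_indicator measurableSet_Iic, integral_smul]
    congr 3
    ext s
    simp only [mem_Ioc, mem_inter_iff, mem_Ioo, mem_Iic]
    exact ⟨fun h => ⟨⟨h.1, h.2.trans_lt ht.2⟩, h.2⟩, fun h => ⟨h.1.1, h.2⟩⟩
  have h2 : ∀ s ∈ Ioo a b, ∫ t in Ioo a b, F t s = -(φ s • v s) := by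
    intro s hs'
    have e : ∀ t, F t s = (Ici s).indicator (fun t => deriv φ t • v s) t := fun t => rfl
    simp only [e]
    rw [setIntegral_indicator measurableSet_Ici, integral_smul_const]
    have e2 : Ioo a b ∩ Ici s = Ico s b := by
      ext t
      simp only [mem_Ico, mem_inter_iff, mem_Ioo, mem_Ici]
      exact ⟨fun h => ⟨h.2, h.1.2⟩, fun h => ⟨⟨hs'.1.trans_le h.1, h.2⟩, h.1⟩⟩
    have hb : φ b = 0 := image_eq_zero_of_notMem_tsupport fun h' => lt_irrefl _ (hs h').2
    rw [e2, integral_Ico_eq_integral_Ioo, ← integral_Ioc_eq_integral_Ioo,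
      ← intervalIntegral.integral_of_le hs'.2.le,
      intervalIntegral.integral_deriv_eq_sub (fun t _ => hφ.differentiable (by simp) t)
        hφ'.intervalIntegrable, hb, zero_sub, neg_smul]
  rw [setIntegral_congr_fun measurableSet_Ioo h1, integral_integral_swap hF,
    setIntegral_congr_fun measurableSet_Ioo h2, integral_neg]

/-- This is the Cauchy–Schwarz inequality, the source of the Hölder exponent 1/2 with values in L².
-/
theorem enorm_setIntegral_Ioc_le {v : ℝ → X} (hv : AEStronglyMeasurable v volume) {s t : ℝ}
    (hst : s ≤ t) : ‖∫ x in Ioc s t, v x‖ₑ ≤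
      ENNReal.ofReal ((t - s) ^ (1 / 2 : ℝ)) * eLpNorm v 2 volume := by
  calc ‖∫ x in Ioc s t, v x‖ₑ ≤ eLpNorm v 1 (volume.restrict (Ioc s t)) := by
        rw [eLpNorm_one_eq_lintegral_enorm]
        exact enorm_integral_le_lintegral_enorm _
    _ ≤ eLpNorm v 2 (volume.restrict (Ioc s t)) * (volume.restrict (Ioc s t) : Measure ℝ) univ ^
          (1 / (1 : ℝ≥0∞).toReal - 1 / (2 : ℝ≥0∞).toReal) :=
        eLpNorm_le_eLpNorm_mul_rpow_measure_univ (by norm_num) hv.restrict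
    _ ≤ eLpNorm v 2 volume * ENNReal.ofReal ((t - s) ^ (1 / 2 : ℝ)) := by
        gcongr
        · exact Measure.restrict_le_self
        · rw [Measure.restrict_apply_univ, Real.volume_Ioc,
            ENNReal.ofReal_rpow_of_nonneg (sub_nonneg.2 hst) (by norm_num)]
          norm_num
    _ = _ := mul_comm _ _

/-- The absolutely continuous representative of a function in `W^{1,2}(J; X)`. -/
theorem TimeSobolev.exists_representative [CompleteSpace X] {T₀ T₁ : ℝ} (hT : T₀ < T₁)
    (u : TimeSobolev X T₀ T₁) : ∃ U : ℝ → X,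
      (∀ᵐ t ∂(volume.restrict (Ioo T₀ T₁)), u.fn t = U t) ∧
      ∀ s t, ‖U s - U t‖ₑ ≤ ENNReal.ofReal (|s - t| ^ (1 / 2 : ℝ)) * ‖u.dt‖ₑ := by
  -- Extending the derivative by zero defines the representative on the whole line, so the Hölder
  -- estimate holds for all times and in particular at the endpoints.
  let v : ℝ → X := (Ioo T₀ T₁).indicator u.dt
  have hvL2 : MemLp v 2 volume := (memLp_indicator_iff_restrict measurableSet_Ioo).2 (Lp.memLp _)
  have hvL1 : Integrable v :=
    (integrable_indicator_iff measurableSet_Ioo).2 ((Lp.memLp u.dt).integrable (by norm_num))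
  have hvn : eLpNorm v 2 volume = ‖u.dt‖ₑ := by
    rw [Lp.enorm_def, eLpNorm_indicator_eq_eLpNorm_restrict measurableSet_Ioo]
  have hui : IntegrableOn u.fn (Ioo T₀ T₁) := (Lp.memLp u.fn).integrable (by norm_num)
  let V : ℝ → X := fun t => ∫ s in T₀..t, v s
  have hVc : Continuous V := intervalIntegral.continuous_primitive
    (fun a b => hvL1.intervalIntegrable) T₀
  have hVi : IntegrableOn V (Ioo T₀ T₁) := hVc.integrableOn_Icc.mono_set Ioo_subset_Icc_self
  obtain ⟨c, hc⟩ := exists_ae_eq_const_of_weakDeriv_eq_zero hT (w := fun t => u.fn t - V t)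
    (hui.sub hVi) (by
      intro φ hφ hφc hφs
      have h1 := u.2 φ hφ hφc hφs
      change ∫ t in Ioo T₀ T₁, deriv φ t • u.fn t = -∫ t in Ioo T₀ T₁, φ t • u.dt t at h1
      have h2 := integral_deriv_smul_primitive hvL1 hφ hφc hφs
      have h3 : ∫ t in Ioo T₀ T₁, φ t • v t = ∫ t in Ioo T₀ T₁, φ t • u.dt t :=
        setIntegral_congr_fun measurableSet_Ioo fun t ht => by simp only [v, indicator_of_mem ht]
      have h4 : ∫ t in Ioo T₀ T₁, deriv φ t • V t =
          ∫ t in Ioo T₀ T₁, deriv φ t • (∫ s in Ioc T₀ t, v s) :=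
        setIntegral_congr_fun measurableSet_Ioo fun t ht => by
          simp only [V, intervalIntegral.integral_of_le ht.1.le]
      obtain ⟨M, hM⟩ := (hφ.continuous_deriv (by simp)).bounded_above_of_compact_support hφc.deriv
      have hb : ∀ w : ℝ → X, IntegrableOn w (Ioo T₀ T₁) →
          IntegrableOn (fun t => deriv φ t • w t) (Ioo T₀ T₁) := fun w hw =>
        hw.bdd_smul M (hφ.continuous_deriv (by simp)).aestronglyMeasurable
          (Eventually.of_forall hM)
      simp only [smul_sub]
      rw [integral_sub (hb _ hui) (hb _ hVi), h1, h4, h2, h3, sub_self])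
  have hVest : ∀ s t, s ≤ t → ‖V t - V s‖ₑ ≤
      ENNReal.ofReal ((t - s) ^ (1 / 2 : ℝ)) * ‖u.dt‖ₑ := by
    intro s t hst
    have : V t - V s = ∫ x in Ioc s t, v x := by
      rw [← intervalIntegral.integral_of_le hst]
      exact intervalIntegral.integral_interval_sub_left hvL1.intervalIntegrable
        hvL1.intervalIntegrable
    rw [this, ← hvn]
    exact enorm_setIntegral_Ioc_le hvL2.1 hst
  refine ⟨fun t => c + V t, ?_, fun s t => ?_⟩
  · filter_upwards [hc] with t ht
    rw [← ht, sub_add_cancel]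
  · rw [add_sub_add_left_eq_sub]
    rcases le_total s t with h | h
    · rw [← enorm_neg, neg_sub, abs_sub_comm, abs_of_nonneg (sub_nonneg.2 h)]
      exact hVest s t h
    · rw [abs_of_nonneg (sub_nonneg.2 h)]
      exact hVest t s h

/-- A weak derivative of the zero function vanishes. -/
theorem TimeSobolev.eq_zero_of_fn_eq_zero [CompleteSpace X] {T₀ T₁ : ℝ} {u : TimeSobolev X T₀ T₁}
    (hu : u.fn = 0) : u = 0 := by
  have hdt : u.dt = 0 := by
    have key := isOpen_Ioo.ae_eq_zero_of_integral_contDiff_smul_eq_zero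
      (μ := volume.restrict (Ioo T₀ T₁)) (U := Ioo T₀ T₁) (f := u.dt)
      (((Lp.memLp u.dt).integrable (by norm_num)).locallyIntegrable.locallyIntegrableOn _) ?_
    · refine (Lp.eq_zero_iff_ae_eq_zero).2 ?_
      filter_upwards [key, ae_restrict_mem measurableSet_Ioo] with t ht ht'
      exact ht ht'
    · intro g hg hgc hgs
      have h1 := u.2 g hg hgc hgs
      change ∫ t in Ioo T₀ T₁, deriv g t • u.fn t = -∫ t in Ioo T₀ T₁, g t • u.dt t at h1
      rw [hu, integral_smul_Lp_zero] at h1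
      exact neg_eq_zero.1 h1.symm
  refine Subtype.ext ((WithLp.equiv 2 _).injective (Prod.ext ?_ ?_))
  · exact hu
  · exact hdt

theorem TimeSobolev.norm_dt_le {T₀ T₁ : ℝ} (u : TimeSobolev X T₀ T₁) : ‖u.dt‖ ≤ ‖u‖ :=
  WithLp.norm_snd_le _ u.1

end WeakDerivative

/-! ### Passing to limits in Lebesgue norms, and good times -/

/-- A bound on the `L^P` norm is preserved by convergence in `L²`. -/
theorem eLpNorm_le_of_tendsto {α : Type*} {m : MeasurableSpace α} {μ : Measure α}
    {f : ℕ → Lp ℝ 2 μ} {g : Lp ℝ 2 μ} (hfg : Tendsto f atTop (𝓝 g)) {P B : ℝ≥0∞}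
    (hB : ∀ n, eLpNorm (f n) P μ ≤ B) : eLpNorm g P μ ≤ B := by
  -- A subsequence converges almost everywhere, and Fatou's lemma applies to it; no convergence in
  -- L^P is needed.
  obtain ⟨ns, -, hns⟩ := (tendstoInMeasure_of_tendsto_Lp hfg).exists_seq_tendsto_ae
  refine (Lp.eLpNorm_lim_le_liminf_eLpNorm (fun n => (Lp.aestronglyMeasurable (f (ns n)))) _
    hns).trans ?_
  exact liminf_le_of_le (by isBoundedDefault)
    fun b hb => (hb.exists.elim fun n hn => hn.trans (hB _))

/-- Somewhere in (a, b), outside any null set, ‖y‖^p does not exceed its average over the interval.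
-/
theorem exists_good_time {X : Type*} [NormedAddCommGroup X] {T₀ T₁ p : ℝ} (hp : 0 < p)
    (y : Lp X (ENNReal.ofReal p) (volume.restrict (Ioo T₀ T₁))) {Q : ℝ → Prop}
    (hQ : ∀ᵐ t ∂(volume.restrict (Ioo T₀ T₁)), Q t) {a b : ℝ} (hab : a < b)
    (hsub : Ioo a b ⊆ Ioo T₀ T₁) :
    ∃ τ ∈ Ioo a b, Q τ ∧ ‖y τ‖ₑ ≤ ENNReal.ofReal ((b - a) ^ (-(1 / p))) * ‖y‖ₑ := by
  have hle : volume.restrict (Ioo a b) ≤ volume.restrict (Ioo T₀ T₁) :=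
    Measure.restrict_mono hsub le_rfl
  have hae : ∀ᵐ t ∂(volume.restrict (Ioo a b)), t ∈ Ioo a b ∧ Q t :=
    (ae_restrict_mem measurableSet_Ioo).and (ae_mono hle hQ)
  have hne : volume.restrict (Ioo a b) ≠ 0 := by
    rw [Ne, Measure.restrict_eq_zero, Real.volume_Ioo, ENNReal.ofReal_eq_zero, not_le]
    linarith
  obtain ⟨τ, hτ, hτle⟩ := exists_notMem_null_le_laverage hne (f := fun t => ‖y t‖ₑ ^ p)
    (((Lp.aestronglyMeasurable y).mono_measure hle).enorm.pow_const p) (ae_iff.1 hae)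
  simp only [mem_ofPred_eq, not_not] at hτ
  refine ⟨τ, hτ.1, hτ.2, ?_⟩
  have hy : ‖y‖ₑ ^ p = ∫⁻ t in Ioo T₀ T₁, ‖y t‖ₑ ^ p := by
    rw [Lp.enorm_def, eLpNorm_eq_lintegral_rpow_enorm_toReal (by simpa using hp) (by simp),
      ENNReal.toReal_ofReal hp.le, ← ENNReal.rpow_mul, one_div_mul_cancel hp.ne', ENNReal.rpow_one]
  have h1 : ‖y τ‖ₑ ^ p ≤ ENNReal.ofReal ((b - a)⁻¹) * ‖y‖ₑ ^ p := by
    refine hτle.trans ?_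
    rw [laverage_eq, Measure.restrict_apply_univ, Real.volume_Ioo, ENNReal.div_eq_inv_mul,
      ENNReal.ofReal_inv_of_pos (sub_pos.2 hab), hy]
    gcongr
  calc ‖y τ‖ₑ = (‖y τ‖ₑ ^ p) ^ (1 / p) := by
        rw [← ENNReal.rpow_mul, mul_one_div_cancel hp.ne', ENNReal.rpow_one]
    _ ≤ (ENNReal.ofReal ((b - a)⁻¹) * ‖y‖ₑ ^ p) ^ (1 / p) := by gcongr
    _ = _ := by
        rw [ENNReal.mul_rpow_of_nonneg _ _ (by positivity), ← ENNReal.rpow_mul,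
          mul_one_div_cancel hp.ne', ENNReal.rpow_one, ENNReal.ofReal_rpow_of_nonneg
          (inv_nonneg.2 (sub_pos.2 hab).le) (by positivity), Real.inv_rpow (sub_pos.2 hab).le,
          ← Real.rpow_neg (sub_pos.2 hab).le]

/-! ### Interpolation between regularity in time and integrability -/

section Interpolation

variable {α : Type*} {m : MeasurableSpace α} {μ : Measure α}

theorem eLpNorm_sub_le_sub_add_sub {P : ℝ≥0∞} (hP : 1 ≤ P) (f g h : Lp ℝ 2 μ) :
    eLpNorm (f - h : Lp ℝ 2 μ) P μ ≤
      eLpNorm (f - g : Lp ℝ 2 μ) P μ + eLpNorm (g - h : Lp ℝ 2 μ) P μ := by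
  have : (f - h : Lp ℝ 2 μ) = (f - g) + (g - h) := (sub_add_sub_cancel f g h).symm
  rw [this, eLpNorm_congr_ae (Lp.coeFn_add _ _)]
  exact eLpNorm_add_le (Lp.aestronglyMeasurable _) (Lp.aestronglyMeasurable _) hP

/-- A bound h^(1/2) in L² and a bound h^(-1/p) in L^p interpolate to h^ρ in L^P. The factors 2 in
the hypotheses leave room for comparing good times from two consecutive dyadic scales. -/
theorem eLpNorm_sub_le_of_bounds {p P θ ρ : ℝ} (hp : 1 ≤ p) (hP : 0 < P) (hθ0 : 0 ≤ θ)
    (hθ1 : θ ≤ 1) (hPθ : 1 / P = θ / 2 + (1 - θ) / p) (hρ : ρ = θ / 2 - (1 - θ) / p)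
    {f g : Lp ℝ 2 μ} {f' g' : Lp ℝ (ENNReal.ofReal p) μ} (hf : f =ᵐ[μ] f') (hg : g =ᵐ[μ] g')
    {h : ℝ} (hh : 0 < h) {M : ℝ≥0∞}
    (hfg : ‖f - g‖ₑ ≤ ENNReal.ofReal (h ^ (1 / 2 : ℝ)) * M)
    (hf' : ‖f'‖ₑ ≤ 2 * (ENNReal.ofReal (h ^ (-(1 / p))) * M))
    (hg' : ‖g'‖ₑ ≤ 2 * (ENNReal.ofReal (h ^ (-(1 / p))) * M)) :
    eLpNorm (f - g : Lp ℝ 2 μ) (ENNReal.ofReal P) μ ≤ 4 * (ENNReal.ofReal (h ^ ρ) * M) := by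
  have h2 : eLpNorm (f - g : Lp ℝ 2 μ) (ENNReal.ofReal 2) μ ≤
      ENNReal.ofReal (h ^ (1 / 2 : ℝ)) * M := by
    rw [ENNReal.ofReal_ofNat, ← Lp.enorm_def]
    exact hfg
  have hp' : eLpNorm (f - g : Lp ℝ 2 μ) (ENNReal.ofReal p) μ ≤
      4 * (ENNReal.ofReal (h ^ (-(1 / p))) * M) := by
    have e : (f - g : Lp ℝ 2 μ) =ᵐ[μ] (f' : α → ℝ) - g' :=
      (Lp.coeFn_sub f g).trans (hf.sub hg)
    rw [eLpNorm_congr_ae e]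
    refine (eLpNorm_sub_le (Lp.aestronglyMeasurable _) (Lp.aestronglyMeasurable _)
      (by simpa using hp)).trans ?_
    rw [← Lp.enorm_def, ← Lp.enorm_def]
    refine (add_le_add hf' hg').trans (le_of_eq ?_)
    rw [← add_mul]
    norm_num
  refine (eLpNorm_le_rpow_mul_rpow (a := 2) (b := p) (r := P) two_pos (by linarith) hP hθ0 hθ1 hPθ
    (Lp.aestronglyMeasurable _)).trans ?_
  have hθ1' : 0 ≤ 1 - θ := by linarith
  calc _ ≤ (ENNReal.ofReal (h ^ (1 / 2 : ℝ)) * M) ^ θ *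
        (4 * (ENNReal.ofReal (h ^ (-(1 / p))) * M)) ^ (1 - θ) := by gcongr
    _ = 4 ^ (1 - θ) * (ENNReal.ofReal (h ^ ρ) * M) := by
        have e1 : M ^ θ * M ^ (1 - θ) = M := by
          rw [← ENNReal.rpow_add_of_nonneg _ _ hθ0 hθ1', add_sub_cancel, ENNReal.rpow_one]
        have e2 : ENNReal.ofReal (h ^ (1 / 2 : ℝ)) ^ θ *
            ENNReal.ofReal (h ^ (-(1 / p))) ^ (1 - θ) = ENNReal.ofReal (h ^ ρ) := by
          rw [ENNReal.ofReal_rpow_of_nonneg (by positivity) hθ0,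
            ENNReal.ofReal_rpow_of_nonneg (by positivity) hθ1', ← ENNReal.ofReal_mul (by positivity),
            ← Real.rpow_mul hh.le, ← Real.rpow_mul hh.le, ← Real.rpow_add hh, hρ]
          congr 2
          ring
        rw [ENNReal.mul_rpow_of_nonneg _ _ hθ0, ENNReal.mul_rpow_of_nonneg _ _ hθ1',
          ENNReal.mul_rpow_of_nonneg _ _ hθ1']
        calc _ = 4 ^ (1 - θ) * ((ENNReal.ofReal (h ^ (1 / 2 : ℝ)) ^ θ *
            ENNReal.ofReal (h ^ (-(1 / p))) ^ (1 - θ)) * (M ^ θ * M ^ (1 - θ))) := by ring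
          _ = _ := by rw [e1, e2]
    _ ≤ 4 * (ENNReal.ofReal (h ^ ρ) * M) := by
        gcongr
        calc (4 : ℝ≥0∞) ^ (1 - θ) ≤ 4 ^ (1 : ℝ) :=
              ENNReal.rpow_le_rpow_of_exponent_le (by norm_num) (by linarith)
          _ = 4 := ENNReal.rpow_one _

variable {p P θ ρ T₀ T₁ : ℝ} [Fact (1 ≤ ENNReal.ofReal p)]

/-- Times which converge geometrically to `t` at which `y` is controlled. -/
theorem exists_seq_good_time {X : Type*} [NormedAddCommGroup X] {T₀ T₁ p : ℝ} (hp : 0 < p)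
    {y : Lp X (ENNReal.ofReal p) (volume.restrict (Ioo T₀ T₁))} {M : ℝ≥0∞} (hy : ‖y‖ₑ ≤ M)
    {Q : ℝ → Prop} (hQ : ∀ᵐ t ∂(volume.restrict (Ioo T₀ T₁)), Q t)
    {a b t τ : ℝ} (hab : a < b) (hsub : Ioo a b ⊆ Ioo T₀ T₁) (ht : t ∈ Icc a b) (hτ : τ ∈ Ioo a b)
    (hτQ : Q τ) (hτM : ‖y τ‖ₑ ≤ ENNReal.ofReal ((b - a) ^ (-(1 / p))) * M) :
    ∃ τs : ℕ → ℝ, τs 0 = τ ∧ ∀ k, Q (τs k) ∧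
      ‖y (τs k)‖ₑ ≤ ENNReal.ofReal (((1 / 2 : ℝ) ^ k * (b - a)) ^ (-(1 / p))) * M ∧
      |τs (k + 1) - τs k| ≤ (1 / 2 : ℝ) ^ k * (b - a) ∧ |τs k - t| ≤ (1 / 2 : ℝ) ^ k * (b - a) := by
  have hba : 0 < b - a := sub_pos.2 hab
  let c : ℕ → ℝ := fun k => (1 / 2 : ℝ) ^ k
  have hc0 : ∀ k, 0 < c k := fun k => by positivity
  have hc1 : ∀ k, c k ≤ 1 := fun k => pow_le_one₀ (by norm_num) (by norm_num)
  have hcs : ∀ k, c (k + 1) = c k / 2 := fun k => by simp only [c, pow_succ]; ring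
  -- The interval (a, b) is shrunk towards t by the ratio 2^(-k). A homothety about t, instead of a
  -- symmetric neighbourhood, stays inside (a, b) even when t is an endpoint, and has length exactly
  -- 2^(-k)(b - a).
  let A : ℕ → ℝ := fun k => t - c k * (t - a)
  let B : ℕ → ℝ := fun k => t + c k * (b - t)
  have hAB : ∀ k, B k - A k = c k * (b - a) := fun k => by simp only [A, B]; ring
  have hlt : ∀ k, A k < B k := fun k => sub_pos.1 (by rw [hAB]; exact mul_pos (hc0 k) hba)
  have hnest : ∀ k, Ioo (A k) (B k) ⊆ Ioo a b := fun k => by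
    refine Ioo_subset_Ioo ?_ ?_
    · have := mul_le_mul_of_nonneg_right (hc1 k) (sub_nonneg.2 ht.1)
      simp only [A]; linarith
    · have := mul_le_mul_of_nonneg_right (hc1 k) (sub_nonneg.2 ht.2)
      simp only [B]; linarith
  have hstep : ∀ k, Ioo (A (k + 1)) (B (k + 1)) ⊆ Ioo (A k) (B k) := fun k => by
    have h1 := mul_nonneg (hc0 k).le (sub_nonneg.2 ht.1)
    have h2 := mul_nonneg (hc0 k).le (sub_nonneg.2 ht.2)
    refine Ioo_subset_Ioo ?_ ?_
    · simp only [A, hcs]; linarith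
    · simp only [B, hcs]; linarith
  have hpick : ∀ k, ∃ σ ∈ Ioo (A k) (B k), Q σ ∧
      ‖y σ‖ₑ ≤ ENNReal.ofReal ((c k * (b - a)) ^ (-(1 / p))) * M := by
    intro k
    obtain ⟨σ, h1, h2, h3⟩ := exists_good_time hp y hQ (hlt k) ((hnest k).trans hsub)
    refine ⟨σ, h1, h2, h3.trans ?_⟩
    rw [hAB]
    gcongr
  choose σ hσ1 hσ2 hσ3 using hpick
  have hA0 : A 0 = a := by simp [A, c]
  have hB0 : B 0 = b := by simp [B, c]
  have hτ1 : ∀ k, (Nat.casesOn k τ fun j => σ (j + 1) : ℝ) ∈ Ioo (A k) (B k) := by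
    rintro (_ | k)
    · rw [hA0, hB0]; exact hτ
    · exact hσ1 _
  refine ⟨fun k => Nat.casesOn k τ fun j => σ (j + 1), rfl, fun k => ⟨?_, ?_, ?_, ?_⟩⟩
  · rcases k with _ | k
    · exact hτQ
    · exact hσ2 _
  · rcases k with _ | k
    · rw [pow_zero, one_mul]
      exact hτM
    · exact hσ3 _
  · have h1 := hstep k (hτ1 (k + 1))
    have h2 := hτ1 k
    have h3 := hAB k
    rw [abs_le]
    constructor <;> linarith [h1.1, h1.2, h2.1, h2.2]
  · have h2 := hτ1 k
    have h4 := mul_nonneg (hc0 k).le (sub_nonneg.2 ht.1)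
    have h5 := mul_nonneg (hc0 k).le (sub_nonneg.2 ht.2)
    have h6 : c k * (b - a) = c k * (t - a) + c k * (b - t) := by ring
    change _ ≤ c k * (b - a)
    simp only [A, B] at h2
    rw [abs_le]
    constructor <;> linarith [h2.1, h2.2]

/-- Telescoping along times which converge geometrically to `t`. -/
theorem eLpNorm_sub_le_of_mem_Icc (hp : 1 ≤ p) (hP : 1 ≤ P) (hθ0 : 0 ≤ θ)
    (hθ1 : θ ≤ 1) (hPθ : 1 / P = θ / 2 + (1 - θ) / p) (hρ : ρ = θ / 2 - (1 - θ) / p) (hρ0 : 0 < ρ)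
    {U : ℝ → Lp ℝ 2 μ} {M : ℝ≥0∞} (hM : M ≠ ⊤)
    (hU : ∀ s t, ‖U s - U t‖ₑ ≤ ENNReal.ofReal (|s - t| ^ (1 / 2 : ℝ)) * M)
    {y : Lp (Lp ℝ (ENNReal.ofReal p) μ) (ENNReal.ofReal p) (volume.restrict (Ioo T₀ T₁))}
    (hy : ‖y‖ₑ ≤ M) (hUy : ∀ᵐ t ∂(volume.restrict (Ioo T₀ T₁)), (U t : α → ℝ) =ᵐ[μ] y t)
    {a b t τ : ℝ} (hab : a < b) (hsub : Ioo a b ⊆ Ioo T₀ T₁) (ht : t ∈ Icc a b) (hτ : τ ∈ Ioo a b)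
    (hτy : (U τ : α → ℝ) =ᵐ[μ] y τ)
    (hτM : ‖y τ‖ₑ ≤ ENNReal.ofReal ((b - a) ^ (-(1 / p))) * M) :
    eLpNorm (U t - U τ : Lp ℝ 2 μ) (ENNReal.ofReal P) μ ≤
      ENNReal.ofReal (4 * (1 - (1 / 2 : ℝ) ^ ρ)⁻¹ * (b - a) ^ ρ) * M := by
  have hP' : 1 ≤ ENNReal.ofReal P := by simpa using hP
  have hba : 0 < b - a := sub_pos.2 hab
  obtain ⟨τs, hτs0, hτs⟩ := exists_seq_good_time (by linarith) hy hUy hab hsub ht hτ hτy hτM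
  obtain ⟨c, hc⟩ : ∃ c : ℕ → ℝ, c = fun k => (1 / 2 : ℝ) ^ k := ⟨_, rfl⟩
  have hc' : ∀ k, (1 / 2 : ℝ) ^ k = c k := fun k => by rw [hc]
  simp only [hc'] at hτs
  have hc0 : ∀ k, 0 < c k := fun k => by rw [hc]; positivity
  have hcs : ∀ k, c (k + 1) = c k / 2 := fun k => by rw [hc]; simp only [pow_succ]; ring
  have hstepU : ∀ k, eLpNorm (U (τs (k + 1)) - U (τs k) : Lp ℝ 2 μ) (ENNReal.ofReal P) μ ≤
      4 * (ENNReal.ofReal ((c k * (b - a)) ^ ρ) * M) := by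
    intro k
    have hck : 0 < c k * (b - a) := mul_pos (hc0 k) hba
    refine eLpNorm_sub_le_of_bounds hp (by linarith) hθ0 hθ1 hPθ hρ (hτs _).1 (hτs _).1 hck ?_ ?_ ?_
    · refine (hU _ _).trans ?_
      gcongr
      exact (hτs k).2.2.1
    · refine (hτs (k + 1)).2.1.trans ?_
      rw [← mul_assoc]
      -- The time with index k + 1 comes from an interval of half the length, so its bound is larger
      -- by the factor 2^(1/p), which is at most 2.
      gcongr
      rw [show (2 : ℝ≥0∞) = ENNReal.ofReal 2 by simp, ← ENNReal.ofReal_mul (by norm_num)]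
      refine ENNReal.ofReal_le_ofReal ?_
      rw [hcs, show c k / 2 * (b - a) = 2⁻¹ * (c k * (b - a)) by ring,
        Real.mul_rpow (by norm_num) hck.le]
      gcongr
      rw [Real.inv_rpow (by norm_num), Real.rpow_neg (by norm_num), inv_inv]
      calc (2 : ℝ) ^ (1 / p) ≤ 2 ^ (1 : ℝ) := by
            refine Real.rpow_le_rpow_of_exponent_le (by norm_num) ?_
            rw [div_le_one (by linarith)]
            exact hp
        _ = 2 := Real.rpow_one _
    · refine (hτs k).2.1.trans ?_
      exact le_mul_of_one_le_left zero_le (by norm_num)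
  let x : ℝ := (1 / 2 : ℝ) ^ ρ
  have hx0 : 0 ≤ x := by positivity
  have hx1 : x < 1 := Real.rpow_lt_one (by norm_num) (by norm_num) hρ0
  have htel : ∀ n, eLpNorm (U (τs n) - U τ : Lp ℝ 2 μ) (ENNReal.ofReal P) μ ≤
      ∑ k ∈ Finset.range n, 4 * (ENNReal.ofReal ((c k * (b - a)) ^ ρ) * M) := by
    intro n
    induction n with
    | zero =>
      rw [hτs0, sub_self, eLpNorm_congr_ae (Lp.coeFn_zero ℝ 2 μ)]
      simp
    | succ n ih =>
      rw [Finset.sum_range_succ]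
      exact (eLpNorm_sub_le_sub_add_sub hP' _ (U (τs n)) _).trans
        ((add_le_add (hstepU n) ih).trans_eq (add_comm _ _))
  have hbound : ∀ n, eLpNorm (U (τs n) - U τ : Lp ℝ 2 μ) (ENNReal.ofReal P) μ ≤
      ENNReal.ofReal (4 * (1 - x)⁻¹ * (b - a) ^ ρ) * M := by
    intro n
    refine (htel n).trans ?_
    have e : ∀ k, 4 * (ENNReal.ofReal ((c k * (b - a)) ^ ρ) * M) =
        ENNReal.ofReal (4 * (b - a) ^ ρ * x ^ k) * M := by
      intro k
      rw [← mul_assoc, show (4 : ℝ≥0∞) = ENNReal.ofReal 4 by simp,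
        ← ENNReal.ofReal_mul (by norm_num), Real.mul_rpow (hc0 k).le hba.le]
      have : c k ^ ρ = x ^ k := by
        simp only [hc, x]
        rw [← Real.rpow_natCast, ← Real.rpow_natCast, ← Real.rpow_mul (by norm_num),
          ← Real.rpow_mul (by norm_num), mul_comm]
      rw [this]
      congr 2
      ring
    simp only [e]
    rw [← Finset.sum_mul, ← ENNReal.ofReal_sum_of_nonneg (fun k _ => by positivity)]
    gcongr
    rw [← Finset.mul_sum]
    have hgeom : ∑ k ∈ Finset.range n, x ^ k ≤ (1 - x)⁻¹ := by
      rw [← tsum_geometric_of_lt_one hx0 hx1]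
      exact (summable_geometric_of_lt_one hx0 hx1).sum_le_tsum _ fun k _ => by positivity
    calc _ ≤ 4 * (b - a) ^ ρ * (1 - x)⁻¹ := by gcongr
      _ = _ := by ring
  -- The telescoped bound is uniform in n, and `U (τs n)` tends to `U t` in L² by the Hölder
  -- estimate `hU`.
  refine eLpNorm_le_of_tendsto (f := fun n => U (τs n) - U τ) ?_ hbound
  refine Tendsto.sub_const ?_ _
  have hcl : Tendsto c atTop (𝓝 0) := by
    rw [hc]
    exact tendsto_pow_atTop_nhds_zero_of_lt_one (by norm_num) (by norm_num)
  rw [tendsto_iff_edist_tendsto_0]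
  have hub : Tendsto (fun n => ENNReal.ofReal ((c n * (b - a)) ^ (1 / 2 : ℝ)) * M) atTop (𝓝 0) := by
    have h1 : Tendsto (fun n => (c n * (b - a)) ^ (1 / 2 : ℝ)) atTop (𝓝 0) := by
      have := (hcl.mul_const (b - a)).rpow_const (p := (1 / 2 : ℝ)) (Or.inr (by norm_num))
      simpa using this
    have h2 := ENNReal.Tendsto.mul_const (b := M) (ENNReal.tendsto_ofReal h1) (Or.inr hM)
    simpa using h2
  refine tendsto_of_tendsto_of_tendsto_of_le_of_le tendsto_const_nhds hub (fun _ => zero_le)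
    fun n => ?_
  change edist (U (τs n)) (U t) ≤ _
  rw [edist_eq_enorm_sub]
  refine (hU _ _).trans ?_
  gcongr
  exact (hτs n).2.2.2

/-- Interpolation between Hölder regularity with values in `L²` and integrability with values in
`L^p`. -/
theorem exists_holder_bound [IsFiniteMeasure μ] (hT : T₀ < T₁) (hp : 2 < p) (hP : 2 < P)
    (hPp : P < (p + 2) / 2) :
    ∃ (ρ : ℝ≥0) (C : ℝ≥0), 0 < ρ ∧ ρ < 1 ∧ ∀ (U : ℝ → Lp ℝ 2 μ) (M : ℝ≥0)
      (y : Lp (Lp ℝ (ENNReal.ofReal p) μ) (ENNReal.ofReal p) (volume.restrict (Ioo T₀ T₁))),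
      (∀ s t, ‖U s - U t‖ₑ ≤ ENNReal.ofReal (|s - t| ^ (1 / 2 : ℝ)) * M) → ‖y‖ₑ ≤ M →
      (∀ᵐ t ∂(volume.restrict (Ioo T₀ T₁)), (U t : α → ℝ) =ᵐ[μ] y t) →
      (∀ t ∈ Icc T₀ T₁, eLpNorm (U t) (ENNReal.ofReal P) μ ≤ C * M) ∧
      ∀ s ∈ Icc T₀ T₁, ∀ t ∈ Icc T₀ T₁, eLpNorm (U s - U t : Lp ℝ 2 μ) (ENNReal.ofReal P) μ ≤
        C * ENNReal.ofReal (|s - t| ^ (ρ : ℝ)) * M := by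
  have hp0 : 0 < p := by linarith
  have hP0 : 0 < P := by linarith
  have hpP : P < p := by linarith
  have hd : 0 < 1 / 2 - 1 / p := by
    rw [sub_pos]; exact one_div_lt_one_div_of_lt two_pos hp
  obtain ⟨θ, hθ⟩ : ∃ θ, θ = (1 / P - 1 / p) / (1 / 2 - 1 / p) := ⟨_, rfl⟩
  have hθd : θ * (1 / 2 - 1 / p) = 1 / P - 1 / p := by rw [hθ, div_mul_cancel₀ _ hd.ne']
  have hPθ : 1 / P = θ / 2 + (1 - θ) / p := by
    have : θ / 2 + (1 - θ) / p = θ * (1 / 2 - 1 / p) + 1 / p := by ring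
    rw [this, hθd]; ring
  have hθ0 : 0 < θ := by
    rw [hθ]; exact div_pos (sub_pos.2 (one_div_lt_one_div_of_lt hP0 hpP)) hd
  have hθ1 : θ < 1 := by
    rw [hθ, div_lt_one hd]
    have := one_div_lt_one_div_of_lt two_pos hP
    linarith
  obtain ⟨ρ, hρ⟩ : ∃ ρ, ρ = θ / 2 - (1 - θ) / p := ⟨_, rfl⟩
  -- Since ρ = θ(1/2 + 1/p) - 1/p, positivity means θ > 2/(p+2). At θ = 2/(p+2) the interpolated
  -- exponent is exactly (p+2)/2, so the bound on P gives the strict inequality.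
  have hρ0 : 0 < ρ := by
    have h1 : ρ = 1 / P - 2 * ((1 - θ) / p) := by rw [hPθ, hρ]; ring
    have h2 : 2 / (p + 2) < 1 / P := by
      rw [div_lt_div_iff₀ (by linarith) hP0]; linarith
    have h3 : ρ = θ * (1 / 2 + 1 / p) - 1 / p := by rw [hρ]; ring
    have h4 : 2 / (p + 2) < θ := by
      have e : 2 / (p + 2) * (1 / 2 - 1 / p) = 2 / (p + 2) - 1 / p := by field_simp; ring
      refine lt_of_mul_lt_mul_right (a := 1 / 2 - 1 / p) ?_ hd.le
      rw [hθd, e]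
      linarith
    have h5 : 2 / (p + 2) * (1 / 2 + 1 / p) = 1 / p := by field_simp
    have h6 : 0 < 1 / 2 + 1 / p := by positivity
    have h7 := mul_lt_mul_of_pos_right h4 h6
    rw [h3]; linarith
  have hρ1 : ρ < 1 := by
    have : 0 ≤ (1 - θ) / p := div_nonneg (by linarith) hp0.le
    rw [hρ]; linarith
  let K : ℝ := 4 * (1 - (1 / 2 : ℝ) ^ ρ)⁻¹
  have hK0 : 0 ≤ K := by
    have : (1 / 2 : ℝ) ^ ρ < 1 := Real.rpow_lt_one (by norm_num) (by norm_num) hρ0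
    have : 0 ≤ (1 - (1 / 2 : ℝ) ^ ρ)⁻¹ := inv_nonneg.2 (by linarith)
    positivity
  have hμ : μ univ ^ (1 / P - 1 / p) ≠ ⊤ := ENNReal.rpow_ne_top_of_nonneg
    (sub_nonneg.2 (one_div_lt_one_div_of_lt hP0 hpP).le) (measure_ne_top μ _)
  let D : ℝ≥0∞ := ENNReal.ofReal (K * (T₁ - T₀) ^ ρ) +
    ENNReal.ofReal ((T₁ - T₀) ^ (-(1 / p))) * μ univ ^ (1 / P - 1 / p)
  have hD : D ≠ ⊤ := ENNReal.add_ne_top.2 ⟨ENNReal.ofReal_ne_top,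
    ENNReal.mul_ne_top ENNReal.ofReal_ne_top hμ⟩
  refine ⟨⟨ρ, hρ0.le⟩, D.toNNReal + Real.toNNReal (2 * K), hρ0, hρ1, fun U M y hU hy hUy => ?_⟩
  have hP' : 1 ≤ ENNReal.ofReal P := by
    rw [← ENNReal.ofReal_one]; exact ENNReal.ofReal_le_ofReal (by linarith)
  have hCD : D ≤ ((D.toNNReal + Real.toNNReal (2 * K) : ℝ≥0) : ℝ≥0∞) := by
    rw [ENNReal.coe_add, ENNReal.coe_toNNReal hD]
    exact le_self_add
  have hCK : ENNReal.ofReal (2 * K) ≤ ((D.toNNReal + Real.toNNReal (2 * K) : ℝ≥0) : ℝ≥0∞) := by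
    rw [ENNReal.coe_add]
    exact le_add_self
  have key := fun {a b t τ : ℝ} => eLpNorm_sub_le_of_mem_Icc (a := a) (b := b) (t := t) (τ := τ)
    (by linarith) (by linarith) hθ0.le hθ1.le hPθ hρ hρ0 ENNReal.coe_ne_top hU hy hUy
  constructor
  · intro t ht
    -- For the uniform bound a single good time of the whole interval suffices: there the L^p norm
    -- controls the L^P norm because the measure is finite, and the telescoping estimate bounds the
    -- difference.
    obtain ⟨τ, hτ1, hτ2, hτ3⟩ := exists_good_time hp0 y hUy hT subset_rfl
    have hτ3' : ‖y τ‖ₑ ≤ ENNReal.ofReal ((T₁ - T₀) ^ (-(1 / p))) * M := hτ3.trans (by gcongr)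
    have h1 := key hT subset_rfl ht hτ1 hτ2 hτ3'
    have h2 : eLpNorm (U τ) (ENNReal.ofReal P) μ ≤
        ENNReal.ofReal ((T₁ - T₀) ^ (-(1 / p))) * μ univ ^ (1 / P - 1 / p) * M := by
      rw [eLpNorm_congr_ae hτ2]
      refine (eLpNorm_le_eLpNorm_mul_rpow_measure_univ (ENNReal.ofReal_le_ofReal hpP.le)
        (Lp.aestronglyMeasurable _)).trans ?_
      rw [ENNReal.toReal_ofReal hP0.le, ENNReal.toReal_ofReal hp0.le, ← Lp.enorm_def,
        mul_right_comm]
      gcongr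
    have h3 := eLpNorm_sub_le_sub_add_sub hP' (U t) (U τ) 0
    rw [sub_zero, sub_zero] at h3
    refine h3.trans ((add_le_add h1 h2).trans ?_)
    rw [← add_mul]
    gcongr
  · intro s hs t ht
    rcases eq_or_ne s t with rfl | hst
    · rw [sub_self, eLpNorm_congr_ae (Lp.coeFn_zero ℝ 2 μ)]
      simp
    have hlt : min s t < max s t := min_lt_max.2 hst
    have habs : max s t - min s t = |s - t| := max_sub_min_eq_abs' s t
    have hsub : Ioo (min s t) (max s t) ⊆ Ioo T₀ T₁ :=
      Ioo_subset_Ioo (le_min hs.1 ht.1) (max_le hs.2 ht.2)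
    -- Both times are endpoints of one interval and are compared with the same good time inside it,
    -- which gives the constant 2K.
    obtain ⟨τ, hτ1, hτ2, hτ3⟩ := exists_good_time hp0 y hUy hlt hsub
    have hτ3' : ‖y τ‖ₑ ≤ ENNReal.ofReal ((max s t - min s t) ^ (-(1 / p))) * M :=
      hτ3.trans (by gcongr)
    have h1 := key hlt hsub ⟨min_le_left _ _, le_max_left _ _⟩ hτ1 hτ2 hτ3' (t := s)
    have h2 := key hlt hsub ⟨min_le_right _ _, le_max_right _ _⟩ hτ1 hτ2 hτ3' (t := t)
    rw [habs] at h1 h2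
    have h2' : eLpNorm (U τ - U t : Lp ℝ 2 μ) (ENNReal.ofReal P) μ ≤
        ENNReal.ofReal (K * |s - t| ^ ρ) * M := by
      rw [← neg_sub, eLpNorm_congr_ae (Lp.coeFn_neg _), eLpNorm_neg]
      exact h2
    refine (eLpNorm_sub_le_sub_add_sub hP' (U s) (U τ) (U t)).trans ((add_le_add h1 h2').trans ?_)
    rw [← add_mul, ← ENNReal.ofReal_add (by positivity) (by positivity)]
    gcongr
    calc ENNReal.ofReal (K * |s - t| ^ ρ + K * |s - t| ^ ρ)
        = ENNReal.ofReal (2 * K) * ENNReal.ofReal (|s - t| ^ ρ) := by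
          rw [← ENNReal.ofReal_mul (by positivity)]
          congr 1
          ring
      _ ≤ _ := mul_le_mul_left hCK _

end Interpolation

/-! ### Hölder functions of time composed with a compact operator -/

section Holder

variable {ρ : ℝ≥0} {K : Type*} [MetricSpace K] [CompactSpace K]
variable {Y Z : Type*} [NormedAddCommGroup Y] [NormedSpace ℝ Y] [NormedAddCommGroup Z]
  [NormedSpace ℝ Z]

namespace HolderSpace

theorem exists_of_bounds (hρ : 0 < ρ) {f : K → Y} {A B : ℝ≥0} (hA : ∀ x, ‖f x‖ ≤ A)
    (hB : HolderWith B ρ f) :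
    ∃ g : HolderSpace ρ K Y, (∀ x, g x = f x) ∧ ‖g‖ ≤ A + B := by
  let g : HolderSpace ρ K Y := ⟨⟨f, hB.continuous hρ⟩, hB.memHolder⟩
  refine ⟨g, fun x => rfl, ?_⟩
  rw [norm_def]
  refine add_le_add ((ContinuousMap.norm_le _ A.2).2 hA) ?_
  exact_mod_cast hB.nnholderNorm_le

theorem norm_apply_le (f : HolderSpace ρ K Y) (x : K) : ‖f x‖ ≤ ‖f‖ := by
  rw [norm_def]
  exact (f.toContinuousMap.norm_coe_le_norm x).trans (le_add_of_nonneg_right NNReal.zero_le_coe)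

theorem norm_apply_sub_apply_le (f : HolderSpace ρ K Y) (x y : K) :
    ‖f x - f y‖ ≤ ‖f‖ * dist x y ^ (ρ : ℝ) := by
  rw [← dist_eq_norm]
  refine (f.memHolder.holderWith.dist_le x y).trans ?_
  gcongr
  rw [norm_def]
  exact le_add_of_nonneg_left (norm_nonneg _)

variable (ρ Y) in
/-- Evaluation at a point. -/
def evalCLM (x : K) : HolderSpace ρ K Y →L[ℝ] Y :=
  LinearMap.mkContinuous
    { toFun := fun f => f x
      map_add' := fun _ _ => rfl
      map_smul' := fun _ _ => rfl } 1 fun f => by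
    rw [one_mul]
    exact norm_apply_le f x

/-- A bound up to finitely many functionals for an operator transfers to Hölder functions. -/
theorem exists_bound_apply (hρ : 0 < ρ) (T : Y →L[ℝ] Z)
    (hT : ∀ η : ℝ, 0 < η → ∃ (n : ℕ) (ℓ : Fin n → (Y →L[ℝ] ℝ)),
      ∀ g, ‖T g‖ ≤ η * ‖g‖ + ∑ i, |ℓ i g|) {ε : ℝ} (hε : 0 < ε) :
    ∃ (n : ℕ) (ℓ : Fin n → (HolderSpace ρ K Y →L[ℝ] ℝ)),
      ∀ (f : HolderSpace ρ K Y) (x : K), ‖T (f x)‖ ≤ ε * ‖f‖ + ∑ i, |ℓ i f| := by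
  obtain ⟨n, ℓ, hℓ⟩ := hT (ε / 2) (half_pos hε)
  have hρ' : (ρ : ℝ) ≠ 0 := by exact_mod_cast hρ.ne'
  -- As in the Arzelà–Ascoli theorem, moving x to a point of a δ-net costs `ε / 2` by Hölder
  -- continuity. At the finitely many net points the bound for `T` costs another `ε / 2`, plus its
  -- functionals composed with evaluation there.
  obtain ⟨δ, hδ0, hδ⟩ : ∃ δ : ℝ, 0 < δ ∧ ‖T‖ * δ ^ (ρ : ℝ) ≤ ε / 2 := by
    refine ⟨(ε / 2 / (‖T‖ + 1)) ^ (1 / (ρ : ℝ)), by positivity, ?_⟩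
    rw [← Real.rpow_mul (by positivity), one_div_mul_cancel hρ', Real.rpow_one, ← mul_div_assoc,
      div_le_iff₀ (by positivity), mul_comm]
    gcongr
    linarith
  obtain ⟨t, -, htf, htc⟩ := finite_cover_balls_of_compact (X := K) isCompact_univ hδ0
  have : Fintype t := htf.fintype
  let e := Fintype.equivFin (t × Fin n)
  refine ⟨Fintype.card (t × Fin n),
    fun i => (ℓ (e.symm i).2).comp (evalCLM ρ Y (e.symm i).1.1), fun f x => ?_⟩
  have hsum : ∑ i, |((ℓ (e.symm i).2).comp (evalCLM ρ Y (e.symm i).1.1)) f| =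
      ∑ i : t × Fin n, |ℓ i.2 (f i.1.1)| :=
    Equiv.sum_comp e.symm fun i : t × Fin n => |ℓ i.2 (f i.1.1)|
  obtain ⟨z, hz, hxz⟩ := mem_iUnion₂.1 (htc (mem_univ x))
  have h1 : ‖T (f x - f z)‖ ≤ ε / 2 * ‖f‖ := by
    calc ‖T (f x - f z)‖ ≤ ‖T‖ * (‖f‖ * δ ^ (ρ : ℝ)) := by
          refine (T.le_opNorm _).trans ?_
          gcongr
          refine (norm_apply_sub_apply_le f x z).trans ?_
          gcongr
          exact (Metric.mem_ball.1 hxz).le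
      _ = (‖T‖ * δ ^ (ρ : ℝ)) * ‖f‖ := by ring
      _ ≤ ε / 2 * ‖f‖ := by gcongr
  have h2 : ‖T (f z)‖ ≤ ε / 2 * ‖f‖ + ∑ i : t × Fin n, |ℓ i.2 (f i.1.1)| := by
    refine (hℓ (f z)).trans ?_
    gcongr
    · exact norm_apply_le f z
    · rw [Fintype.sum_prod_type]
      exact Finset.single_le_sum (f := fun y : t => ∑ j, |ℓ j (f y.1)|)
        (fun y _ => Finset.sum_nonneg fun j _ => abs_nonneg _) (Finset.mem_univ (⟨z, hz⟩ : t))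
  rw [hsum]
  have h3 : T (f x) = T (f x - f z) + T (f z) := by rw [← map_add, sub_add_cancel]
  rw [h3]
  refine (norm_add_le _ _).trans ((add_le_add h1 h2).trans (le_of_eq ?_))
  ring

/-- Hölder functions on an interval are determined by their values almost everywhere. -/
theorem ext_of_ae_eq {T₀ T₁ : ℝ} (hT : T₀ < T₁) {f g : HolderSpace ρ (Icc T₀ T₁) Y}
    (hfg : ∀ᵐ t ∂(volume.restrict (Ioo T₀ T₁)), f (projIcc T₀ T₁ hT.le t) =
      g (projIcc T₀ T₁ hT.le t)) : f = g := by
  have hf : Continuous fun t => f (projIcc T₀ T₁ hT.le t) :=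
    f.toContinuousMap.continuous.comp continuous_projIcc
  have hg : Continuous fun t => g (projIcc T₀ T₁ hT.le t) :=
    g.toContinuousMap.continuous.comp continuous_projIcc
  have h1 := (Measure.eqOn_open_of_ae_eq hfg isOpen_Ioo hf.continuousOn hg.continuousOn).closure
    hf hg
  rw [closure_Ioo hT.ne] at h1
  refine Subtype.ext (ContinuousMap.ext fun t => ?_)
  have h2 := h1 t.2
  simp only [projIcc_val] at h2
  exact h2

/-- The class in `L^s` of the composition of a Hölder function with a bounded operator. -/
theorem exists_compLp {T₀ T₁ : ℝ} (hT : T₀ < T₁) (T : Y →L[ℝ] Z) (s : ℝ≥0∞) [Fact (1 ≤ s)] :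
    ∃ S : HolderSpace ρ (Icc T₀ T₁) Y →L[ℝ] Lp Z s (volume.restrict (Ioo T₀ T₁)),
      ∀ f, ∀ᵐ t ∂(volume.restrict (Ioo T₀ T₁)), S f t = T (f (projIcc T₀ T₁ hT.le t)) := by
  -- This is the length of the interval to the power 1/s. For `s = ⊤` the exponent is 0 and `D` is
  -- 1, so this case needs no separate treatment.
  let D : ℝ := (measureUnivNNReal (volume.restrict (Ioo T₀ T₁)) : ℝ) ^ s.toReal⁻¹
  refine (exists_clm_of_relation
    (fun (f : HolderSpace ρ (Icc T₀ T₁) Y) (F : Lp Z s (volume.restrict (Ioo T₀ T₁))) =>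
      ∀ᵐ t ∂(volume.restrict (Ioo T₀ T₁)), F t = T (f (projIcc T₀ T₁ hT.le t))) (D * ‖T‖)
    ?_ ?_ ?_ ?_).imp fun S hS f => (hS f).1
  · intro f g F G hF hG
    filter_upwards [hF, hG, Lp.coeFn_add F G] with t h1 h2 h3
    rw [h3, Pi.add_apply, h1, h2, ← map_add]
    rfl
  · intro c f F hF
    filter_upwards [hF, Lp.coeFn_smul c F] with t h1 h2
    rw [h2, Pi.smul_apply, h1, ← map_smul]
    rfl
  · intro f F G hF hG
    refine Lp.ext ?_
    filter_upwards [hF, hG] with t h1 h2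
    rw [h1, h2]
  · intro f
    have hle : ∀ t, ‖T (f (projIcc T₀ T₁ hT.le t))‖ ≤ ‖T‖ * ‖f‖ := fun t =>
      (T.le_opNorm _).trans (by gcongr; exact norm_apply_le f _)
    have hm : MemLp (fun t => T (f (projIcc T₀ T₁ hT.le t))) s (volume.restrict (Ioo T₀ T₁)) :=
      MemLp.of_bound (T.continuous.comp (f.toContinuousMap.continuous.comp
        continuous_projIcc)).aestronglyMeasurable _ (Eventually.of_forall hle)
    refine ⟨hm.toLp, hm.coeFn_toLp, ?_⟩
    rw [mul_assoc]
    refine Lp.norm_le_of_ae_bound (by positivity) ?_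
    filter_upwards [hm.coeFn_toLp] with t ht
    rw [ht]
    exact hle t

/-- The bound of `exists_bound_apply` is uniform in time, so integrating it in any L^s over a
bounded interval preserves its form, and the compactness criterion applies. -/
theorem isCompactOperator_of_compLp [CompleteSpace Z] (hρ : 0 < ρ) {T₀ T₁ : ℝ} (hT : T₀ < T₁)
    {T : Y →L[ℝ] Z}
    (hTc : ∀ η : ℝ, 0 < η → ∃ (n : ℕ) (ℓ : Fin n → (Y →L[ℝ] ℝ)),
      ∀ g, ‖T g‖ ≤ η * ‖g‖ + ∑ i, |ℓ i g|) {s : ℝ≥0∞} [Fact (1 ≤ s)]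
    {S : HolderSpace ρ (Icc T₀ T₁) Y →L[ℝ] Lp Z s (volume.restrict (Ioo T₀ T₁))}
    (hS : ∀ f, ∀ᵐ t ∂(volume.restrict (Ioo T₀ T₁)), S f t = T (f (projIcc T₀ T₁ hT.le t))) :
    IsCompactOperator S := by
  refine isCompactOperator_of_forall_norm_le S fun ε hε => ?_
  let D : ℝ := (measureUnivNNReal (volume.restrict (Ioo T₀ T₁)) : ℝ) ^ s.toReal⁻¹
  have hD : 0 ≤ D := by positivity
  obtain ⟨n, ℓ, hℓ⟩ := exists_bound_apply (ρ := ρ) (K := Icc T₀ T₁) hρ T hTc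
    (ε := ε / (D + 1)) (by positivity)
  refine ⟨n, fun i => D • ℓ i, fun f => ?_⟩
  have h1 : ‖S f‖ ≤ D * (ε / (D + 1) * ‖f‖ + ∑ i, |ℓ i f|) := by
    refine Lp.norm_le_of_ae_bound
      (add_nonneg (by positivity) (Finset.sum_nonneg fun i _ => abs_nonneg _)) ?_
    filter_upwards [hS f] with t ht
    rw [ht]
    exact hℓ f _
  refine h1.trans ?_
  rw [mul_add, Finset.mul_sum]
  refine add_le_add ?_ (Finset.sum_le_sum fun i _ => ?_)
  · rw [← mul_assoc]
    gcongr
    rw [← mul_div_assoc, div_le_iff₀ (by positivity), mul_comm]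
    gcongr
    linarith
  · rw [smul_apply, smul_eq_mul, abs_mul, abs_of_nonneg hD]

end HolderSpace

end Holder

/-! ### Embedding the control space -/

section Control

variable {Ω ΓD : Set E3} {T₀ T₁ : ℝ}

theorem controlValue_add {p : ℝ≥0∞} [Fact (1 ≤ p)] (u v : controlSpace Ω ΓD T₀ T₁ p) :
    ∀ᵐ t ∂(volume.restrict (Ioo T₀ T₁)),
      controlValue (u + v) t = controlValue u t + controlValue v t :=
  Lp.coeFn_add u.1.fst.fn v.1.fst.fn

theorem controlValue_smul {p : ℝ≥0∞} [Fact (1 ≤ p)] (c : ℝ) (u : controlSpace Ω ΓD T₀ T₁ p) :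
    ∀ᵐ t ∂(volume.restrict (Ioo T₀ T₁)), controlValue (c • u) t = c • controlValue u t :=
  Lp.coeFn_smul c u.1.fst.fn

/-- A control vanishing at almost every time vanishes. -/
theorem controlSpace_eq_zero {p : ℝ≥0∞} [Fact (1 ≤ p)] {u : controlSpace Ω ΓD T₀ T₁ p}
    (hu : ∀ᵐ t ∂(volume.restrict (Ioo T₀ T₁)),
      controlValue u t =ᵐ[boundaryMeasure Ω ΓD] (0 : E3 → ℝ)) : u = 0 := by
  have h1 : u.1.fst = 0 := by
    refine TimeSobolev.eq_zero_of_fn_eq_zero ((Lp.eq_zero_iff_ae_eq_zero).2 ?_)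
    filter_upwards [hu] with t ht
    exact (Lp.eq_zero_iff_ae_eq_zero).2 ht
  have h2 : u.1.snd = 0 := by
    refine (Lp.eq_zero_iff_ae_eq_zero).2 ?_
    filter_upwards [hu, u.2] with t ht ht'
    exact (Lp.eq_zero_iff_ae_eq_zero).2 (ht'.symm.trans ht)
  exact Subtype.ext ((WithLp.equiv 1 _).injective (Prod.ext h1 h2))

/-- The control space embeds into a Hölder space. -/
theorem exists_holder_embedding [IsFiniteMeasure (boundaryMeasure Ω ΓD)] (hT : T₀ < T₁) {p P : ℝ}
    [Fact (1 ≤ ENNReal.ofReal p)] [Fact (1 ≤ ENNReal.ofReal P)] (hp : 2 < p) (hP : 2 < P)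
    (hPp : P < (p + 2) / 2) :
    ∃ ρ : ℝ≥0, 0 < ρ ∧ ρ < 1 ∧ ∃ E : controlSpace Ω ΓD T₀ T₁ (ENNReal.ofReal p) →L[ℝ]
      HolderSpace ρ (Icc T₀ T₁) (Lp ℝ (ENNReal.ofReal P) (boundaryMeasure Ω ΓD)),
      ∀ u, ∀ᵐ t ∂(volume.restrict (Ioo T₀ T₁)),
        (E u (projIcc T₀ T₁ hT.le t) : E3 → ℝ) =ᵐ[boundaryMeasure Ω ΓD] controlValue u t := by
  obtain ⟨ρ, C, hρ0, hρ1, hC⟩ := exists_holder_bound (μ := boundaryMeasure Ω ΓD) hT hp hP hPp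
  refine ⟨ρ, hρ0, hρ1, ?_⟩
  refine (exists_clm_of_relation
    (fun (u : controlSpace Ω ΓD T₀ T₁ (ENNReal.ofReal p))
      (f : HolderSpace ρ (Icc T₀ T₁) (Lp ℝ (ENNReal.ofReal P) (boundaryMeasure Ω ΓD))) =>
      ∀ᵐ t ∂(volume.restrict (Ioo T₀ T₁)),
        (f (projIcc T₀ T₁ hT.le t) : E3 → ℝ) =ᵐ[boundaryMeasure Ω ΓD] controlValue u t) (C + C)
    ?_ ?_ ?_ ?_).imp fun E hE u => (hE u).1
  · intro u v f g hf hg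
    filter_upwards [hf, hg, controlValue_add u v] with t h1 h2 h3
    rw [h3]
    exact (Lp.coeFn_add (f (projIcc T₀ T₁ hT.le t)) (g (projIcc T₀ T₁ hT.le t))).trans
      ((h1.add h2).trans (Lp.coeFn_add _ _).symm)
  · intro c u f hf
    filter_upwards [hf, controlValue_smul c u] with t h1 h2
    rw [h2]
    exact (Lp.coeFn_smul c (f (projIcc T₀ T₁ hT.le t))).trans
      ((h1.const_smul c).trans (Lp.coeFn_smul _ _).symm)
  · intro u f g hf hg
    refine HolderSpace.ext_of_ae_eq hT ?_
    filter_upwards [hf, hg] with t h1 h2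
    exact Lp.ext (h1.trans h2.symm)
  · intro u
    obtain ⟨U, hU1, hU2⟩ := u.1.fst.exists_representative hT
    have hdt : ‖u.1.fst.dt‖ₑ ≤ (‖u‖₊ : ℝ≥0∞) := by
      rw [← enorm_eq_nnnorm, enorm_le_iff_norm_le]
      exact (TimeSobolev.norm_dt_le _).trans (WithLp.norm_fst_le _ u.1)
    have hsnd : ‖u.1.snd‖ₑ ≤ (‖u‖₊ : ℝ≥0∞) := by
      rw [← enorm_eq_nnnorm, enorm_le_iff_norm_le]
      exact WithLp.norm_snd_le _ u.1
    have hUy : ∀ᵐ t ∂(volume.restrict (Ioo T₀ T₁)),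
        (U t : E3 → ℝ) =ᵐ[boundaryMeasure Ω ΓD] u.1.snd t := by
      filter_upwards [hU1, u.2] with t h1 h2
      rwa [← h1]
    obtain ⟨h1, h2⟩ := hC U ‖u‖₊ u.1.snd (fun s t => (hU2 s t).trans (by gcongr)) hsnd hUy
    have hm : ∀ t : Icc T₀ T₁, MemLp (U t) (ENNReal.ofReal P) (boundaryMeasure Ω ΓD) := fun t =>
      ⟨Lp.aestronglyMeasurable _, (h1 t t.2).trans_lt
        (ENNReal.mul_lt_top ENNReal.coe_lt_top ENNReal.coe_lt_top)⟩
    obtain ⟨f, hf1, hf2⟩ := HolderSpace.exists_of_bounds (f := fun t => (hm t).toLp) hρ0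
      (A := C * ‖u‖₊) (B := C * ‖u‖₊) (fun t => by
        rw [Lp.norm_toLp]
        refine ENNReal.toReal_le_of_le_ofReal (by positivity) ((h1 t t.2).trans_eq ?_)
        rw [← ENNReal.coe_mul, ENNReal.ofReal_coe_nnreal]) (fun s t => by
        rw [Lp.edist_toLp_toLp, ← eLpNorm_congr_ae (Lp.coeFn_sub (U s) (U t))]
        refine (h2 s s.2 t t.2).trans_eq ?_
        rw [ENNReal.coe_mul, mul_right_comm, edist_dist, Subtype.dist_eq, Real.dist_eq,
          ENNReal.ofReal_rpow_of_nonneg (abs_nonneg _) (NNReal.coe_nonneg ρ)])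
    refine ⟨f, ?_, hf2.trans_eq ?_⟩
    · filter_upwards [hU1, ae_restrict_mem measurableSet_Ioo] with t ht ht'
      rw [projIcc_of_mem hT.le (Ioo_subset_Icc_self ht'), hf1, controlValue, ht]
      exact (hm _).coeFn_toLp
    · push_cast
      ring

theorem injective_of_ae_eq_controlValue (hT : T₀ < T₁) {p P : ℝ≥0∞} [Fact (1 ≤ p)] [Fact (1 ≤ P)]
    {ρ : ℝ≥0} {E : controlSpace Ω ΓD T₀ T₁ p →L[ℝ]
      HolderSpace ρ (Icc T₀ T₁) (Lp ℝ P (boundaryMeasure Ω ΓD))}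
    (hE : ∀ u, ∀ᵐ t ∂(volume.restrict (Ioo T₀ T₁)),
      (E u (projIcc T₀ T₁ hT.le t) : E3 → ℝ) =ᵐ[boundaryMeasure Ω ΓD] controlValue u t) :
    Function.Injective E := by
  refine (injective_iff_map_eq_zero E).2 fun u hu => controlSpace_eq_zero ?_
  filter_upwards [hE u] with t ht
  rw [hu] at ht
  exact ht.symm.trans (Lp.coeFn_zero _ _ _)

/-- A boundary function is determined by its action on test functions. -/
theorem eq_zero_of_boundaryFunctional_eq_zero (hΩ : IsOpen Ω)
    [IsFiniteMeasure (boundaryMeasure Ω ΓD)] (hΓD : IsClosed ΓD) {P r : ℝ≥0∞}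
    [hP : Fact (1 ≤ P)] [Fact (1 ≤ r)] {T : Lp ℝ P (boundaryMeasure Ω ΓD) →L[ℝ] NegSobolev Ω ΓD r}
    (hT : ∀ g (w : sobolevOff Ω ΓD r) (ψ : E3 → ℝ), IsTestFunctionOff ΓD ψ →
      w.1.fn =ᵐ[volume.restrict Ω] ψ → T g w = ∫ x, g x * ψ x ∂(boundaryMeasure Ω ΓD))
    {g : Lp ℝ P (boundaryMeasure Ω ΓD)} (hg : T g = 0) : g = 0 := by
  -- Smooth functions with compact support in the open complement of Γ_D are admissible test
  -- functions, and that complement carries all of the boundary measure on Γ_N.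
  have key := hΓD.isOpen_compl.ae_eq_zero_of_integral_contDiff_smul_eq_zero
    (μ := boundaryMeasure Ω ΓD) (f := g)
    (((Lp.memLp g).locallyIntegrable hP.out).locallyIntegrableOn _) ?_
  · refine (Lp.eq_zero_iff_ae_eq_zero).2 ?_
    filter_upwards [key, ae_boundaryMeasure_mem hΓD] with x hx hx'
    exact hx hx'.2
  · intro ψ h1 h2 h3
    have hψ : IsTestFunctionOff ΓD ψ := ⟨h1, h2, subset_compl_iff_disjoint_right.1 h3⟩
    obtain ⟨w, hw⟩ := exists_fn_ae_eq (Ω := Ω) (r := r) ΓD hψ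
    have hmem : w ∈ sobolevOff Ω ΓD r :=
      (sobolevTest Ω ΓD r).le_topologicalClosure (mem_sobolevTest hΩ hψ hw)
    have h4 := hT g ⟨w, hmem⟩ ψ hψ hw
    rw [hg] at h4
    simp only [smul_eq_mul]
    simp_rw [mul_comm (ψ _)]
    exact h4.symm

end Control

end Thermistor

end

/-! ### The two embeddings -/

theorem proposition4p12
    (Ω ΓD : Set Thermistor.E3) (hΩ : Thermistor.IsBoundedLipschitzDomain Ω)
    (hΓD : IsClosed ΓD) (hΓDΩ : ΓD ⊆ frontier Ω)
    (T₀ T₁ : ℝ) (hT : T₀ < T₁)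
    (p : ℝ) [Fact (1 ≤ ENNReal.ofReal p)] (hp : 2 < p) :
    (∀ (𝔭 : ℝ) [Fact (1 ≤ ENNReal.ofReal 𝔭)], 2 < 𝔭 → 𝔭 < (p + 2) / 2 →
      ∃ ϱ : ℝ≥0, 0 < ϱ ∧ ϱ < 1 ∧
        ∃ E : Thermistor.controlSpace Ω ΓD T₀ T₁ (ENNReal.ofReal p) →L[ℝ]
            Thermistor.HolderSpace ϱ (Icc T₀ T₁)
              (Lp ℝ (ENNReal.ofReal 𝔭) (Thermistor.boundaryMeasure Ω ΓD)),
          Function.Injective E ∧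
          ∀ u, ∀ᵐ t : ℝ, ∀ ht : t ∈ Ioo T₀ T₁,
            (E u ⟨t, Ioo_subset_Icc_self ht⟩ : Thermistor.E3 → ℝ)
              =ᵐ[Thermistor.boundaryMeasure Ω ΓD] Thermistor.controlValue u t) ∧
    (∀ (q q' : ℝ) [Fact (1 ≤ ENNReal.ofReal q')], q.HolderConjugate q' → 4 / 3 * q - 2 < p →
      ∀ (s : ℝ≥0∞) [Fact (1 ≤ s)],
        ∃ 𝓔 : Thermistor.controlSpace Ω ΓD T₀ T₁ (ENNReal.ofReal p) →L[ℝ]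
            Lp (Thermistor.NegSobolev Ω ΓD (ENNReal.ofReal q')) s (volume.restrict (Ioo T₀ T₁)),
          Function.Injective 𝓔 ∧ IsCompactOperator 𝓔 ∧
          -- `𝓔` is the natural embedding: `𝓔 u (t)` is the functional `ψ ↦ ∫_{Γ_N} u(t) ψ dω`,
          -- determined by its values on the dense set of restrictions of test functions
          ∀ u, ∀ᵐ t ∂(volume.restrict (Ioo T₀ T₁)),
            ∀ (w : Thermistor.sobolevOff Ω ΓD (ENNReal.ofReal q')) (ψ : Thermistor.E3 → ℝ),
              Thermistor.IsTestFunctionOff ΓD ψ → w.1.fn =ᵐ[volume.restrict Ω] ψ →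
              𝓔 u t w =
                ∫ x, Thermistor.controlValue u t x * ψ x ∂(Thermistor.boundaryMeasure Ω ΓD)) := by
  have hfin := Thermistor.isFiniteMeasure_boundaryMeasure hΩ ΓD
  constructor
  · intro 𝔭 _ h1 h2
    obtain ⟨ϱ, h3, h4, E, hE⟩ :=
      Thermistor.exists_holder_embedding (Ω := Ω) (ΓD := ΓD) hT hp h1 h2
    refine ⟨ϱ, h3, h4, E, Thermistor.injective_of_ae_eq_controlValue hT hE, fun u => ?_⟩
    filter_upwards [(ae_restrict_iff' measurableSet_Ioo).1 (hE u)] with t h5 ht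
    have h6 := h5 ht
    rwa [projIcc_of_mem hT.le (Ioo_subset_Icc_self ht)] at h6
  · intro q q' _ hq hqp s _
    -- The intermediate exponent must be below (p+2)/2 for the Hölder embedding and above 2q/3 for
    -- the trace estimate. The gap is open because p > 4q/3 - 2 and p > 2.
    obtain ⟨𝔭, h1, h2⟩ : ∃ 𝔭, max 2 (2 / 3 * q) < 𝔭 ∧ 𝔭 < (p + 2) / 2 :=
      exists_between (max_lt (by linarith) (by linarith))
    have h3 : 2 < 𝔭 := (le_max_left _ _).trans_lt h1
    have h4 : 2 / 3 * q < 𝔭 := (le_max_right _ _).trans_lt h1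
    have : Fact (1 ≤ ENNReal.ofReal 𝔭) := ⟨by
      rw [← ENNReal.ofReal_one]
      exact ENNReal.ofReal_le_ofReal (by linarith)⟩
    obtain ⟨ϱ, hϱ, -, E, hE⟩ :=
      Thermistor.exists_holder_embedding (Ω := Ω) (ΓD := ΓD) hT hp h3 h2
    obtain ⟨T, hT1, hT2⟩ := Thermistor.exists_boundaryFunctional hΩ hΓD (P := 𝔭) (by linarith) hq h4
    obtain ⟨S, hS⟩ := Thermistor.HolderSpace.exists_compLp (ρ := ϱ) hT T s
    have hS' : ∀ u, ∀ᵐ t ∂(volume.restrict (Ioo T₀ T₁)), S.comp E u t =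
        T (E u (projIcc T₀ T₁ hT.le t)) := fun u => hS (E u)
    refine ⟨S.comp E, ?_, ?_, fun u => ?_⟩
    -- If the image vanishes, then `T` annihilates `E u` at almost every time. Injectivity of `T`
    -- makes these values zero, and by continuity in time `E u` is zero.
    · refine (injective_iff_map_eq_zero (S.comp E)).2 fun u hu =>
        Thermistor.injective_of_ae_eq_controlValue hT hE ?_
      rw [map_zero]
      refine Thermistor.HolderSpace.ext_of_ae_eq hT ?_
      have h5 := hS' u
      rw [hu] at h5
      filter_upwards [h5, Lp.coeFn_zero (Thermistor.NegSobolev Ω ΓD (ENNReal.ofReal q')) s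
        (volume.restrict (Ioo T₀ T₁))] with t h6 h7
      rw [h7, Pi.zero_apply] at h6
      exact Thermistor.eq_zero_of_boundaryFunctional_eq_zero hΩ.isOpen hΓD hT1 h6.symm
    · exact (Thermistor.HolderSpace.isCompactOperator_of_compLp hϱ hT hT2 hS).comp_clm E
    · filter_upwards [hE u, hS' u] with t h5 h6 w ψ hψ hw
      rw [h6, hT1 _ w ψ hψ hw]
      exact integral_congr_ae (h5.mono fun x hx => by simp only [hx])
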